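/- Let $k$ be a field of characteristic $0$ (for instance $k=\mathbf{C}$). Call a $k$-scheme *smooth, possibly of infinite type*, if Zariski locally it is étale over an affine space $\operatorname{Spec} k[x_j : j\in J]$ with $J$ a possibly infinite set of coordinates. A *log pair* $(X,D)$ is such a scheme $X$ with a reduced simple normal crossings divisor $D$: each point has an affine open neighbourhood with étale coordinates as above such that only finitely many irreducible components of $D$ meet it, and their ideals are generated by distinct coordinates. (Every smooth variety over $k$ with a simple normal crossings divisor is a log pair.) A morphism of log pairs $(Y,D_Y)\to(X,D)$ is a morphism of $k$-schemes $f:Y\to X$ with $f^{-1}(D)\subseteq D_Y$. A *log commutative vertex scheme* (lcvs) is a tuple $(X,D,\partial)$ with $(X,D)$ a log pair and $\partial$ a vector field on $X$, i.e. a $k$-linear derivation of $\mathcal{O}_X$, that is tangent to $D$, i.e. preserves the ideal sheaf of $D$; a morphism of lcvs is a morphism of log pairs compatible with the vector fields. For a $k$-algebra $B$ let $JB$ be the $k$-algebra generated by symbols $b(n)$ ($b\in B$, $n\ge 0$), $k$-linear in $b$, with $1(n)=\delta_{n,0}$ and $(ab)(n)=\sum_{i+j=n}a(i)b(j)$, with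 derivation $\partial b(n)=(n+1)b(n+1)$. For a log pair $(X,D)$ with components $D_i$, the *log jet space* $\pi: J_{\log D}(X)\to X$ is the relative spectrum over $X$ of the sheaf of algebras whose sections over an affine open $U$ form the smallest subring of $J\,\mathcal{O}(U\setminus D)$ that is closed under $\partial$ and contains $\mathcal{O}(U)$ and all $y\,\partial x$ with $x\in\mathcal{O}(-D_i)(U)$ and $y\in\mathcal{O}(D_i)(U)$. Locally, where $D_i$ has an equation $\gamma^i$, it is generated under $\partial$ by the functions on $X$ and the $\partial\gamma^i/\gamma^i$. Let $\widetilde D$ be the pull-back $\pi^{-1}(D)$. **Lemma.** For every log pair $(X,D)$, the scheme-theoretic pull-back of $D$ is reduced (so it is $\widetilde D$), and there is a vector field $\partial$ on $J_{\log D}(X)$ that restricts to the derivation $\partial$ of the algebra of log jets over each affine open $U\subseteq X$, such that $(J_{\log D}(X),\widetilde D,\partial)$ is an lcvs. It is the free lcvs on $(X,D)$: the assignment $(X,D)\mapsto (J_{\log D}(X),\widetilde D,\partial)$ is (the object part of) a right adjoint to the forgetful functor $(Y,D_Y,\partial_Y)\mapsto(Y,D_Y)$ from lcvs to log pairs, with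 the projections $\pi$ as counit. That is, every morphism of log pairs $(Y,D_Y)\to(X,D)$ from an lcvs $(Y,D_Y,\partial_Y)$ factors through $\pi$ by a unique morphism of lcvs $(Y,D_Y,\partial_Y)\to(J_{\log D}(X),\widetilde D,\partial)$. -/

import Mathlib

universe u

noncomputable section

namespace LogJets

section Jets

variable {k B C R : Type*} [CommRing k] [CommRing B] [CommRing C] [CommRing R]

/-- The relations imposed on the symbols `a(n)`, `a ∈ B`, `n ≥ 0`. -/
inductive JetRel (φ : k →+* B) : MvPolynomial (B × ℕ) k → MvPolynomial (B × ℕ) k → Prop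
  | const (c : k) (n : ℕ) :
      JetRel φ (MvPolynomial.X (φ c, n)) (if n = 0 then MvPolynomial.C c else 0)
  | add (a b : B) (n : ℕ) :
      JetRel φ (MvPolynomial.X (a + b, n)) (MvPolynomial.X (a, n) + MvPolynomial.X (b, n))
  | mul (a b : B) (n : ℕ) :
      JetRel φ (MvPolynomial.X (a * b, n))
        (∑ p ∈ Finset.HasAntidiagonal.antidiagonal n, MvPolynomial.X (a, p.1) * MvPolynomial.X (b, p.2))

/-- The ideal generated by the relations between the symbols `a(n)`. -/
def jetIdeal (φ : k →+* B) : Ideal (MvPolynomial (B × ℕ) k) :=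
  Ideal.span {p | ∃ q r, JetRel φ q r ∧ q - r = p}

/-- The algebra of functions on the jet space of `Spec B`, for a `k`-algebra `φ : k → B`: the
`k`-algebra generated by symbols `a(n)`, `k`-linear in `a`, subject to `1(n) = δ_{n,0}` and
`(ab)(n) = ∑_{i+j=n} a(i) b(j)`. -/
def JetAlgebra (φ : k →+* B) : Type _ := MvPolynomial (B × ℕ) k ⧸ jetIdeal φ

instance (φ : k →+* B) : CommRing (JetAlgebra φ) :=
  inferInstanceAs (CommRing (MvPolynomial (B × ℕ) k ⧸ jetIdeal φ))

instance (φ : k →+* B) : Algebra k (JetAlgebra φ) :=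
  inferInstanceAs (Algebra k (MvPolynomial (B × ℕ) k ⧸ jetIdeal φ))

namespace JetAlgebra

variable (φ : k →+* B)

/-- The quotient map from the polynomial algebra on the symbols `a(n)`. -/
def proj : MvPolynomial (B × ℕ) k →ₐ[k] JetAlgebra φ := Ideal.Quotient.mkₐ k (jetIdeal φ)

theorem proj_surjective : Function.Surjective (proj φ) := Ideal.Quotient.mkₐ_surjective k _

theorem proj_eq_zero_iff {p : MvPolynomial (B × ℕ) k} : proj φ p = 0 ↔ p ∈ jetIdeal φ :=
  Ideal.Quotient.eq_zero_iff_mem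

/-- The symbol `a(n)`. -/
def sym (a : B) (n : ℕ) : JetAlgebra φ := proj φ (MvPolynomial.X (a, n))

theorem proj_eq_of_rel {p q : MvPolynomial (B × ℕ) k} (h : JetRel φ p q) :
    proj φ p = proj φ q := by
  rw [← sub_eq_zero, ← map_sub, proj_eq_zero_iff]
  exact Ideal.subset_span ⟨p, q, h, rfl⟩

theorem sym_const (c : k) (n : ℕ) :
    sym φ (φ c) n = if n = 0 then algebraMap k (JetAlgebra φ) c else 0 := by
  refine (proj_eq_of_rel φ (.const c n)).trans ?_
  split_ifs
  · exact (proj φ).commutes c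
  · exact map_zero _

theorem sym_add (a b : B) (n : ℕ) : sym φ (a + b) n = sym φ a n + sym φ b n :=
  (proj_eq_of_rel φ (.add a b n)).trans (map_add _ _ _)

theorem sym_mul (a b : B) (n : ℕ) :
    sym φ (a * b) n = ∑ p ∈ Finset.HasAntidiagonal.antidiagonal n, sym φ a p.1 * sym φ b p.2 := by
  refine (proj_eq_of_rel φ (.mul a b n)).trans ?_
  simp [map_sum, sym]

theorem induction_on {P : JetAlgebra φ → Prop} (x : JetAlgebra φ)
    (const : ∀ c, P (algebraMap k _ c)) (sym : ∀ a n, P (sym φ a n))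
    (add : ∀ x y, P x → P y → P (x + y)) (mul : ∀ x y, P x → P y → P (x * y)) : P x := by
  obtain ⟨p, rfl⟩ := proj_surjective φ x
  induction p using MvPolynomial.induction_on with
  | C c => exact ((proj φ).commutes c).symm ▸ const c
  | add p q hp hq => rw [map_add]; exact add _ _ hp hq
  | mul_X p i hp => rw [map_mul]; exact mul _ _ hp (sym i.1 i.2)

/-- The derivation `a(n) ↦ (n + 1) a(n + 1)` of the polynomial algebra on the symbols `a(n)`. -/
def polyDer {S : Type*} : Derivation k (MvPolynomial (S × ℕ) k) (MvPolynomial (S × ℕ) k) :=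
  MvPolynomial.mkDerivation k fun p ↦ (p.2 + 1 : ℕ) • MvPolynomial.X (p.1, p.2 + 1)

theorem polyDer_X {S : Type*} (a : S) (n : ℕ) : polyDer (k := k) (MvPolynomial.X (a, n)) =
    (n + 1 : ℕ) • MvPolynomial.X (a, n + 1) := MvPolynomial.mkDerivation_X ..

theorem sum_antidiagonal_der (f g : ℕ → R) (n : ℕ) :
    ∑ p ∈ Finset.HasAntidiagonal.antidiagonal n,
      (f p.1 * ((p.2 + 1 : ℕ) • g (p.2 + 1)) + g p.2 * ((p.1 + 1 : ℕ) • f (p.1 + 1))) =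
    (n + 1 : ℕ) • ∑ p ∈ Finset.HasAntidiagonal.antidiagonal (n + 1), f p.1 * g p.2 := by
  have key : ∀ h : ℕ → ℕ → R, (∑ p ∈ Finset.HasAntidiagonal.antidiagonal (n + 1), p.2 • h p.1 p.2) =
      ∑ p ∈ Finset.HasAntidiagonal.antidiagonal n, (p.2 + 1) • h p.1 (p.2 + 1) := by
    intro h
    rw [Finset.Nat.sum_antidiagonal_succ']
    simp
  have key' : ∀ h : ℕ → ℕ → R, (∑ p ∈ Finset.HasAntidiagonal.antidiagonal (n + 1), p.1 • h p.1 p.2) =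
      ∑ p ∈ Finset.HasAntidiagonal.antidiagonal n, (p.1 + 1) • h (p.1 + 1) p.2 := by
    intro h
    rw [Finset.Nat.sum_antidiagonal_succ]
    simp
  rw [Finset.smul_sum, Finset.sum_add_distrib]
  have : ∑ p ∈ Finset.HasAntidiagonal.antidiagonal (n + 1), (n + 1) • (f p.1 * g p.2) =
      ∑ p ∈ Finset.HasAntidiagonal.antidiagonal (n + 1), (p.2 • (f p.1 * g p.2) + p.1 • (f p.1 * g p.2)) := by
    refine Finset.sum_congr rfl fun p hp ↦ ?_
    rw [← add_smul, add_comm p.2, Finset.HasAntidiagonal.mem_antidiagonal.mp hp]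
  rw [this, Finset.sum_add_distrib, key (fun i j ↦ f i * g j), key' (fun i j ↦ f i * g j)]
  congr 1
  · exact Finset.sum_congr rfl fun p _ ↦ mul_smul_comm _ _ _
  · refine Finset.sum_congr rfl fun p _ ↦ ?_
    rw [mul_smul_comm, mul_comm]

theorem proj_polyDer {p q : MvPolynomial (B × ℕ) k} (h : JetRel φ p q) :
    proj φ (polyDer p) = proj φ (polyDer q) := by
  cases h with
  | const c n =>
    rw [polyDer_X, map_nsmul]
    change _ • sym φ (φ c) (n + 1) = _
    rw [sym_const]
    split_ifs <;> simp_all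
  | add a b n =>
    simp only [map_add, polyDer_X, map_nsmul]
    change _ • sym φ (a + b) (n + 1) = _ • sym φ a (n + 1) + _ • sym φ b (n + 1)
    rw [sym_add, smul_add]
  | mul a b n =>
    simp only [map_sum, Derivation.leibniz, polyDer_X, map_nsmul, map_add, map_mul, smul_eq_mul]
    change _ • sym φ (a * b) (n + 1) = _
    rw [sym_mul]
    exact (sum_antidiagonal_der (sym φ a) (sym φ b) n).symm

theorem proj_polyDer_eq_zero (x : MvPolynomial (B × ℕ) k) (hx : proj φ x = 0) :
    proj φ (polyDer x) = 0 := by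
  rw [proj_eq_zero_iff] at hx
  refine Submodule.span_induction ?_ (by simp) ?_ ?_ hx
  · rintro _ ⟨p, q, h, rfl⟩
    rw [map_sub, map_sub, proj_polyDer φ h, sub_self]
  · intro x y _ _ hx hy
    rw [map_add, map_add, hx, hy, add_zero]
  · intro a x hx' hx
    have : proj φ x = 0 := (proj_eq_zero_iff φ).mpr hx'
    simp [hx, this]

/-- The translation derivation `∂` of the jet algebra, `∂ a(n) = (n + 1) a(n + 1)`. -/
def der : Derivation k (JetAlgebra φ) (JetAlgebra φ) :=
  Derivation.liftOfSurjective (proj_surjective φ) (proj_polyDer_eq_zero φ)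

theorem der_sym (a : B) (n : ℕ) : der φ (sym φ a n) = (n + 1 : ℕ) • sym φ a (n + 1) := by
  refine (Derivation.liftOfSurjective_apply (proj_surjective φ) (proj_polyDer_eq_zero φ) _).trans ?_
  rw [polyDer_X, map_nsmul]
  rfl

variable {φ}

/-- The ring homomorphism out of the jet algebra with prescribed values on the symbols. -/
def lift (g : k →+* R) (s : B → ℕ → R) (hc : ∀ c n, s (φ c) n = if n = 0 then g c else 0)
    (ha : ∀ a b n, s (a + b) n = s a n + s b n)
    (hm : ∀ a b n, s (a * b) n = ∑ p ∈ Finset.HasAntidiagonal.antidiagonal n, s a p.1 * s b p.2) :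
    JetAlgebra φ →+* R :=
  Ideal.Quotient.lift (jetIdeal φ) (MvPolynomial.eval₂Hom g fun p ↦ s p.1 p.2) <| by
    intro x hx
    rw [← RingHom.mem_ker]
    refine (Ideal.span_le.mpr ?_ : jetIdeal φ ≤ _) hx
    rintro _ ⟨p, q, h, rfl⟩
    simp only [SetLike.mem_coe, RingHom.mem_ker, map_sub, sub_eq_zero]
    cases h with
    | const c n => rw [MvPolynomial.coe_eval₂Hom, MvPolynomial.eval₂_X, hc]; split_ifs <;> simp
    | add a b n => simp [ha]
    | mul a b n => simp [hm, map_sum]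

theorem lift_sym (g : k →+* R) (s : B → ℕ → R) (hc ha hm) (a : B) (n : ℕ) :
    lift (φ := φ) g s hc ha hm (sym φ a n) = s a n := by
  refine (Ideal.Quotient.lift_mk _ _ _).trans ?_
  simp

theorem lift_algebraMap (g : k →+* R) (s : B → ℕ → R) (hc ha hm) (c : k) :
    lift (φ := φ) g s hc ha hm (algebraMap k _ c) = g c := by
  refine (Ideal.Quotient.lift_mk _ _ _).trans ?_
  simp

theorem hom_ext {f g : JetAlgebra φ →+* R} (h : ∀ a n, f (sym φ a n) = g (sym φ a n)) :
    f = g := by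
  ext x
  induction x using induction_on with
  | const c => have := sym_const φ c 0; rw [if_pos rfl] at this; rw [← this]; exact h _ _

  | sym a n => exact h a n
  | add x y hx hy => rw [map_add, map_add, hx, hy]
  | mul x y hx hy => rw [map_mul, map_mul, hx, hy]

/-- Functoriality of the jet algebra: `a(n) ↦ (ψ a)(n)`. -/
def map {φ' : k →+* C} (ψ : B →+* C) (h : ψ.comp φ = φ') : JetAlgebra φ →+* JetAlgebra φ' :=
  lift (algebraMap k _) (fun a n ↦ sym φ' (ψ a) n)
    (fun c n ↦ by rw [← sym_const, ← h]; rfl) (fun a b n ↦ by rw [map_add, sym_add])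
    (fun a b n ↦ by rw [map_mul, sym_mul])

@[simp]
theorem map_sym {φ' : k →+* C} (ψ : B →+* C) (h : ψ.comp φ = φ') (a : B) (n : ℕ) :
    map ψ h (sym φ a n) = sym φ' (ψ a) n := lift_sym ..

theorem map_der {φ' : k →+* C} (ψ : B →+* C) (h : ψ.comp φ = φ') (x : JetAlgebra φ) :
    map ψ h (der φ x) = der φ' (map ψ h x) := by
  induction x using induction_on with
  | const c => simp [map, lift_algebraMap]
  | sym a n => rw [der_sym, map_nsmul, map_sym, map_sym, der_sym]
  | add x y hx hy => simp only [map_add, hx, hy]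
  | mul x y hx hy => simp only [Derivation.leibniz, smul_eq_mul, map_add, map_mul, hx, hy]

/-- Elements of `J B` that die in `J B_f` are killed by a power of `f`. -/
theorem exists_pow_mul_eq_zero {φ' : k →+* C} (ψ : B →+* C) (h : ψ.comp φ = φ') (f : B)
    (hf : letI := ψ.toAlgebra; IsLocalization.Away f C) (x : JetAlgebra φ)
    (hx : map ψ h x = 0) : ∃ n : ℕ, sym φ f 0 ^ n * x = 0 := by
  let _ := ψ.toAlgebra
  let S := Localization.Away (sym φ f 0)
  let σ : B →+* PowerSeries S :=
    { toFun := fun a ↦ PowerSeries.mk fun n ↦ algebraMap _ S (sym φ a n)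
      map_one' := by
        ext n
        rw [← map_one φ, PowerSeries.coeff_mk, sym_const, PowerSeries.coeff_one]
        split_ifs <;> simp
      map_zero' := by
        ext n
        rw [← map_zero φ, PowerSeries.coeff_mk, sym_const]
        simp
      map_add' := fun a b ↦ by ext n; simp [sym_add]
      map_mul' := fun a b ↦ by
        ext n; simp [sym_mul, PowerSeries.coeff_mul, map_sum] }
  have hu : IsUnit (σ f) := by
    rw [PowerSeries.isUnit_iff_constantCoeff, ← PowerSeries.coeff_zero_eq_constantCoeff_apply]
    simp only [σ, RingHom.coe_mk, MonoidHom.coe_mk, OneHom.coe_mk, PowerSeries.coeff_mk]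
    exact IsLocalization.Away.algebraMap_isUnit (S := S) (sym φ f 0)
  let τ : C →+* PowerSeries S := IsLocalization.Away.lift f hu
  have hτ : ∀ a, τ (ψ a) = σ a := fun a ↦ IsLocalization.Away.lift_eq f hu a
  let ρ : JetAlgebra φ' →+* S := lift ((algebraMap _ S).comp (algebraMap k (JetAlgebra φ)))
    (fun c n ↦ PowerSeries.coeff n (τ c))
    (fun c n ↦ by
      subst h
      rw [RingHom.comp_apply, hτ]
      simp only [σ, RingHom.coe_mk, MonoidHom.coe_mk, OneHom.coe_mk, PowerSeries.coeff_mk,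
        sym_const]
      split_ifs <;> simp)
    (fun a b n ↦ by simp) (fun a b n ↦ by rw [map_mul, PowerSeries.coeff_mul])
  have hρ : ρ.comp (map ψ h) = algebraMap _ S := by
    refine hom_ext fun a n ↦ ?_
    rw [RingHom.comp_apply, map_sym, lift_sym, hτ]
    simp [σ]
  have : algebraMap _ S x = algebraMap _ S 0 := by
    rw [← hρ, RingHom.comp_apply, hx, map_zero, map_zero]
  obtain ⟨⟨_, n, rfl⟩, hn⟩ := (IsLocalization.eq_iff_exists (Submonoid.powers (sym φ f 0)) S).mp this
  exact ⟨n, by simpa using hn⟩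

end JetAlgebra

end Jets

open AlgebraicGeometry CategoryTheory TopologicalSpace

namespace JetAlgebra

variable {k B C : Type*} [CommRing k] [CommRing B] [CommRing C]

/-- The homomorphism `a ↦ a(0)`. -/
def of (φ : k →+* B) : B →+* JetAlgebra φ where
  toFun a := sym φ a 0
  map_one' := by rw [← map_one φ, sym_const, if_pos rfl, map_one]
  map_zero' := by rw [← map_zero φ, sym_const, if_pos rfl, map_zero]
  map_add' a b := sym_add φ a b 0
  map_mul' a b := by simp [sym_mul]

@[simp]
theorem map_of {φ : k →+* B} {φ' : k →+* C} (ψ : B →+* C) (h : ψ.comp φ = φ') (a : B) :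
    map ψ h (of φ a) = of φ' (ψ a) := map_sym ..

end JetAlgebra

section LogPairs

variable {k : Type u} [Field k]

/-- Restriction of functions. -/
abbrev res {X : Scheme.{u}} {U V : X.Opens} (h : V ≤ U) : Γ(X, U) →+* Γ(X, V) :=
  (X.presheaf.map (homOfLE h).op).hom

theorem res_res {X : Scheme.{u}} {U V W : X.Opens} (h : V ≤ U) (h' : W ≤ V) (a : Γ(X, U)) :
    res h' (res h a) = res (h'.trans h) a := by
  change (X.presheaf.map _ ≫ X.presheaf.map _).hom a = _
  rw [← X.presheaf.map_comp]
  rfl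

/-- The constant functions on an open subset of a `k`-scheme. -/
def consts (X : Over (Spec (.of k))) (U : X.left.Opens) : k →+* Γ(X.left, U) :=
  (res le_top).comp (X.hom.appTop.hom.comp (Scheme.ΓSpecIso (.of k)).inv.hom)

theorem res_comp_consts (X : Over (Spec (.of k))) {U V : X.left.Opens} (h : V ≤ U) :
    (res h).comp (consts X U) = consts X V :=
  RingHom.ext fun _ ↦ res_res ..

/-- The irreducible components of a closed subset. -/
def components {X : Type*} [TopologicalSpace X] (D : Closeds X) : Set (Closeds X) :=
  {Z | Maximal (fun W : Closeds X ↦ IsIrreducible (W : Set X) ∧ W ≤ D) Z}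

/-- `X` is smooth over `k` and `D` is a simple normal crossings divisor near `p`: there are an affine
open neighbourhood `U` of `p` and étale coordinates `φ : k[x_j] → 𝒪(U)` such that only finitely
many irreducible components `Z` of `D` meet `U`, and the ideals of these are generated by distinct
coordinates. For `X` locally of finite type this is the usual notion. The set of coordinates may be
infinite, so that jet spaces, which are locally products of a smooth variety and an
infinite-dimensional affine space, are allowed. -/
def HasLogChart (X : Over (Spec (.of k))) (D : Closeds X.left) (p : X.left) : Prop :=
  ∃ (U : X.left.affineOpens) (J : Type u) (φ : MvPolynomial J k →+* Γ(X.left, U))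
    (σ : {Z ∈ components D | ((Z : Set X.left) ∩ U).Nonempty} → J),
    p ∈ U.1 ∧ φ.comp MvPolynomial.C = consts X U ∧ φ.Etale ∧
    {Z ∈ components D | ((Z : Set X.left) ∩ U).Nonempty}.Finite ∧ Function.Injective σ ∧
    ∀ Z, (Scheme.IdealSheafData.vanishingIdeal Z.1).ideal U =
      Ideal.span {φ (MvPolynomial.X (σ Z))}

variable (k) in
/-- A log pair over `k`: a smooth scheme `X` (possibly of infinite type) together with a (reduced)
simple normal crossings divisor `D`. -/
structure LogPair where
  /-- the underlying scheme over `k` -/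
  X : Over (Spec (.of k))
  /-- the divisor -/
  D : Closeds X.left
  hasLogChart : ∀ p, HasLogChart X D p

theorem exists_component {X : Type*} [TopologicalSpace X] (D : Closeds X) {x : X} (hx : x ∈ D) :
    ∃ Z ∈ components D, x ∈ Z := by
  suffices ∃ m, {x} ⊆ m ∧ Maximal (· ∈ {t : Set X | IsIrreducible t ∧ t ⊆ D}) m by
    obtain ⟨m, hm, hmax⟩ := this
    have hcl : IsClosed m := by
      refine closure_eq_iff_isClosed.mp (Set.Subset.antisymm (hmax.2 ⟨hmax.1.1.closure,
        closure_minimal hmax.1.2 D.isClosed⟩ subset_closure) subset_closure)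
    exact ⟨⟨m, hcl⟩, ⟨⟨hmax.1.1, hmax.1.2⟩, fun W hW h ↦ hmax.2 hW h⟩, hm rfl⟩
  refine zorn_subset_nonempty
    {t : Set X | IsIrreducible t ∧ t ⊆ D} (fun c hc hcc hne ↦ ?_) {x}
    ⟨isIrreducible_singleton, by simpa using hx⟩
  · refine ⟨⋃₀ c, ⟨⟨?_, ?_⟩, Set.sUnion_subset fun t ht ↦ (hc ht).2⟩,
      fun t ht ↦ Set.subset_sUnion_of_mem ht⟩
    · obtain ⟨t, ht⟩ := hne
      exact (hc ht).1.1.mono (Set.subset_sUnion_of_mem ht)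
    · rintro u v hu hv ⟨y, hy, hyu⟩ ⟨z, hz, hzv⟩
      obtain ⟨p, hpc, hyp⟩ := Set.mem_sUnion.1 hy
      obtain ⟨q, hqc, hzq⟩ := Set.mem_sUnion.1 hz
      rcases hcc.total hpc hqc with hpq | hqp
      · obtain ⟨w, hw, hw'⟩ := (hc hqc).1.2 u v hu hv ⟨y, hpq hyp, hyu⟩ ⟨z, hzq, hzv⟩
        exact ⟨w, ⟨q, hqc, hw⟩, hw'⟩
      · obtain ⟨w, hw, hw'⟩ := (hc hpc).1.2 u v hu hv ⟨y, hyp, hyu⟩ ⟨z, hqp hzq, hzv⟩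
        exact ⟨w, ⟨p, hpc, hw⟩, hw'⟩

namespace LogPair

variable (P : LogPair k)

/-- The functions on `U` vanishing on the closed subset `Z`. -/
abbrev idealOf {X : Scheme.{u}} (Z : Closeds X) (U : X.AffineZariskiSite) : Ideal Γ(X, U.toOpens) :=
  (Scheme.IdealSheafData.vanishingIdeal Z).ideal ⟨U.toOpens, U.2⟩

/-- `U ∖ D`. -/
abbrev away (U : P.X.left.Opens) : P.X.left.Opens := U ⊓ P.D.compl

theorem mem_iff_of_ideal_eq {X : Scheme.{u}} (Z : Closeds X) (U : X.affineOpens) (γ : Γ(X, U))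
    (h : (Scheme.IdealSheafData.vanishingIdeal Z).ideal U = Ideal.span {γ}) {x : X} (hx : x ∈ U.1) :
    x ∈ Z ↔ x ∉ X.basicOpen γ := by
  have h1 : x ∈ (Scheme.IdealSheafData.vanishingIdeal Z).support ↔ x ∈ Z := by
    rw [← SetLike.mem_coe, Scheme.IdealSheafData.coe_support_vanishingIdeal]; rfl
  rw [← h1, Scheme.IdealSheafData.mem_support_iff_of_mem hx, h, Scheme.zeroLocus_span]
  simp

theorem isCompact_away (U : P.X.left.AffineZariskiSite) :
    IsCompact ((P.away U.toOpens : P.X.left.Opens) : Set P.X.left) := by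
  suffices ∃ K, IsCompact K ∧ (U.toOpens : Set P.X.left) ∩ (P.away U.toOpens : Set P.X.left) ⊆ K ∧
      K ⊆ (P.away U.toOpens : Set P.X.left) by
    obtain ⟨K, hK, h1, h2⟩ := this
    rwa [Set.Subset.antisymm h2 (fun x hx ↦ h1 ⟨hx.1, hx⟩)] at hK
  refine U.2.isCompact.induction_on
    (p := fun s ↦ ∃ K, IsCompact K ∧ s ∩ (P.away U.toOpens : Set P.X.left) ⊆ K ∧
      K ⊆ (P.away U.toOpens : Set P.X.left))
    ⟨∅, isCompact_empty, by simp, by simp⟩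
    (fun s t hst ⟨K, hK, h1, h2⟩ ↦ ⟨K, hK, (Set.inter_subset_inter_left _ hst).trans h1, h2⟩)
    (fun s t ⟨K, hK, h1, h2⟩ ⟨K', hK', h1', h2'⟩ ↦ ⟨K ∪ K', hK.union hK', by
      rw [Set.union_inter_distrib_right]; exact Set.union_subset_union h1 h1',
      Set.union_subset h2 h2'⟩)
    (fun x hx ↦ ?_)
  · obtain ⟨V, J, φ, σ, hxV, -, -, hfin, -, hσ⟩ := P.hasLogChart x
    have := hfin.fintype
    obtain ⟨g, g', hgg', hxg⟩ := exists_basicOpen_le_affine_inter U.2 V.2 x ⟨hx, hxV⟩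
    let h : Γ(P.X.left, V) := ∏ Z, φ (MvPolynomial.X (σ Z))
    have key : ∀ y ∈ V.1, y ∈ P.D ↔ y ∉ P.X.left.basicOpen h := by
      intro y hy
      have h1 : y ∈ P.X.left.basicOpen h ↔
          ∀ Z, y ∈ P.X.left.basicOpen (φ (MvPolynomial.X (σ Z))) := by
        simp only [Scheme.mem_basicOpen _ _ _ hy, h, map_prod, IsUnit.prod_univ_iff]
      rw [h1, not_forall]
      constructor
      · intro hyD
        obtain ⟨Z, hZ, hyZ⟩ := exists_component P.D hyD
        exact ⟨⟨Z, hZ, y, hyZ, hy⟩, (mem_iff_of_ideal_eq Z V _ (hσ ⟨Z, hZ, y, hyZ, hy⟩) hy).mp hyZ⟩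
      · rintro ⟨Z, hZ⟩
        exact Z.2.1.1.2 ((mem_iff_of_ideal_eq Z.1 V _ (hσ Z) hy).mpr hZ)
    refine ⟨P.X.left.basicOpen g, mem_nhdsWithin_of_mem_nhds
      ((P.X.left.basicOpen g).isOpen.mem_nhds hxg), P.X.left.basicOpen (g' * h),
      (V.2.basicOpen _).isCompact, ?_, ?_⟩
    · rintro y ⟨hy, hy'⟩
      rw [hgg'] at hy
      rw [Scheme.basicOpen_mul]
      exact ⟨hy, not_not.mp fun hn ↦ hy'.2 ((key y (P.X.left.basicOpen_le _ hy)).mpr hn)⟩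
    · rintro y hy
      rw [Scheme.basicOpen_mul] at hy
      have hyg : y ∈ P.X.left.basicOpen g := hgg' ▸ hy.1
      exact ⟨P.X.left.basicOpen_le _ hyg, fun hD ↦
        (key y (P.X.left.basicOpen_le _ hy.1)).mp hD hy.2⟩

theorem isLocalization_of_eq {X : Scheme.{u}} {U V : X.Opens} (hU : IsCompact (U : Set X))
    (hU' : IsQuasiSeparated (U : Set X)) (f : Γ(X, U)) (h : V ≤ U) (hV : V = X.basicOpen f) :
    letI := (res h).toAlgebra; IsLocalization.Away f Γ(X, V) := by
  subst hV
  exact isLocalization_basicOpen_of_qcqs hU hU' f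

theorem away_le {U V : P.X.left.Opens} (h : V ≤ U) : P.away V ≤ P.away U :=
  inf_le_inf_right _ h

theorem isLocalization_away (U : P.X.left.AffineZariskiSite) (f : Γ(P.X.left, U.toOpens)) :
    letI := (res (P.away_le (P.X.left.basicOpen_le f))).toAlgebra
    IsLocalization.Away (res (inf_le_left : P.away U.toOpens ≤ U.toOpens) f)
      Γ(P.X.left, P.away (P.X.left.basicOpen f)) := by
  refine isLocalization_of_eq (P.isCompact_away U) (U.2.isQuasiSeparated.of_subset inf_le_left) _
    (P.away_le (P.X.left.basicOpen_le f)) ?_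
  rw [Scheme.basicOpen_res]
  exact le_antisymm (le_inf (P.away_le (P.X.left.basicOpen_le f)) inf_le_left)
    (le_inf inf_le_right (inf_le_left.trans inf_le_right))

theorem fg_idealOf (Z : Closeds P.X.left) (hZ : Z ∈ components P.D)
    (U : P.X.left.AffineZariskiSite) : (idealOf Z U).FG := by
  let t : Set Γ(P.X.left, U.toOpens) := {g | ((idealOf Z U).map
    (algebraMap _ (Localization.Away g))).FG}
  refine Ideal.fg_of_localizationSpan t ?_ fun g ↦ g.2
  rw [← U.2.self_le_iSup_basicOpen_iff]
  intro x hx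
  obtain ⟨V, J, φ, σ, hxV, -, -, -, -, hσ⟩ := P.hasLogChart x
  obtain ⟨g, g', hgg', hxg⟩ := exists_basicOpen_le_affine_inter U.2 V.2 x ⟨hx, hxV⟩
  refine Opens.mem_iSup.mpr ⟨⟨g, ?_⟩, hxg⟩
  have hV : ((Scheme.IdealSheafData.vanishingIdeal Z).ideal V).FG := by
    by_cases hZV : ((Z : Set P.X.left) ∩ V).Nonempty
    · rw [hσ ⟨Z, hZ, hZV⟩]
      exact ⟨{_}, by rw [Finset.coe_singleton]⟩
    · have : V.2.fromSpec ⁻¹' (Z : Set P.X.left) = ∅ := by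
        refine Set.eq_empty_of_forall_notMem fun y hy ↦ hZV ⟨_, hy, ?_⟩
        rw [← V.2.range_fromSpec]
        exact ⟨y, rfl⟩
      have h : (Scheme.IdealSheafData.vanishingIdeal Z).ideal V = ⊤ :=
        (congrArg PrimeSpectrum.vanishingIdeal this).trans PrimeSpectrum.vanishingIdeal_empty
      rw [h]
      exact ⟨{1}, by simp⟩
  let W : P.X.left.affineOpens := P.X.left.affineBasicOpen (U := ⟨U.toOpens, U.2⟩) g
  have hWU : W ≤ ⟨U.toOpens, U.2⟩ := P.X.left.basicOpen_le g
  have hWV : W ≤ V := (congrArg (· ≤ V.1) hgg').mpr (P.X.left.basicOpen_le g')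
  have hW : ((Scheme.IdealSheafData.vanishingIdeal Z).ideal W).FG := by
    rw [← Scheme.IdealSheafData.map_ideal _ hWV]
    exact hV.map _
  rw [← Scheme.IdealSheafData.map_ideal _ hWU] at hW
  let _ := (res hWU).toAlgebra
  have : IsLocalization.Away g Γ(P.X.left, W) := U.2.isLocalization_basicOpen g
  let e := IsLocalization.algEquiv (Submonoid.powers g) Γ(P.X.left, W) (Localization.Away g)
  have he : algebraMap Γ(P.X.left, U.toOpens) (Localization.Away g) =
      e.toRingEquiv.toRingHom.comp (res hWU) := by
    ext a
    exact (e.commutes a).symm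
  change ((idealOf Z U).map _).FG
  rw [he, ← Ideal.map_map]
  exact hW.map _

/-- The jet algebra of `U ∖ D`, that is, the sections over `U` of the push-forward to `X` of the
structure sheaf of the jet space of `X ∖ D`. -/
abbrev awayJets (U : P.X.left.Opens) : Type u := JetAlgebra (consts P.X (P.away U))

/-- The restriction of jets. -/
def resJets {U V : P.X.left.Opens} (h : V ≤ U) : P.awayJets U →+* P.awayJets V :=
  JetAlgebra.map (res (P.away_le h)) (res_comp_consts _ _)

/-- The functions on `U`, as functions on the jets of `U ∖ D`. -/
def fn (U : P.X.left.Opens) : Γ(P.X.left, U) →+* P.awayJets U :=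
  (JetAlgebra.of _).comp (res inf_le_left)

/-- The generators of the algebra of log jets: the functions on `U`, and the functions `y ∂x`, where
`x` is a section over `U` of `𝒪(-Z)` and `y` a section of `𝒪(Z)`, for `Z` a component of `D`.
If `Z` has an equation `γ` on `U`, then `x = a γ` and `y = b / γ` with `a` and `b` functions on `U`,
and `y ∂x = b ∂a + a b (∂γ / γ)`; so, up to functions on `U` and their derivatives, these are the
multiples of the logarithmic derivative `∂γ / γ`. -/
def logJetGenerators (U : P.X.left.AffineZariskiSite) : Set (P.awayJets U.toOpens) :=
  {s | ∃ a, s = P.fn U.toOpens a} ∪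
  {s | ∃ Z ∈ components P.D, ∃ x ∈ idealOf Z U, ∃ y : Γ(P.X.left, P.away U.toOpens),
    (∀ t ∈ idealOf Z U, ∃ a : Γ(P.X.left, U.toOpens), y * res inf_le_left t = res inf_le_left a) ∧
    s = JetAlgebra.of _ y * JetAlgebra.der _ (P.fn U.toOpens x)}

/-- The algebra of log jets over the affine open subset `U`: the smallest subring of the jet algebra
of `U ∖ D` that is closed under `∂` and contains the generators. It is compatible with localization
in `U`, so it is the algebra of sections over `U` of the sheaf of algebras generated locally, in
coordinates `γ^i` in which `D` is `γ^1 ⋯ γ^r = 0`, under `∂` by the functions on `X` and the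
`∂γ^i / γ^i`, `i ≤ r`. -/
def logJetAlgebra (U : P.X.left.AffineZariskiSite) : Subring (P.awayJets U.toOpens) :=
  sInf {S | P.logJetGenerators U ⊆ S ∧ ∀ s ∈ S, JetAlgebra.der _ s ∈ S}

theorem generators_subset (U : P.X.left.AffineZariskiSite) :
    P.logJetGenerators U ⊆ P.logJetAlgebra U :=
  fun _ hs ↦ Subring.mem_sInf.mpr fun _ hS ↦ hS.1 hs

theorem fn_mem (U : P.X.left.AffineZariskiSite) (a) : P.fn U.toOpens a ∈ P.logJetAlgebra U :=
  P.generators_subset U (.inl ⟨a, rfl⟩)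

theorem der_mem (U : P.X.left.AffineZariskiSite) {s} (hs : s ∈ P.logJetAlgebra U) :
    JetAlgebra.der _ s ∈ P.logJetAlgebra U :=
  Subring.mem_sInf.mpr fun S hS ↦ hS.2 _ (Subring.mem_sInf.mp hs S hS)

theorem logJetAlgebra_le {U : P.X.left.AffineZariskiSite} {S : Subring (P.awayJets U.toOpens)}
    (h1 : P.logJetGenerators U ⊆ S) (h2 : ∀ s ∈ S, JetAlgebra.der _ s ∈ S) :
    P.logJetAlgebra U ≤ S := sInf_le ⟨h1, h2⟩

theorem resJets_fn {U V : P.X.left.Opens} (h : V ≤ U) (a : Γ(P.X.left, U)) :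
    P.resJets h (P.fn U a) = P.fn V (res h a) := by
  refine (JetAlgebra.map_of _ _ _).trans ?_
  change JetAlgebra.of _ _ = JetAlgebra.of _ _
  rw [res_res, res_res]

theorem resJets_of {U V : P.X.left.Opens} (h : V ≤ U) (a : Γ(P.X.left, P.away U)) :
    P.resJets h (JetAlgebra.of _ a) = JetAlgebra.of _ (res (P.away_le h) a) :=
  JetAlgebra.map_of _ _ _

theorem resJets_der {U V : P.X.left.Opens} (h : V ≤ U) (s : P.awayJets U) :
    P.resJets h (JetAlgebra.der _ s) = JetAlgebra.der _ (P.resJets h s) :=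
  JetAlgebra.map_der _ _ _

theorem resJets_sym {U V : P.X.left.Opens} (h : V ≤ U) (a : Γ(P.X.left, P.away U)) (n : ℕ) :
    P.resJets h (JetAlgebra.sym _ a n) = JetAlgebra.sym _ (res (P.away_le h) a) n :=
  JetAlgebra.map_sym _ _ _ _

theorem resJets_resJets {U V W : P.X.left.Opens} (h : V ≤ U) (h' : W ≤ V) (s : P.awayJets U) :
    P.resJets h' (P.resJets h s) = P.resJets (h'.trans h) s := by
  refine RingHom.congr_fun (f := (P.resJets h').comp (P.resJets h))
    (JetAlgebra.hom_ext fun a n ↦ ?_) s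
  rw [RingHom.comp_apply, resJets_sym, resJets_sym, res_res, resJets_sym]

theorem resJets_refl {U : P.X.left.Opens} (s : P.awayJets U) : P.resJets le_rfl s = s := by
  refine RingHom.congr_fun (f := P.resJets le_rfl) (g := .id _)
    (JetAlgebra.hom_ext fun a n ↦ ?_) s
  rw [resJets_sym]
  change JetAlgebra.sym _ ((P.X.left.presheaf.map (𝟙 _)).hom a) n = _
  rw [P.X.left.presheaf.map_id]
  rfl

theorem exists_mem_ideal_lift (Z : Closeds P.X.left)
    (U : P.X.left.AffineZariskiSite) (f : Γ(P.X.left, U.toOpens))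
    {x' : Γ(P.X.left, P.X.left.basicOpen f)}
    (hx' : x' ∈ idealOf Z (U.basicOpen f)) : ∃ (n : ℕ), ∃ x ∈ idealOf Z U,
      res (P.X.left.basicOpen_le f) x = res (P.X.left.basicOpen_le f) f ^ n * x' := by
  let W : P.X.left.affineOpens := P.X.left.affineBasicOpen (U := ⟨U.toOpens, U.2⟩) f
  have hWU : W ≤ ⟨U.toOpens, U.2⟩ := P.X.left.basicOpen_le f
  change x' ∈ (Scheme.IdealSheafData.vanishingIdeal Z).ideal W at hx'
  rw [← Scheme.IdealSheafData.map_ideal _ hWU] at hx'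
  let _ := (res hWU).toAlgebra
  have : IsLocalization.Away f Γ(P.X.left, W) := U.2.isLocalization_basicOpen f
  obtain ⟨⟨x, ⟨_, n, rfl⟩⟩, h⟩ :=
    (IsLocalization.mem_map_algebraMap_iff (Submonoid.powers f) Γ(P.X.left, W)).mp hx'
  refine ⟨n, x, x.2, ?_⟩
  rw [mul_comm, ← map_pow]
  exact h.symm

theorem exists_fn_lift (U : P.X.left.AffineZariskiSite) (f : Γ(P.X.left, U.toOpens))
    (a' : Γ(P.X.left, P.X.left.basicOpen f)) : ∃ (n : ℕ) (a : Γ(P.X.left, U.toOpens)),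
      res (P.X.left.basicOpen_le f) a = res (P.X.left.basicOpen_le f) f ^ n * a' := by
  let _ := (res (P.X.left.basicOpen_le f)).toAlgebra
  have : IsLocalization.Away f Γ(P.X.left, P.X.left.basicOpen f) :=
    U.2.isLocalization_basicOpen f
  obtain ⟨n, a, h⟩ := IsLocalization.Away.surj f a'
  refine ⟨n, a, ?_⟩
  rw [mul_comm]
  exact h.symm

theorem exists_generator_lift (Z : Closeds P.X.left) (hZ : Z ∈ components P.D)
    (U : P.X.left.AffineZariskiSite) (f : Γ(P.X.left, U.toOpens))
    (y' : Γ(P.X.left, P.away (P.X.left.basicOpen f)))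
    (hy' : ∀ t ∈ idealOf Z (U.basicOpen f), ∃ a : Γ(P.X.left, P.X.left.basicOpen f),
      y' * res inf_le_left t = res inf_le_left a) :
    ∃ (n : ℕ) (y : Γ(P.X.left, P.away U.toOpens)),
      (∀ t ∈ idealOf Z U, ∃ a : Γ(P.X.left, U.toOpens), y * res inf_le_left t = res inf_le_left a) ∧
      res (P.away_le (P.X.left.basicOpen_le f)) y =
        res (inf_le_left.trans (P.X.left.basicOpen_le f)) f ^ n * y' := by
  let ρ : Γ(P.X.left, P.away U.toOpens) →+* Γ(P.X.left, P.away (P.X.left.basicOpen f)) :=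
    res (P.away_le (P.X.left.basicOpen_le f))
  let ι : Γ(P.X.left, U.toOpens) →+* Γ(P.X.left, P.away U.toOpens) := res inf_le_left
  let ι' : Γ(P.X.left, P.X.left.basicOpen f) →+* Γ(P.X.left, P.away (P.X.left.basicOpen f)) :=
    res inf_le_left
  let r : Γ(P.X.left, U.toOpens) →+* Γ(P.X.left, P.X.left.basicOpen f) := res (P.X.left.basicOpen_le f)
  have hρι : ∀ a, ρ (ι a) = ι' (r a) := fun a ↦ (res_res ..).trans (res_res ..).symm
  have hf : res (inf_le_left.trans (P.X.left.basicOpen_le f)) f = ρ (ι f) := (res_res ..).symm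
  have hr : ∀ t ∈ idealOf Z U, r t ∈ idealOf Z (U.basicOpen f) := fun t ht ↦
    Scheme.IdealSheafData.ideal_le_comap_ideal (Scheme.IdealSheafData.vanishingIdeal Z)
      (U := ⟨_, (U.basicOpen f).2⟩) (V := ⟨U.toOpens, U.2⟩) (P.X.left.basicOpen_le f) ht
  rw [hf]
  let _ := ρ.toAlgebra
  have : IsLocalization.Away (ι f) Γ(P.X.left, P.away (P.X.left.basicOpen f)) :=
    P.isLocalization_away U f
  obtain ⟨m, y₀, hy₀⟩ := IsLocalization.Away.surj (ι f) y'
  replace hy₀ : y' * ρ (ι f) ^ m = ρ y₀ := hy₀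
  have key : ∀ t ∈ idealOf Z U, ∃ N, ∃ a, ι f ^ N * y₀ * ι t = ι a := by
    intro t ht
    obtain ⟨a', ha'⟩ := hy' (r t) (hr t ht)
    replace ha' : y' * ι' (r t) = ι' a' := ha'
    obtain ⟨p, a, ha⟩ := P.exists_fn_lift U f a'
    replace ha : r a = r f ^ p * a' := ha
    have h1 : ρ (y₀ * ι f ^ p * ι t) = ρ (ι (f ^ m * a)) := by
      rw [hρι (f ^ m * a)]
      simp only [map_mul, map_pow, ha, ← ha', ← hy₀, hρι]
      ring
    obtain ⟨⟨_, q, rfl⟩, h2⟩ := (IsLocalization.eq_iff_exists (Submonoid.powers (ι f))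
      Γ(P.X.left, P.away (P.X.left.basicOpen f))).mp h1
    refine ⟨p + q, f ^ q * (f ^ m * a), ?_⟩
    replace h2 : ι f ^ q * (y₀ * ι f ^ p * ι t) = ι f ^ q * ι (f ^ m * a) := h2
    rw [map_mul, map_pow, ← h2]
    ring
  obtain ⟨S, hS⟩ := P.fg_idealOf Z hZ U
  choose! N hN using key
  let M := S.sup N
  have key' : ∀ t ∈ idealOf Z U, ∃ a, ι f ^ M * y₀ * ι t = ι a := by
    intro t ht
    rw [← hS] at ht
    induction ht using Submodule.span_induction with
    | mem t ht =>
      have ht' : t ∈ idealOf Z U := hS ▸ Submodule.subset_span ht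
      obtain ⟨a, ha⟩ := hN t ht'
      obtain ⟨d, hd⟩ := Nat.exists_eq_add_of_le (Finset.le_sup (f := N) ht)
      refine ⟨f ^ d * a, ?_⟩
      rw [show M = N t + d from hd, map_mul, ← ha, map_pow]
      ring
    | zero => exact ⟨0, by simp⟩
    | add s t _ _ hs ht =>
      obtain ⟨a, ha⟩ := hs
      obtain ⟨b, hb⟩ := ht
      exact ⟨a + b, by rw [map_add, mul_add, ha, hb, map_add]⟩
    | smul c t _ ht =>
      obtain ⟨a, ha⟩ := ht
      exact ⟨c * a, by rw [smul_eq_mul, map_mul, map_mul, ← ha]; ring⟩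
  refine ⟨M + m, ι f ^ M * y₀, key', ?_⟩
  change ρ _ = _
  rw [map_mul, map_pow, ← hy₀]
  ring

theorem resJets_mem {U V : P.X.left.AffineZariskiSite} (h : V.toOpens ≤ U.toOpens) {s : P.awayJets U.toOpens}
    (hs : s ∈ P.logJetAlgebra U) : P.resJets h s ∈ P.logJetAlgebra V := by
  suffices P.logJetAlgebra U ≤ (P.logJetAlgebra V).comap (P.resJets h) from this hs
  refine P.logJetAlgebra_le ?_ fun s hs ↦ ?_
  · rintro _ (⟨a, rfl⟩ | ⟨Z, hZ, x, hx, y, hy, rfl⟩)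
    · refine Subring.mem_comap.mpr ?_
      rw [resJets_fn]
      exact P.fn_mem _ _
    · refine Subring.mem_comap.mpr (P.generators_subset V (.inr ⟨Z, hZ, res h x, ?_,
        res (P.away_le h) y, ?_, ?_⟩))
      · exact Scheme.IdealSheafData.ideal_le_comap_ideal (Scheme.IdealSheafData.vanishingIdeal Z)
          (U := ⟨V.toOpens, V.2⟩) (V := ⟨U.toOpens, U.2⟩) h hx
      · intro t ht
        have hm := Scheme.IdealSheafData.map_ideal (Scheme.IdealSheafData.vanishingIdeal Z)
          (U := ⟨V.toOpens, V.2⟩) (V := ⟨U.toOpens, U.2⟩) h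
        change t ∈ (Scheme.IdealSheafData.vanishingIdeal Z).ideal ⟨V.toOpens, V.2⟩ at ht
        rw [← hm] at ht
        induction ht using Submodule.span_induction with
        | mem t ht =>
          obtain ⟨t, ht, rfl⟩ := ht
          obtain ⟨a, ha⟩ := hy t ht
          refine ⟨res h a, ?_⟩
          have := congrArg (res (P.away_le h)) ha
          rw [map_mul, res_res, res_res] at this
          rw [res_res]
          refine Eq.trans ?_ this
          congr 1
          exact res_res ..
        | zero => exact ⟨0, by simp⟩
        | add s t _ _ hs ht =>
          obtain ⟨a, ha⟩ := hs
          obtain ⟨b, hb⟩ := ht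
          exact ⟨a + b, by rw [map_add, mul_add, ha, hb, map_add]⟩
        | smul c t _ ht =>
          obtain ⟨a, ha⟩ := ht
          exact ⟨c * a, by rw [smul_eq_mul, map_mul, map_mul, ← ha]; ring⟩
      · rw [map_mul, resJets_of, resJets_der, resJets_fn]
  · refine Subring.mem_comap.mpr ?_
    rw [resJets_der]
    exact P.der_mem V hs

theorem exists_logJet_lift (U : P.X.left.AffineZariskiSite) (f : Γ(P.X.left, U.toOpens))
    {s : P.awayJets (P.X.left.basicOpen f)} (hs : s ∈ P.logJetAlgebra (U.basicOpen f)) :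
    ∃ (n : ℕ), ∃ l ∈ P.logJetAlgebra U, P.resJets (P.X.left.basicOpen_le f) l =
      P.resJets (P.X.left.basicOpen_le f) (P.fn U.toOpens f) ^ n * s := by
  let m : P.awayJets U.toOpens →+* P.awayJets (P.X.left.basicOpen f) :=
    P.resJets (P.X.left.basicOpen_le f)
  let F := m (P.fn U.toOpens f)
  let M := (P.logJetAlgebra U).map m
  let δ := JetAlgebra.der (consts P.X (P.away (P.X.left.basicOpen f)))
  have hF : ∀ n, F ^ n ∈ M := fun n ↦ pow_mem (Subring.mem_map.mpr ⟨_, P.fn_mem U f, rfl⟩) n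
  have hδ : ∀ x ∈ M, δ x ∈ M := by
    rintro _ ⟨x, hx, rfl⟩
    exact Subring.mem_map.mpr ⟨_, P.der_mem U hx, P.resJets_der _ _⟩
  let T : Subring (P.awayJets (P.X.left.basicOpen f)) :=
    { carrier := {s | ∃ n, F ^ n * s ∈ M}
      mul_mem' := by
        rintro x y ⟨n, hn⟩ ⟨p, hp⟩
        refine ⟨n + p, ?_⟩
        rw [show F ^ (n + p) * (x * y) = (F ^ n * x) * (F ^ p * y) by ring]
        exact mul_mem hn hp
      one_mem' := ⟨0, by simp⟩
      add_mem' := by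
        rintro x y ⟨n, hn⟩ ⟨p, hp⟩
        refine ⟨n + p, ?_⟩
        rw [show F ^ (n + p) * (x + y) = F ^ p * (F ^ n * x) + F ^ n * (F ^ p * y) by ring]
        exact add_mem (mul_mem (hF _) hn) (mul_mem (hF _) hp)
      zero_mem' := ⟨0, by simp⟩
      neg_mem' := by
        rintro x ⟨n, hn⟩
        exact ⟨n, by rw [mul_neg]; exact neg_mem hn⟩ }
  have hMT : ∀ x ∈ M, x ∈ T := fun x hx ↦ ⟨0, by simpa using hx⟩
  have hFT : ∀ n x, F ^ n * x ∈ T → x ∈ T := by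
    rintro n x ⟨p, hp⟩
    exact ⟨p + n, by rwa [pow_add, mul_assoc]⟩
  have hfn : ∀ a, P.fn _ a ∈ T := by
    intro a'
    obtain ⟨n, a, ha⟩ := P.exists_fn_lift U f a'
    refine ⟨n, Subring.mem_map.mpr ⟨P.fn U.toOpens a, P.fn_mem U a, ?_⟩⟩
    simp only [m, F, resJets_fn, ha, map_mul, map_pow]
  suffices P.logJetAlgebra (U.basicOpen f) ≤ T by
    obtain ⟨n, hn⟩ := this hs
    obtain ⟨l, hl, h⟩ := Subring.mem_map.mp hn
    exact ⟨n, l, hl, h⟩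
  refine P.logJetAlgebra_le (U := U.basicOpen f) ?_ fun s' hs ↦ ?_
  · rintro s hs
    have hs : (∃ a : Γ(P.X.left, P.X.left.basicOpen f), s = P.fn _ a) ∨
      ∃ Z ∈ components P.D, ∃ x' : Γ(P.X.left, P.X.left.basicOpen f),
        x' ∈ idealOf Z (U.basicOpen f) ∧
        ∃ y' : Γ(P.X.left, P.away (P.X.left.basicOpen f)),
        (∀ t ∈ idealOf Z (U.basicOpen f), ∃ a : Γ(P.X.left, P.X.left.basicOpen f),
          y' * res inf_le_left t = res inf_le_left a) ∧
        s = JetAlgebra.of _ y' * JetAlgebra.der _ (P.fn (P.X.left.basicOpen f) x') := hs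
    rcases hs with ⟨a, rfl⟩ | ⟨Z, hZ, x', hx', y', hy', rfl⟩
    · exact hfn a
    · obtain ⟨p, x, hx, hxx'⟩ := P.exists_mem_ideal_lift Z U f hx'
      obtain ⟨q, y, hy, hyy'⟩ := P.exists_generator_lift Z hZ U f y' hy'
      obtain ⟨a, ha⟩ := hy' x' hx'
      have hF' : F = P.fn _ (res (P.X.left.basicOpen_le f) f) := P.resJets_fn _ _
      let Y' := JetAlgebra.of (consts P.X (P.away (P.X.left.basicOpen f))) y'
      let X' := P.fn (P.X.left.basicOpen f) x'
      have h1 : m (JetAlgebra.of _ y) = F ^ q * Y' := by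
        simp only [m, resJets_of]
        rw [hyy', map_mul, map_pow, ← res_res (P.X.left.basicOpen_le f) inf_le_left, hF']
        rfl
      have h2 : m (P.fn U.toOpens x) = F ^ p * X' := by
        simp only [m, resJets_fn]
        rw [hxx', map_mul, map_pow, hF']
      have h3 : Y' * X' = P.fn _ a := by
        change JetAlgebra.of _ _ * JetAlgebra.of _ _ = JetAlgebra.of _ _
        rw [← map_mul]
        exact congrArg _ ha
      have h4 : F ^ (q + p) * (Y' * δ X') =
          m (JetAlgebra.of _ y * JetAlgebra.der _ (P.fn U.toOpens x)) -
            F ^ q * δ (F ^ p) * P.fn _ a := by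
        rw [map_mul, h1]
        have : m (JetAlgebra.der _ (P.fn U.toOpens x)) = δ (F ^ p * X') := by
          rw [← h2]
          exact P.resJets_der _ _
        rw [this, Derivation.leibniz, ← h3]
        simp only [smul_eq_mul]
        ring
      refine hFT (q + p) _ ?_
      change F ^ (q + p) * (Y' * δ X') ∈ T
      rw [h4]
      refine sub_mem (hMT _ (Subring.mem_map.mpr ⟨_, P.generators_subset U
        (.inr ⟨Z, hZ, x, hx, y, hy, rfl⟩), rfl⟩)) (mul_mem (hMT _ (mul_mem (hF _) (hδ _ (hF _))))
          (hfn a))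
  · let s : P.awayJets (P.X.left.basicOpen f) := s'
    obtain ⟨n, hn⟩ : ∃ n, F ^ n * s ∈ M := hs
    refine hFT (n + n) _ (hMT _ ?_)
    have : F ^ (n + n) * δ s = F ^ n * δ (F ^ n * s) - δ (F ^ n) * (F ^ n * s) := by
      rw [Derivation.leibniz]
      simp only [smul_eq_mul]
      ring
    change F ^ (n + n) * δ s ∈ M
    rw [this]
    exact sub_mem (mul_mem (hF _) (hδ _ hn)) (mul_mem (hδ _ (hF _)) hn)

/-- The presheaf of algebras of log jets on the affine open subsets of `X`. -/
def logJetPresheaf : P.X.left.AffineZariskiSiteᵒᵖ ⥤ CommRingCat.{u} where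
  obj U := .of (P.logJetAlgebra U.unop)
  map {U V} i := CommRingCat.ofHom <|
    (P.resJets (Scheme.AffineZariskiSite.toOpens_mono i.unop.le)).restrict _ _
      fun _ hs ↦ P.resJets_mem _ hs
  map_id U := by
    exact CommRingCat.hom_ext (RingHom.ext fun s ↦ Subtype.ext (P.resJets_refl s.1))
  map_comp i j := by
    exact CommRingCat.hom_ext (RingHom.ext fun s ↦ Subtype.ext (P.resJets_resJets
      (Scheme.AffineZariskiSite.toOpens_mono i.unop.le)
      (Scheme.AffineZariskiSite.toOpens_mono j.unop.le) s.1).symm)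

/-- The structure map from the functions on `X`. -/
def logJetPresheafMap : (Scheme.AffineZariskiSite.toOpensFunctor P.X.left).op ⋙ P.X.left.presheaf ⟶
    P.logJetPresheaf where
  app U := CommRingCat.ofHom ((P.fn U.unop.1).codRestrict _ (P.fn_mem U.unop))
  naturality U V i := by
    ext a
    exact Subtype.ext (P.resJets_fn (Scheme.AffineZariskiSite.toOpens_mono i.unop.le) a).symm

theorem coequifibered_logJetPresheafMap : P.logJetPresheafMap.Coequifibered := by
  refine Scheme.AffineZariskiSite.coequifibered_iff_forall_isLocalizationAway.mpr fun U f ↦ ?_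
  let _ := (P.logJetPresheaf.map (homOfLE (U.basicOpen_le f)).op).hom.toAlgebra
  have hα : ∀ l : P.logJetAlgebra U, (algebraMap (P.logJetPresheaf.obj (.op U))
      (P.logJetPresheaf.obj (.op (U.basicOpen f))) l).1 =
        P.resJets (P.X.left.basicOpen_le f) l.1 := fun _ ↦ rfl
  have hF : (algebraMap (P.logJetPresheaf.obj (.op U)) (P.logJetPresheaf.obj (.op (U.basicOpen f)))
      (P.logJetPresheafMap.app (.op U) f)).1 =
        P.resJets (P.X.left.basicOpen_le f) (P.fn U.toOpens f) := rfl
  refine (isLocalization_iff _ _).mpr ⟨?_, ?_, ?_⟩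
  · rintro ⟨_, n, rfl⟩
    have h : algebraMap (P.logJetPresheaf.obj (.op U)) (P.logJetPresheaf.obj (.op (U.basicOpen f)))
        (P.logJetPresheafMap.app (.op U) f) =
          (P.logJetPresheafMap.app (.op (U.basicOpen f))).hom (res (P.X.left.basicOpen_le f) f) :=
      Subtype.ext (P.resJets_fn (P.X.left.basicOpen_le f) f)
    rw [map_pow, h]
    exact ((RingedSpace.isUnit_res_basicOpen _ f).map _).pow n
  · intro s
    obtain ⟨n, l, hl, h⟩ := P.exists_logJet_lift U f s.2
    refine ⟨⟨⟨l, hl⟩, ⟨_, n, rfl⟩⟩, Subtype.ext ?_⟩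
    rw [map_pow]
    refine Eq.trans ?_ h.symm
    exact mul_comm _ _
  · intro x y hxy
    have h : P.resJets (P.X.left.basicOpen_le f) (x.1 - y.1) = 0 := by
      rw [map_sub, sub_eq_zero]
      exact congrArg Subtype.val hxy
    obtain ⟨n, hn⟩ := JetAlgebra.exists_pow_mul_eq_zero _ _ _ (P.isLocalization_away U f) _ h
    refine ⟨⟨_, n, rfl⟩, Subtype.ext ?_⟩
    rw [mul_sub, sub_eq_zero] at hn
    exact hn

/-- The data to glue the spectra of the algebras of log jets. -/
def logJetGluingData : (Scheme.AffineZariskiSite.directedCover P.X.left).RelativeGluingData :=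
  Scheme.AffineZariskiSite.relativeGluingData P.coequifibered_logJetPresheafMap

/-- The log jet space: the relative spectrum over `X` of the algebras of log jets. -/
def logJet : Over (Spec (.of k)) := Over.mk (P.logJetGluingData.toBase ≫ P.X.hom)

/-- The projection from the log jet space to `X`. -/
def logJetProj : P.logJet ⟶ P.X := Over.homMk P.logJetGluingData.toBase

/-- The pull-back of `D` to the log jet space: the log jets with centre in `D`. -/
def logJetDivisor : Closeds P.logJet.left := P.D.preimage P.logJetProj.left.continuous

/-- The chart `Spec 𝓛(U) → J` of the log jet space over an affine open subset `U`, where `𝓛(U)` is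
the algebra of log jets over `U`. -/
def logJetChart (U : P.X.left.AffineZariskiSite) :
    Spec (.of (P.logJetAlgebra U)) ⟶ P.logJet.left := P.logJetGluingData.cover.f U

theorem top_le_preimage_logJetChart (U : P.X.left.AffineZariskiSite) :
    ⊤ ≤ P.logJetChart U ⁻¹ᵁ P.logJetProj.left ⁻¹ᵁ U.toOpens := by
  rintro x -
  have h : P.logJetChart U ≫ P.logJetProj.left = P.logJetGluingData.natTrans.app U ≫ U.toOpens.ι :=
    P.logJetGluingData.ι_toBase U
  change (P.logJetChart U ≫ P.logJetProj.left) x ∈ U.toOpens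
  rw [h]
  exact (P.logJetGluingData.natTrans.app U x).2

/-- The identification of the functions on the preimage of `U` in the log jet space with the algebra
of log jets over `U`. -/
def logJetSections (U : P.X.left.AffineZariskiSite) :
    Γ(P.logJet.left, P.logJetProj.left ⁻¹ᵁ U.toOpens) →+* P.logJetAlgebra U :=
  ((P.logJetChart U).appLE _ ⊤ (P.top_le_preimage_logJetChart U) ≫
    (Scheme.ΓSpecIso (.of (P.logJetAlgebra U))).hom).hom

/-- A morphism of log pairs `(X, D_X) → (Y, D_Y)` is a morphism `f : X → Y` over `k` with
`f⁻¹(D_Y) ⊆ D_X`, that is, one that pulls functions invertible off `D_Y` back to functions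
invertible off `D_X`. -/
@[ext]
structure Hom (P Q : LogPair k) where
  /-- the morphism of schemes over `k` -/
  hom : P.X ⟶ Q.X
  mem_of_mem : ∀ x, hom.left x ∈ Q.D → x ∈ P.D

instance : Category (LogPair k) where
  Hom := Hom
  id P := ⟨𝟙 _, fun _ h ↦ h⟩
  comp f g := ⟨f.hom ≫ g.hom, fun x h ↦ f.mem_of_mem x (g.mem_of_mem _ h)⟩

end LogPair

/-- A vector field on a `k`-scheme: a `k`-linear derivation of the structure sheaf. -/
structure VectorField (X : Over (Spec (.of k))) where
  /-- the derivation on the functions on `U` -/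
  der (U : X.left.Opens) : Γ(X.left, U) →+ Γ(X.left, U)
  leibniz : ∀ U a b, der U (a * b) = a * der U b + b * der U a
  consts : ∀ U c, der U (consts X U c) = 0
  res : ∀ {U V : X.left.Opens} (h : V ≤ U) a, res h (der U a) = der V (res h a)

/-- A vector field is tangent to the closed subset `D` if it preserves the ideal sheaf of `D`. -/
def VectorField.IsTangent {X : Over (Spec (.of k))} (δ : VectorField X) (D : Closeds X.left) :
    Prop :=
  ∀ U : X.left.affineOpens, ∀ s ∈ (Scheme.IdealSheafData.vanishingIdeal D).ideal U,
    δ.der U.1 s ∈ (Scheme.IdealSheafData.vanishingIdeal D).ideal U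

variable (k) in
/-- A log commutative vertex scheme: a log pair with a vector field tangent to the divisor. -/
structure LCVS where
  /-- the underlying log pair -/
  pair : LogPair k
  /-- the vector field -/
  field : VectorField pair.X
  isTangent : field.IsTangent pair.D

namespace LCVS

/-- A morphism of log commutative vertex schemes: a morphism of log pairs compatible with the vector
fields. -/
@[ext]
structure Hom (Y Z : LCVS k) where
  /-- the morphism of log pairs -/
  hom : Y.pair ⟶ Z.pair
  map_der : ∀ (U : Z.pair.X.left.Opens) (s : Γ(Z.pair.X.left, U)),
    (hom.hom.left.app U).hom (Z.field.der U s) = Y.field.der _ ((hom.hom.left.app U).hom s)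

instance : Category (LCVS k) where
  Hom := Hom
  id Y := ⟨𝟙 _, fun U s ↦ rfl⟩
  comp f g := ⟨f.hom ≫ g.hom, fun U s ↦ by
    change (g.hom.hom.left.app U ≫ f.hom.hom.left.app _).hom _ = _
    simp only [CommRingCat.hom_comp, RingHom.comp_apply, g.map_der, f.map_der]
    rfl⟩

variable (k) in
/-- The forgetful functor `(Y, D, ∂) ↦ (Y, D)`. -/
def forget : LCVS k ⥤ LogPair k where
  obj Y := Y.pair
  map f := f.hom

end LCVS

end LogPairs

end LogJets

end

open AlgebraicGeometry CategoryTheory LogJets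

open AlgebraicGeometry CategoryTheory TopologicalSpace LogJets

/-! The heart of the matter is the structure of the algebra of log jets over a chart `U` with étale
coordinates `x_j`. Put `ζ_j = ∂x_j / x_j` if `x_j` is the equation of a component of `D`, and `ζ_j =
∂x_j` otherwise. Then the algebra of log jets over `U` is the polynomial algebra over `𝒪(U)` on the
`∂^n ζ_j` (`LogChart.exists_jetCoord`). These elements generate, because derivations are determined
on étale coordinates, so that the subring generated by `𝒪(U)` and the `∂^n ζ_j` is stable under `∂`
(`logCoord_der`). They are independent, because `𝒪(U ∖ D)[z_{j,n}]` carries a derivation that models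
`∂`, and Taylor expansion along it maps the jets of `U ∖ D` back to polynomials
(`logCoord_injective`).

Thus `π` is locally the projection from a product with an affine space. The `x_j` and the new
variables are étale coordinates upstairs. Radical ideals extend to radical ideals, so the pull-back
of `D` is reduced; primes extend to primes, so the fibres of `π` have generic points, and the
components of the preimage of `D` are the preimages of the components of `D`, with the same
equations. Tangency of `∂` holds because `∂γ = γ · (∂γ / γ)`, where the second factor is a log jet.

For the universal property, let `f` be a morphism of log pairs from an lcvs `Y` to `X`. Functions on
`U ∖ D` pull back to functions off `D_Y`, and in characteristic zero this extends uniquely to jets,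
compatibly with the derivations, by `a(n) ↦ ∂^n (f^* a) / n!` (`taylor`). On log jets the values
must have no poles along `D_Y`. The only question is `∂(f^*γ) / f^*γ`. Now `f^*γ` is invertible off
`D_Y`, so locally it divides a power of the equation of `D_Y`. The equations of the components are
prime, are not zero divisors and, by tangency, divide their own derivatives; every divisor of a
product of such elements divides its derivative as well (`LogChart.dvd_der_of_isUnit`). Functions on
`Y` are determined off `D_Y`, which gives uniqueness and all compatibilities, and the homomorphisms
of algebras glue to a morphism because `π` is affine. -/

namespace LogJets

/-! ### Derivations along a homomorphism, and étale extensions -/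

section Derivations

variable {A B R S : Type*} [CommRing A] [CommRing B] [CommRing R] [CommRing S]

/-- The Leibniz rule for an additive map `d : B → R`, where `R` is a `B`-module through `g`. -/
def IsDerivationAlong (g : B →+* R) (d : B →+ R) : Prop :=
  ∀ a b, d (a * b) = g a * d b + g b * d a

namespace IsDerivationAlong

theorem comp {g : B →+* R} {d : B →+ R} (hd : IsDerivationAlong g d) (ψ : A →+* B) :
    IsDerivationAlong (g.comp ψ) (d.comp ψ.toAddMonoidHom) := fun a b ↦ by
  simp only [AddMonoidHom.comp_apply, RingHom.toAddMonoidHom_eq_coe, AddMonoidHom.coe_coe, map_mul]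
  exact hd _ _

theorem postcomp {g : B →+* R} {d : B →+ R} (hd : IsDerivationAlong g d) (χ : R →+* S) :
    IsDerivationAlong (χ.comp g) (χ.toAddMonoidHom.comp d) := fun a b ↦ by
  simp only [AddMonoidHom.comp_apply, RingHom.toAddMonoidHom_eq_coe, AddMonoidHom.coe_coe,
    RingHom.comp_apply]
  rw [hd, map_add, map_mul, map_mul]

/-- Derivations agreeing on the image of a formally unramified homomorphism agree. -/
theorem ext_of_formallyUnramified {ψ : A →+* B} (hψ : ψ.FormallyUnramified) {g : B →+* R}
    {d d' : B →+ R} (hd : IsDerivationAlong g d) (hd' : IsDerivationAlong g d')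
    (h : ∀ a, d (ψ a) = d' (ψ a)) : d = d' := by
  let _ := ψ.toAlgebra
  let _ := g.toAlgebra
  let _ : Module A R := Module.compHom R (g.comp ψ)
  have : IsScalarTower A B R := ⟨fun a b r ↦ by
    change g (ψ a * b) * r = g (ψ a) * (g b * r)
    rw [map_mul, mul_assoc]⟩
  have : Algebra.FormallyUnramified A B := hψ
  have key : ∀ a b, (d - d') (a * b) = g a * (d - d') b + g b * (d - d') a := fun a b ↦ by
    simp only [AddMonoidHom.sub_apply, hd a b, hd' a b]; ring
  -- Since `d - d'` kills the image of `ψ`, it is `A`-linear, and so it factors through the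
  -- differentials of `B` over `A`, which vanish.
  let D : Derivation A B R := Derivation.mk'
    { toFun := d - d'
      map_add' := map_add (d - d')
      map_smul' := fun a b ↦ by
        change (d - d') (ψ a * b) = g (ψ a) * (d - d') b
        rw [key, AddMonoidHom.sub_apply d d' (ψ a), h, sub_self, mul_zero, add_zero] }
    (fun a b ↦ key a b)
  have hD : D = 0 := by
    have h1 := D.liftKaehlerDifferential_comp
    rw [← h1]
    ext x
    rw [Subsingleton.elim (D.liftKaehlerDifferential) 0]
    rfl
  ext b
  exact sub_eq_zero.mp (DFunLike.congr_fun hD b)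

/-- Derivations extend along formally étale homomorphisms. -/
theorem exists_extension {ψ : A →+* B} (hψ : letI := ψ.toAlgebra; Algebra.FormallyEtale A B)
    {g : B →+* R} {d : A →+ R} (hd : IsDerivationAlong (g.comp ψ) d) :
    ∃ d' : B →+ R, IsDerivationAlong g d' ∧ ∀ a, d' (ψ a) = d a := by
  let _ := ψ.toAlgebra
  let _ := g.toAlgebra
  let _ : Module A R := Module.compHom R (g.comp ψ)
  have : IsScalarTower A B R := ⟨fun a b r ↦ by
    change g (ψ a * b) * r = g (ψ a) * (g b * r)
    rw [map_mul, mul_assoc]⟩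
  have : Algebra.FormallyEtale A B := hψ
  let D : Derivation ℤ A R := Derivation.mk' d.toIntLinearMap (fun a b ↦ hd a b)
  -- For formally étale `ψ`, the differentials of `B` are the base change of those of `A`. They are
  -- taken over `ℤ` because `d` is only assumed to be additive.
  have hb := KaehlerDifferential.isBaseChange_of_formallyEtale ℤ A B
  let l : Ω[B⁄ℤ] →ₗ[B] R := hb.lift D.liftKaehlerDifferential
  refine ⟨(l.toAddMonoidHom).comp (KaehlerDifferential.D ℤ B).toLinearMap.toAddMonoidHom, ?_, ?_⟩
  · intro a b
    change l (KaehlerDifferential.D ℤ B (a * b)) = g a * l (KaehlerDifferential.D ℤ B b) +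
      g b * l (KaehlerDifferential.D ℤ B a)
    rw [Derivation.leibniz, map_add, map_smul, map_smul]
    rfl
  · intro a
    change l (KaehlerDifferential.D ℤ B (algebraMap A B a)) = d a
    rw [← KaehlerDifferential.map_D ℤ ℤ A B]
    refine (hb.lift_eq _ _).trans ?_
    exact D.liftKaehlerDifferential_comp_D a

end IsDerivationAlong

theorem formallyEtale_of_etale {ψ : A →+* B} (h : ψ.Etale) :
    letI := ψ.toAlgebra; Algebra.FormallyEtale A B := by
  let _ := ψ.toAlgebra
  have : Algebra.Etale A B := h
  infer_instance

end Derivations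

/-! ### Taylor expansion along a derivation in characteristic zero -/

section Taylor

variable {k B R : Type*} [Field k] [CommRing B] [CommRing R]

/-- The divided powers `(n!)⁻¹ d^n` of a derivation. -/
def divPow (g : k →+* R) (d : R →+ R) : ℕ → R → R
  | 0, a => a
  | n + 1, a => g ((n + 1 : ℕ) : k)⁻¹ * d (divPow g d n a)

theorem succ_nsmul_divPow [CharZero k] (g : k →+* R) (d : R →+ R) (n : ℕ) (a : R) :
    (n + 1) • divPow g d (n + 1) a = d (divPow g d n a) := by
  have h : g ((n + 1 : ℕ) : k) * g ((n + 1 : ℕ) : k)⁻¹ = 1 := by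
    rw [← map_mul, mul_inv_cancel₀ (Nat.cast_ne_zero.mpr n.succ_ne_zero), map_one]
  rw [divPow, nsmul_eq_mul, ← mul_assoc, ← map_natCast g, h, one_mul]

/-- The integer `n + 1` is invertible in `k`, hence in every ring that receives a homomorphism from
`k`. -/
theorem nsmul_cancel [CharZero k] (g : k →+* R) {n : ℕ} {a b : R}
    (h : (n + 1) • a = (n + 1) • b) : a = b := by
  have hg : g ((n + 1 : ℕ) : k)⁻¹ * g ((n + 1 : ℕ) : k) = 1 := by
    rw [← map_mul, inv_mul_cancel₀ (Nat.cast_ne_zero.mpr n.succ_ne_zero), map_one]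
  have := congrArg (g ((n + 1 : ℕ) : k)⁻¹ * ·) h
  simpa only [nsmul_eq_mul, ← map_natCast g, ← mul_assoc, hg, one_mul] using this

variable {g : k →+* R} {d : R →+ R}

theorem divPow_add (n : ℕ) (a b : R) :
    divPow g d n (a + b) = divPow g d n a + divPow g d n b := by
  induction n with
  | zero => rfl
  | succ n ih => rw [divPow, ih, map_add, mul_add]; rfl

/-- Dividing by `n!` removes the binomial coefficients from the higher Leibniz rule, which leaves
exactly the relation for `(ab)(n)` in the jet algebra. -/
theorem divPow_mul [CharZero k] (hd : IsDerivationAlong (.id R) d) (n : ℕ) (a b : R) :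
    divPow g d n (a * b) =
      ∑ p ∈ Finset.HasAntidiagonal.antidiagonal n, divPow g d p.1 a * divPow g d p.2 b := by
  induction n with
  | zero => simp [divPow]
  | succ n ih =>
    apply nsmul_cancel g
    rw [succ_nsmul_divPow, ih, ← JetAlgebra.sum_antidiagonal_der (divPow g d · a) (divPow g d · b),
      map_sum]
    refine Finset.sum_congr rfl fun p _ ↦ ?_
    rw [hd, succ_nsmul_divPow, succ_nsmul_divPow]
    rfl

theorem divPow_const (hc : ∀ c, d (g c) = 0) (c : k) (n : ℕ) :
    divPow g d n (g c) = if n = 0 then g c else 0 := by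
  rcases n with _ | n
  · rfl
  · rw [if_neg n.succ_ne_zero]
    induction n with
    | zero => simp [divPow, hc]
    | succ n ih => rw [divPow, ih, map_zero, mul_zero]

/-- The homomorphism from the jet algebra to an algebra with a derivation that extends a given
homomorphism: Taylor expansion along the derivation. -/
noncomputable def taylor [CharZero k] {φ : k →+* B} (ψ : B →+* R) (hψ : ψ.comp φ = g)
    (hd : IsDerivationAlong (.id R) d) (hc : ∀ c, d (g c) = 0) : JetAlgebra φ →+* R :=
  JetAlgebra.lift g (fun a n ↦ divPow g d n (ψ a))
    (fun c n ↦ by rw [← divPow_const hc, ← hψ]; rfl)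
    (fun a b n ↦ by rw [map_add, divPow_add])
    (fun a b n ↦ by rw [map_mul, divPow_mul hd])

theorem taylor_of [CharZero k] {φ : k →+* B} (ψ : B →+* R) (hψ : ψ.comp φ = g)
    (hd : IsDerivationAlong (.id R) d) (hc : ∀ c, d (g c) = 0) (a : B) :
    taylor ψ hψ hd hc (JetAlgebra.of φ a) = ψ a := JetAlgebra.lift_sym ..

theorem taylor_der [CharZero k] {φ : k →+* B} (ψ : B →+* R) (hψ : ψ.comp φ = g)
    (hd : IsDerivationAlong (.id R) d) (hc : ∀ c, d (g c) = 0) (x : JetAlgebra φ) :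
    taylor ψ hψ hd hc (JetAlgebra.der φ x) = d (taylor ψ hψ hd hc x) := by
  induction x using JetAlgebra.induction_on with
  | const c => rw [Derivation.map_algebraMap, map_zero, taylor, JetAlgebra.lift_algebraMap, hc]
  | sym a n =>
    rw [JetAlgebra.der_sym, map_nsmul, taylor, JetAlgebra.lift_sym, JetAlgebra.lift_sym,
      succ_nsmul_divPow]
  | add x y hx hy => simp only [map_add, hx, hy]
  | mul x y hx hy =>
    rw [Derivation.leibniz, smul_eq_mul, smul_eq_mul, map_add, map_mul, map_mul, map_mul, hx, hy, hd]
    rfl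

/-- A homomorphism from the jet algebra compatible with derivations is determined by its values
on functions. -/
theorem JetAlgebra.hom_ext_of_der [CharZero k] {φ : k →+* B} (g : k →+* R) {d : R →+ R}
    {F G : JetAlgebra φ →+* R}
    (hF : ∀ x, F (JetAlgebra.der φ x) = d (F x)) (hG : ∀ x, G (JetAlgebra.der φ x) = d (G x))
    (h : ∀ a, F (JetAlgebra.of φ a) = G (JetAlgebra.of φ a)) : F = G := by
  refine JetAlgebra.hom_ext fun a n ↦ ?_
  induction n with
  | zero => exact h a
  | succ n ih =>
    -- As `(n + 1) a(n + 1) = ∂ a(n)`, the value on `a(n)` determines that on `a(n + 1)` after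
    -- division by `n + 1`.
    apply nsmul_cancel g (n := n)
    rw [← map_nsmul, ← JetAlgebra.der_sym, ← map_nsmul, ← JetAlgebra.der_sym, hF, hG, ih]

end Taylor

/-! ### Divisors of products of primes that divide their derivatives -/

section Primes

variable {R : Type*} [CommRing R]

/-- Divisors of products of elements dividing their derivative do so too, if the factors are primes
and not zero divisors. -/
theorem dvd_derivation_of_mul_eq_prod {d : R →+ R} (hd : IsDerivationAlong (.id R) d)
    (s : Multiset R) (hs : ∀ p ∈ s, (∀ x y, p ∣ x * y → p ∣ x ∨ p ∣ y) ∧ p ∈ nonZeroDivisors R ∧ p ∣ d p)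
    (a b : R) (h : a * b = s.prod) : a ∣ d a := by
  induction s using Multiset.induction_on generalizing a b with
  | empty =>
    rw [Multiset.prod_zero] at h
    exact (IsUnit.of_mul_eq_one _ h).dvd
  | cons p s ih =>
    obtain ⟨hp, hp0, hpd⟩ := hs p (Multiset.mem_cons_self p s)
    replace ih := ih fun q hq ↦ hs q (Multiset.mem_cons_of_mem hq)
    rw [Multiset.prod_cons] at h
    -- The prime `p` divides `a` or `b` and can be cancelled there. If `a = p a'`, then `∂a = p ∂a'
    -- + a' ∂p`, and `a` divides both terms.
    rcases hp a b ⟨_, h⟩ with ⟨a', rfl⟩ | ⟨b', rfl⟩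
    · have h' : a' * b = s.prod := by
        rw [mul_assoc] at h
        exact (mul_cancel_left_mem_nonZeroDivisors hp0).mp h
      rw [hd]
      exact dvd_add (mul_dvd_mul_left p (ih a' b h')) (by
        rw [mul_comm p a']
        exact mul_dvd_mul_left a' hpd)
    · refine ih a b' ?_
      rw [mul_left_comm] at h
      exact (mul_cancel_left_mem_nonZeroDivisors hp0).mp h

end Primes

end LogJets

namespace LogJets

/-! ### Polynomial coordinates on jet algebras over étale charts -/

section Coordinates

variable {k A C J : Type*} [Field k] [CommRing A] [CommRing C]

theorem etale_comp {B : Type*} [CommRing B] {f : A →+* B} {g : B →+* C} (hf : f.Etale)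
    (hg : g.Etale) : (g.comp f).Etale := by
  let _ := f.toAlgebra
  let _ := g.toAlgebra
  let _ := (g.comp f).toAlgebra
  have : IsScalarTower A B C := .of_algebraMap_eq fun _ ↦ rfl
  have : Algebra.Etale A B := hf
  have : Algebra.Etale B C := hg
  exact Algebra.Etale.comp A B C

theorem etale_of_bijective {f : A →+* C} (hf : Function.Bijective f) : f.Etale := by
  let _ := f.toAlgebra
  exact Algebra.Etale.of_equiv (AlgEquiv.ofBijective (Algebra.ofId A C) hf)

theorem etale_of_isLocalization {f : A →+* C} (a : A)
    (h : letI := f.toAlgebra; IsLocalization.Away a C) : f.Etale := by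
  let _ := f.toAlgebra
  exact Algebra.Etale.of_isLocalizationAway a

/-- Étaleness is stable under base change, and `A[σ]` is the base change of `A` along `B → B[σ]`. -/
theorem etale_mvPolynomial_map {B σ : Type*} [CommRing B] {φ : B →+* A} (hφ : φ.Etale) :
    (MvPolynomial.map (σ := σ) φ).Etale := by
  let _ := φ.toAlgebra
  have : Algebra.Etale B A := hφ
  have h1 : (algebraMap (MvPolynomial σ B) (TensorProduct B (MvPolynomial σ B) A)).Etale :=
    RingHom.etale_algebraMap.mpr inferInstance
  let e₁ : TensorProduct B (MvPolynomial σ B) A ≃+* TensorProduct B A (MvPolynomial σ B) :=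
    (Algebra.TensorProduct.comm B _ _).toRingEquiv
  let e₂ : TensorProduct B A (MvPolynomial σ B) ≃+* MvPolynomial σ A :=
    (MvPolynomial.algebraTensorAlgEquiv B A).toRingEquiv
  have h2 := etale_comp (g := (e₁.trans e₂).toRingHom) h1
    (etale_of_bijective (e₁.trans e₂).bijective)
  convert h2
  refine RingHom.ext fun p ↦ ?_
  change _ = MvPolynomial.algebraTensorAlgEquiv B A (Algebra.TensorProduct.comm B _ _ (p ⊗ₜ 1))
  rw [Algebra.TensorProduct.comm_tmul, MvPolynomial.algebraTensorAlgEquiv_tmul, one_smul]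
  rfl

/-- The étale coordinates on the product of a scheme with an affine space. -/
noncomputable def polyChart (φ : MvPolynomial J k →+* A) (σ : Type*) :
    MvPolynomial (σ ⊕ J) k →+* MvPolynomial σ A :=
  (MvPolynomial.map φ).comp (MvPolynomial.sumRingEquiv k σ J).toRingHom

theorem polyChart_etale {φ : MvPolynomial J k →+* A} (hφ : φ.Etale) (σ : Type*) :
    (polyChart φ σ).Etale :=
  etale_comp
    (etale_of_bijective (MvPolynomial.sumRingEquiv k σ J).bijective) (etale_mvPolynomial_map hφ)

variable (φ : MvPolynomial J k →+* A) {σ : Type*}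

theorem polyChart_C (c : k) : polyChart φ σ (.C c) = .C (φ (.C c)) := by
  simp [polyChart]

theorem polyChart_inl (s : σ) : polyChart φ σ (.X (.inl s)) = .X s := by
  simp [polyChart]

theorem polyChart_inr (j : J) : polyChart φ σ (.X (.inr j)) = .C (φ (.X j)) := by
  simp [polyChart]

variable {φ}

/-- Derivations of a polynomial algebra along a homomorphism may be prescribed on variables. -/
theorem exists_derivation_mvPolynomial {R : Type*} [CommRing R] (g : MvPolynomial σ k →+* R)
    (r : σ → R) : ∃ d : MvPolynomial σ k →+ R, IsDerivationAlong g d ∧ (∀ c, d (.C c) = 0) ∧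
      ∀ s, d (.X s) = r s := by
  let _ := (g.comp (MvPolynomial.C)).toAlgebra
  let _ := g.toAlgebra
  have : IsScalarTower k (MvPolynomial σ k) R := .of_algebraMap_eq fun _ ↦ rfl
  let D : Derivation k (MvPolynomial σ k) R := MvPolynomial.mkDerivation k r
  exact ⟨D.toLinearMap.toAddMonoidHom, fun a b ↦ D.leibniz a b, fun c ↦ D.map_algebraMap c,
    fun s ↦ MvPolynomial.mkDerivation_X k r s⟩

/-- Derivations of a polynomial algebra along a homomorphism agree if they agree on variables and
constants. -/
theorem IsDerivationAlong.ext_mvPolynomial {R : Type*} [CommRing R] {g : MvPolynomial σ k →+* R}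
    {d d' : MvPolynomial σ k →+ R} (hd : IsDerivationAlong g d) (hd' : IsDerivationAlong g d')
    (hC : ∀ c, d (.C c) = d' (.C c)) (hX : ∀ s, d (.X s) = d' (.X s)) (p : MvPolynomial σ k) :
    d p = d' p := by
  induction p using MvPolynomial.induction_on with
  | C c => exact hC c
  | add p q hp hq => rw [map_add, map_add, hp, hq]
  | mul_X p i hp => rw [hd, hd', hp, hX]

theorem IsDerivationAlong.ext_etale {R : Type*} [CommRing R] {φ : MvPolynomial σ k →+* A}
    (hφ : φ.Etale) {g : A →+* R}
    {d d' : A →+ R} (hd : IsDerivationAlong g d) (hd' : IsDerivationAlong g d')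
    (hC : ∀ c, d (φ (.C c)) = d' (φ (.C c))) (hX : ∀ s, d (φ (.X s)) = d' (φ (.X s))) :
    d = d' :=
  hd.ext_of_formallyUnramified hφ.formallyUnramified hd' fun p ↦
    (hd.comp φ).ext_mvPolynomial (hd'.comp φ) hC hX p

/-- The derivation of `A[z_{j,n}]` with `x_j ↦ e_j z_{j,0}` and `z_{j,n} ↦ z_{j,n+1}`. -/
theorem exists_logDerivation (hφ : φ.Etale) (e : J → A) :
    ∃ D : MvPolynomial (J × ℕ) A →+ MvPolynomial (J × ℕ) A, IsDerivationAlong (.id _) D ∧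
      (∀ c, D (.C (φ (.C c))) = 0) ∧ (∀ j, D (.C (φ (.X j))) = .C (e j) * .X (j, 0)) ∧
      ∀ j n, D (.X (j, n)) = .X (j, n + 1) := by
  -- Values can be prescribed freely on the étale coordinates of `A[z_{j,n}]`, namely the `z_{j,n}`
  -- and the `x_j`; the derivation then extends along the étale homomorphism.
  obtain ⟨d, hd, hC, hX⟩ := exists_derivation_mvPolynomial
    ((RingHom.id _).comp (polyChart φ (J × ℕ)))
    (Sum.elim (fun p ↦ .X (p.1, p.2 + 1)) (fun j ↦ .C (e j) * .X (j, 0)))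
  obtain ⟨D, hD, h⟩ := IsDerivationAlong.exists_extension
    (formallyEtale_of_etale (polyChart_etale hφ (J × ℕ))) hd
  refine ⟨D, hD, fun c ↦ ?_, fun j ↦ ?_, fun j n ↦ ?_⟩
  · rw [← polyChart_C, h, hC]
  · rw [← polyChart_inr, h, hX]
    rfl
  · rw [← polyChart_inl φ, h, hX]
    rfl

variable {φC : k →+* C} {ι : A →+* C}

/-- The homomorphism `A[z_{j,n}] → J C` that sends `z_{j,n}` to `∂^n ζ_j`. -/
noncomputable def logCoord (φC : k →+* C) (ι : A →+* C) (ζ : J → JetAlgebra φC) :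
    MvPolynomial (J × ℕ) A →+* JetAlgebra φC :=
  MvPolynomial.eval₂Hom ((JetAlgebra.of φC).comp ι) fun p ↦ (JetAlgebra.der φC)^[p.2] (ζ p.1)

@[simp]
theorem logCoord_C (ζ : J → JetAlgebra φC) (a : A) :
    logCoord φC ι ζ (.C a) = JetAlgebra.of φC (ι a) := by simp [logCoord]

@[simp]
theorem logCoord_X (ζ : J → JetAlgebra φC) (j : J) (n : ℕ) :
    logCoord φC ι ζ (.X (j, n)) = (JetAlgebra.der φC)^[n] (ζ j) := by simp [logCoord]

theorem JetAlgebra.isDerivationAlong_der : IsDerivationAlong (.id _)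
    (JetAlgebra.der φC).toLinearMap.toAddMonoidHom := fun a b ↦ (JetAlgebra.der φC).leibniz a b

theorem JetAlgebra.of_comp : (JetAlgebra.of φC).comp φC = algebraMap k _ :=
  RingHom.ext fun c ↦ (JetAlgebra.sym_const φC c 0).trans (if_pos rfl)

/-- Both sides are derivations along `logCoord φC ι ζ`, and its source is étale over a polynomial
algebra, so they need only be compared on constants and coordinates. On `x_j` the equality is the
relation `e_j ζ_j = ∂x_j`. As a consequence, the range of `logCoord` is closed under `∂`. -/
theorem logCoord_der (hφ : φ.Etale) (hφC : ι.comp (φ.comp MvPolynomial.C) = φC) {e : J → A}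
    {ζ : J → JetAlgebra φC}
    (hζ : ∀ j, JetAlgebra.of φC (ι (e j)) * ζ j =
      JetAlgebra.der φC (JetAlgebra.of φC (ι (φ (.X j)))))
    {D : MvPolynomial (J × ℕ) A →+ MvPolynomial (J × ℕ) A} (hD : IsDerivationAlong (.id _) D)
    (hC : ∀ c, D (.C (φ (.C c))) = 0) (hX : ∀ j, D (.C (φ (.X j))) = .C (e j) * .X (j, 0))
    (hz : ∀ j n, D (.X (j, n)) = .X (j, n + 1)) (x : MvPolynomial (J × ℕ) A) :
    logCoord φC ι ζ (D x) = JetAlgebra.der φC (logCoord φC ι ζ x) := by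
  refine DFunLike.congr_fun (IsDerivationAlong.ext_etale (polyChart_etale hφ (J × ℕ))
    (hD.postcomp (logCoord φC ι ζ)) (JetAlgebra.isDerivationAlong_der.comp (logCoord φC ι ζ))
    (fun c ↦ ?_) fun s ↦ ?_) x
  · rw [polyChart_C]
    change logCoord φC ι ζ (D _) = JetAlgebra.der φC (logCoord φC ι ζ _)
    rw [hC, map_zero, logCoord_C, show ι (φ (.C c)) = φC c from RingHom.congr_fun hφC c,
      ← RingHom.comp_apply, JetAlgebra.of_comp, Derivation.map_algebraMap]
  · rcases s with ⟨j, n⟩ | j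
    · rw [polyChart_inl]
      change logCoord φC ι ζ (D _) = JetAlgebra.der φC (logCoord φC ι ζ _)
      rw [hz, logCoord_X, logCoord_X, Function.iterate_succ_apply']
    · rw [polyChart_inr]
      change logCoord φC ι ζ (D _) = JetAlgebra.der φC (logCoord φC ι ζ _)
      rw [hX, map_mul, logCoord_C, logCoord_X, logCoord_C]
      exact hζ j

/-- The ring `C[z_{j,n}]` has a derivation with `x_j ↦ e_j z_{j,0}` and `z_{j,n} ↦ z_{j,n+1}`.
Taylor expansion along it sends `∂^n ζ_j` back to `z_{j,n}`, so it inverts `logCoord` up to the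
injection of the coefficients `A` into `C`. -/
theorem logCoord_injective [CharZero k] (hφ : φ.Etale) (hι : ι.Etale) (hι' : Function.Injective ι)
    (hφC : ι.comp (φ.comp MvPolynomial.C) = φC) {e : J → A} (he : ∀ j, IsUnit (ι (e j)))
    {ζ : J → JetAlgebra φC}
    (hζ : ∀ j, JetAlgebra.of φC (ι (e j)) * ζ j =
      JetAlgebra.der φC (JetAlgebra.of φC (ι (φ (.X j))))) :
    Function.Injective (logCoord φC ι ζ) := by
  obtain ⟨D, hD, hC, hX, hz⟩ := exists_logDerivation
    (etale_comp hφ hι) fun j ↦ ι (e j)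
  let Ψ : JetAlgebra φC →+* MvPolynomial (J × ℕ) C :=
    taylor (MvPolynomial.C) (g := MvPolynomial.C.comp φC) rfl hD
      fun c ↦ by rw [← hφC]; exact hC c
  have hΨ : ∀ x, Ψ (JetAlgebra.der φC x) = D (Ψ x) := fun _ ↦ taylor_der ..
  have hΨ' : ∀ a, Ψ (JetAlgebra.of φC a) = .C a := fun _ ↦ taylor_of ..
  have hΨζ : ∀ j, Ψ (ζ j) = .X (j, 0) := fun j ↦ by
    -- Apply `Ψ` to `e_j ζ_j = ∂x_j` and cancel `e_j`, which is a unit in `C`.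
    have h := congrArg Ψ (hζ j)
    rw [map_mul, hΨ, hΨ', hΨ'] at h
    exact ((he j).map MvPolynomial.C).mul_left_cancel (h.trans (hX j))
  have hΨn : ∀ j n, Ψ ((JetAlgebra.der φC)^[n] (ζ j)) = .X (j, n) := fun j n ↦ by
    induction n with
    | zero => exact hΨζ j
    | succ n ih => rw [Function.iterate_succ_apply', hΨ, ih, hz]
  have key : Ψ.comp (logCoord φC ι ζ) = MvPolynomial.map ι := by
    refine MvPolynomial.ringHom_ext (fun a ↦ ?_) fun p ↦ ?_
    · rw [RingHom.comp_apply, logCoord_C, hΨ', MvPolynomial.map_C]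
    · rw [RingHom.comp_apply, logCoord_X, hΨn, MvPolynomial.map_X]
  refine Function.Injective.of_comp (f := Ψ) ?_
  rw [← RingHom.coe_comp, key]
  exact MvPolynomial.map_injective ι hι'

end Coordinates

end LogJets

namespace LogJets

/-! ### Sections off a divisor, and ideals of closed subsets -/

section Sections

variable {X : Scheme.{u}}

theorem eq_of_locally_eq {W : X.Opens} (s t : Γ(X, W))
    (h : ∀ x ∈ W, ∃ (V : X.Opens) (hV : V ≤ W), x ∈ V ∧ res hV s = res hV t) : s = t := by
  choose V hV hx h using h
  refine X.sheaf.eq_of_locally_eq' (fun x : W ↦ V x.1 x.2) W (fun x ↦ homOfLE (hV x.1 x.2))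
    (fun x hx' ↦ Opens.mem_iSup.mpr ⟨⟨x, hx'⟩, hx x hx'⟩) s t fun x ↦ h x.1 x.2

theorem res_refl {W : X.Opens} (s : Γ(X, W)) : res le_rfl s = s := by
  change (X.presheaf.map (𝟙 _)).hom s = s
  rw [X.presheaf.map_id]
  rfl

theorem basicOpen_res {U V : X.Opens} (h : V ≤ U) (s : Γ(X, U)) :
    X.basicOpen (res h s) = V ⊓ X.basicOpen s := Scheme.basicOpen_res X s (homOfLE h).op

/-- Being the restriction of a section is a local condition, for a section on `W ∩ O` for which
restriction to `O` is injective. -/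
theorem mem_range_res_of_locally (O : X.Opens)
    (hO : ∀ W : X.Opens, Function.Injective (res (inf_le_left : W ⊓ O ≤ W)))
    {W : X.Opens} (s : Γ(X, W ⊓ O))
    (h : ∀ x ∈ W, ∃ (V : X.Opens) (hV : V ≤ W), x ∈ V ∧
      ∃ t : Γ(X, V), res inf_le_left t = res (inf_le_inf_right O hV) s) :
    ∃ t : Γ(X, W), res inf_le_left t = s := by
  choose V hV hx t ht using h
  obtain ⟨r, hr, -⟩ := X.sheaf.existsUnique_gluing' (fun x : W ↦ V x.1 x.2) W
    (fun x ↦ homOfLE (hV x.1 x.2)) (fun x hx' ↦ Opens.mem_iSup.mpr ⟨⟨x, hx'⟩, hx x hx'⟩)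
    -- The local extensions agree on overlaps because they agree there after restriction to `O`,
    -- which is injective.
    (fun x ↦ t x.1 x.2) (fun x y ↦ hO _ (by
      change res _ (res inf_le_left (t x.1 x.2)) = res _ (res inf_le_right (t y.1 y.2))
      have h1 := congrArg (res (inf_le_inf_right O inf_le_left :
        (V x.1 x.2 ⊓ V y.1 y.2) ⊓ O ≤ V x.1 x.2 ⊓ O)) (ht x.1 x.2)
      have h2 := congrArg (res (inf_le_inf_right O inf_le_right :
        (V x.1 x.2 ⊓ V y.1 y.2) ⊓ O ≤ V y.1 y.2 ⊓ O)) (ht y.1 y.2)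
      rw [res_res, res_res] at h1 h2
      rw [res_res, res_res, h1, h2]))
  refine ⟨r, eq_of_locally_eq _ _ ?_⟩
  rintro x ⟨hx₁, hx₂⟩
  have hx₁ : x ∈ W := hx₁
  refine ⟨V x hx₁ ⊓ O, inf_le_inf_right O (hV x hx₁), ⟨hx x hx₁, hx₂⟩, ?_⟩
  have hr' : res (hV x hx₁) r = t x hx₁ := hr ⟨x, hx₁⟩
  rw [← ht, ← hr']
  exact (res_res ..).trans (res_res ..).symm

theorem mem_vanishingIdeal_iff {Z : Closeds X} {U : X.affineOpens} {s : Γ(X, U)} :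
    s ∈ (Scheme.IdealSheafData.vanishingIdeal Z).ideal U ↔ ∀ x ∈ Z, x ∉ X.basicOpen s := by
  rw [Scheme.IdealSheafData.vanishingIdeal_ideal, PrimeSpectrum.mem_vanishingIdeal]
  constructor
  · intro h x hxZ hxs
    have hxU : x ∈ U.1 := X.basicOpen_le s hxs
    rw [← SetLike.mem_coe, ← U.2.range_fromSpec] at hxU
    obtain ⟨y, rfl⟩ := hxU
    have := h y hxZ
    have h2 : y ∈ U.2.fromSpec ⁻¹ᵁ X.basicOpen s := hxs
    rw [U.2.fromSpec_preimage_basicOpen] at h2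
    exact h2 this
  · intro h y hy
    have := h _ hy
    change y ∉ U.2.fromSpec ⁻¹ᵁ X.basicOpen s at this
    rw [U.2.fromSpec_preimage_basicOpen] at this
    exact not_not.mp this

/-- Two open subsets that meet an irreducible `Z` meet each other inside `Z`. If `Z` misses `U`, the
ideal is the whole ring, hence a disjunction and not a statement about prime ideals. -/
theorem mul_mem_primeLike {Z : Closeds X} (hZ : IsIrreducible (Z : Set X)) {U : X.affineOpens}
    {s t : Γ(X, U)} (h : s * t ∈ (Scheme.IdealSheafData.vanishingIdeal Z).ideal U) :
    s ∈ (Scheme.IdealSheafData.vanishingIdeal Z).ideal U ∨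
      t ∈ (Scheme.IdealSheafData.vanishingIdeal Z).ideal U := by
  simp only [mem_vanishingIdeal_iff] at h ⊢
  by_contra! hst
  obtain ⟨⟨x, hx, hxs⟩, ⟨y, hy, hyt⟩⟩ := hst
  obtain ⟨z, hz, hzs, hzt⟩ := hZ.2 _ _ (X.basicOpen s).isOpen (X.basicOpen t).isOpen
    ⟨x, hx, hxs⟩ ⟨y, hy, hyt⟩
  exact h z hz (by rw [Scheme.basicOpen_mul]; exact ⟨hzs, hzt⟩)

end Sections

/-! ### Log charts: equations of components and their derivatives -/

section Charts

variable {k : Type u} [Field k] {X : Over (Spec (.of k))} {D : Closeds X.left}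

/-- The irreducible components of `D` that meet `U`. -/
abbrev meetingComponents (D : Closeds X.left) (U : X.left.Opens) : Set (Closeds X.left) :=
  {Z ∈ components D | ((Z : Set X.left) ∩ U).Nonempty}

/-- Étale coordinates on an affine open subset, among which there are equations of the components of
`D`. -/
structure LogChart (X : Over (Spec (.of k))) (D : Closeds X.left) (U : X.left.affineOpens) where
  /-- the set of coordinates -/
  J : Type u
  /-- the coordinates -/
  φ : MvPolynomial J k →+* Γ(X.left, U)
  /-- the coordinates that define components of `D` -/
  σ : meetingComponents D U.1 → J
  φ_comp : φ.comp MvPolynomial.C = consts X U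
  etale : φ.Etale
  finite : (meetingComponents D U.1).Finite
  injective : Function.Injective σ
  ideal_eq : ∀ Z, (Scheme.IdealSheafData.vanishingIdeal Z.1).ideal U =
      Ideal.span {φ (MvPolynomial.X (σ Z))}

theorem LogChart.hasLogChart {U : X.left.affineOpens} (c : LogChart X D U) {p : X.left}
    (hp : p ∈ U.1) : HasLogChart X D p :=
  ⟨U, c.J, c.φ, c.σ, hp, c.φ_comp, c.etale, c.finite, c.injective, c.ideal_eq⟩

/-- A chart restricts to basic open subsets: localization is étale, the ideals of the components
localize, and the components that meet the smaller open subset are among those that met the larger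
one. -/
theorem HasLogChart.exists_logChart_le {p : X.left} (h : HasLogChart X D p) (W : X.left.Opens)
    (hp : p ∈ W) : ∃ U : X.left.affineOpens, p ∈ U.1 ∧ U.1 ≤ W ∧ Nonempty (LogChart X D U) := by
  obtain ⟨U, J, φ, σ, hpU, h1, h2, h3, h4, h5⟩ := h
  obtain ⟨g, hg, hpg⟩ := U.2.exists_basicOpen_le ⟨p, hp⟩ hpU
  let V : X.left.affineOpens := X.left.affineBasicOpen g
  have hVU : V ≤ U := X.left.basicOpen_le g
  have hsub : meetingComponents D V.1 ⊆ meetingComponents D U.1 := fun Z hZ ↦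
    ⟨hZ.1, hZ.2.mono (Set.inter_subset_inter_right _ hVU)⟩
  refine ⟨V, hpg, hg, ⟨⟨J, (res hVU).comp φ, σ ∘ Set.inclusion hsub, ?_, ?_, h3.subset hsub,
    h4.comp (Set.inclusion_injective hsub), fun Z ↦ ?_⟩⟩⟩
  · rw [RingHom.comp_assoc, h1]
    exact res_comp_consts X hVU
  · exact etale_comp h2 (etale_of_isLocalization g (U.2.isLocalization_basicOpen g))
  · rw [← Scheme.IdealSheafData.map_ideal _ hVU, h5 ⟨Z.1, hsub Z.2⟩, Ideal.map_span,
      Set.image_singleton]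
    rfl

namespace LogChart

variable {U : X.left.affineOpens} (c : LogChart X D U)

/-- The equation of a component of `D`. -/
noncomputable def eqn (Z : meetingComponents D U.1) : Γ(X.left, U) := c.φ (.X (c.σ Z))

theorem mem_ideal_iff (Z : meetingComponents D U.1) {s : Γ(X.left, U)} :
    s ∈ (Scheme.IdealSheafData.vanishingIdeal Z.1).ideal U ↔ c.eqn Z ∣ s := by
  rw [c.ideal_eq, Ideal.mem_span_singleton]
  rfl

theorem mem_iff (Z : meetingComponents D U.1) {x : X.left} (hx : x ∈ U.1) :
    x ∈ Z.1 ↔ x ∉ X.left.basicOpen (c.eqn Z) :=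
  LogPair.mem_iff_of_ideal_eq Z.1 U _ (c.ideal_eq Z) hx

theorem dvd_or_dvd (Z : meetingComponents D U.1) {s t : Γ(X.left, U)} (h : c.eqn Z ∣ s * t) :
    c.eqn Z ∣ s ∨ c.eqn Z ∣ t := by
  rw [← mem_ideal_iff] at h
  rw [← mem_ideal_iff, ← mem_ideal_iff]
  exact mul_mem_primeLike Z.2.1.1.1 h

/-- A variable is not a zero divisor in the polynomial algebra, and this persists because étale
homomorphisms are flat. -/
theorem eqn_mem_nonZeroDivisors (Z : meetingComponents D U.1) :
    c.eqn Z ∈ nonZeroDivisors Γ(X.left, U) := by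
  let _ := c.φ.toAlgebra
  have : Algebra.Etale (MvPolynomial c.J k) Γ(X.left, U) := c.etale
  have hX : (MvPolynomial.X (c.σ Z) : MvPolynomial c.J k) ∈ nonZeroDivisors _ :=
    mem_nonZeroDivisors_of_ne_zero (MvPolynomial.X_ne_zero _)
  have h := Module.Flat.isSMulRegular_of_nonZeroDivisors (M := Γ(X.left, U)) hX
  rw [mem_nonZeroDivisors_iff_right]
  intro x hx
  refine h ?_
  change c.φ _ * x = c.φ _ * 0
  rw [mul_zero, mul_comm]
  exact hx

theorem exists_mem_of_mem {x : X.left} (hx : x ∈ U.1) (hxD : x ∈ D) :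
    ∃ Z : meetingComponents D U.1, x ∈ Z.1 := by
  obtain ⟨Z, hZ, hxZ⟩ := exists_component D hxD
  exact ⟨⟨Z, hZ, x, hxZ, hx⟩, hxZ⟩

/-- The equation of `D`. -/
noncomputable def prodEqn : Γ(X.left, U) :=
  letI := c.finite.fintype
  ∏ Z, c.eqn Z

theorem prodEqn_mem_nonZeroDivisors : c.prodEqn ∈ nonZeroDivisors Γ(X.left, U) :=
  letI := c.finite.fintype
  prod_mem fun Z _ ↦ c.eqn_mem_nonZeroDivisors Z

theorem mem_iff_notMem_basicOpen {x : X.left} (hx : x ∈ U.1) :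
    x ∈ D ↔ x ∉ X.left.basicOpen c.prodEqn := by
  let _ := c.finite.fintype
  have h1 : x ∈ X.left.basicOpen c.prodEqn ↔ ∀ Z, x ∈ X.left.basicOpen (c.eqn Z) := by
    simp only [Scheme.mem_basicOpen _ _ _ hx, prodEqn, map_prod, IsUnit.prod_univ_iff]
  rw [h1, not_forall]
  constructor
  · intro hxD
    obtain ⟨Z, hxZ⟩ := exists_mem_of_mem hx hxD
    exact ⟨Z, (c.mem_iff Z hx).mp hxZ⟩
  · rintro ⟨Z, hZ⟩
    exact Z.2.1.1.2 ((c.mem_iff Z hx).mpr hZ)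

theorem inf_compl_eq_basicOpen : U.1 ⊓ D.compl = X.left.basicOpen c.prodEqn := by
  ext x
  constructor
  · rintro ⟨hx, hxD⟩
    exact not_not.mp fun h ↦ hxD ((c.mem_iff_notMem_basicOpen hx).mpr h)
  · intro hx
    have hxU := X.left.basicOpen_le _ hx
    exact ⟨hxU, fun hxD ↦ (c.mem_iff_notMem_basicOpen hxU).mp hxD hx⟩

theorem isLocalization : letI := (res (inf_le_left : U.1 ⊓ D.compl ≤ U.1)).toAlgebra
    IsLocalization.Away c.prodEqn Γ(X.left, U.1 ⊓ D.compl) :=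
  LogPair.isLocalization_of_eq U.2.isCompact U.2.isQuasiSeparated _ _ c.inf_compl_eq_basicOpen

theorem res_injective (c : LogChart X D U) :
    Function.Injective (res (inf_le_left : U.1 ⊓ D.compl ≤ U.1)) := by
  let _ := (res (inf_le_left : U.1 ⊓ D.compl ≤ U.1)).toAlgebra
  have := c.isLocalization
  exact IsLocalization.injective _ (Submonoid.powers_le.mpr c.prodEqn_mem_nonZeroDivisors)

theorem isUnit_res_eqn (Z : meetingComponents D U.1) :
    IsUnit (res (inf_le_left : U.1 ⊓ D.compl ≤ U.1) (c.eqn Z)) := by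
  let _ := c.finite.fintype
  let _ := (res (inf_le_left : U.1 ⊓ D.compl ≤ U.1)).toAlgebra
  have := c.isLocalization
  have h : IsUnit (res (inf_le_left : U.1 ⊓ D.compl ≤ U.1) c.prodEqn) :=
    IsLocalization.Away.algebraMap_isUnit (S := Γ(X.left, U.1 ⊓ D.compl)) c.prodEqn
  rw [prodEqn, map_prod, IsUnit.prod_univ_iff] at h
  exact h Z

/-- Divisibility gives `Z ∩ U ⊆ Z'`. As `Z ∩ U` is dense in the irreducible set `Z`, it follows that
`Z ⊆ Z'`, and components are maximal. -/
theorem eqn_dvd_eqn {Z Z' : meetingComponents D U.1} (h : c.eqn Z ∣ c.eqn Z') : Z = Z' := by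
  rw [← mem_ideal_iff, mem_vanishingIdeal_iff] at h
  have hsub : (Z.1 : Set X.left) ∩ U.1 ⊆ Z'.1 := fun x hx ↦
    (c.mem_iff Z' hx.2).mpr (h x hx.1)
  have hle : (Z.1 : Set X.left) ⊆ Z'.1 := by
    have h1 : (Z.1 : Set X.left) ⊆ closure ((Z.1 : Set X.left) ∩ U.1) :=
      subset_closure_inter_of_isPreirreducible_of_isOpen Z.2.1.1.1.2 U.1.isOpen Z.2.2
    exact h1.trans (closure_minimal hsub Z'.1.isClosed)
  exact Subtype.ext (le_antisymm hle (Z.2.1.2 Z'.2.1.1 hle))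

/-- The equations of the components divide their derivatives along vector fields tangent to `D`. -/
theorem eqn_dvd_der {δ : VectorField X} (hδ : δ.IsTangent D) (Z : meetingComponents D U.1) :
    c.eqn Z ∣ δ.der U.1 (c.eqn Z) := by
  classical
  let _ := c.finite.fintype
  have h1 : c.prodEqn ∈ (Scheme.IdealSheafData.vanishingIdeal D).ideal U :=
    mem_vanishingIdeal_iff.mpr fun x hx hx' ↦
      (c.mem_iff_notMem_basicOpen (X.left.basicOpen_le _ hx')).mp hx hx'
  have h2 : c.eqn Z ∣ δ.der U.1 c.prodEqn := (c.mem_ideal_iff Z).mp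
    (Scheme.IdealSheafData.vanishingIdeal_antimono Z.2.1.1.2 U (hδ U _ h1))
  have h3 : c.prodEqn = c.eqn Z * ∏ Z' ∈ Finset.univ.erase Z, c.eqn Z' :=
    (Finset.mul_prod_erase _ _ (Finset.mem_univ Z)).symm
  -- Tangency only controls the derivative of the equation of `D`. By the Leibniz rule, the equation
  -- of `Z` divides its own derivative times the product of the other equations, and as a prime it
  -- does not divide that product.
  rw [h3, δ.leibniz, dvd_add_right (dvd_mul_right _ _)] at h2
  refine (c.dvd_or_dvd Z h2).resolve_left fun h ↦ ?_
  suffices ∀ s : Finset (meetingComponents D U.1), c.eqn Z ∣ ∏ Z' ∈ s, c.eqn Z' → Z ∈ s from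
    Finset.notMem_erase Z _ (this _ h)
  intro s
  induction s using Finset.induction_on with
  | empty =>
    intro h
    rw [Finset.prod_empty] at h
    -- The equation of `Z` is not a unit, because `Z` meets `U`.
    obtain ⟨x, hxZ, hxU⟩ := Z.2.2
    refine absurd ?_ ((c.mem_iff Z hxU).mp hxZ)
    rw [Scheme.mem_basicOpen _ _ _ hxU]
    exact (isUnit_of_dvd_one h).map _
  | insert Z' s hZ' ih =>
    intro h
    rw [Finset.prod_insert hZ'] at h
    rcases c.dvd_or_dvd Z h with h | h
    · rw [c.eqn_dvd_eqn h]
      exact Finset.mem_insert_self _ _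
    · exact Finset.mem_insert_of_mem (ih h)

/-- Functions invertible off `D` divide their derivatives along vector fields tangent to `D`. -/
theorem dvd_der_of_isUnit (c : LogChart X D U) {δ : VectorField X} (hδ : δ.IsTangent D)
    {a : Γ(X.left, U)}
    (ha : IsUnit (res (inf_le_left : U.1 ⊓ D.compl ≤ U.1) a)) : a ∣ δ.der U.1 a := by
  let _ := c.finite.fintype
  let ι := res (inf_le_left : U.1 ⊓ D.compl ≤ U.1)
  let _ := ι.toAlgebra
  have := c.isLocalization
  obtain ⟨b, hb⟩ := ha.exists_right_inv
  obtain ⟨n, b', hb'⟩ := IsLocalization.Away.surj c.prodEqn b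
  -- The inverse of `a` off `D` has the form `b' / γ^n`, where `γ` is the equation of `D`; so `a`
  -- divides a power of `γ`.
  have h : a * b' = c.prodEqn ^ n := c.res_injective (by
    rw [map_mul, map_pow]
    change ι a * algebraMap _ _ b' = ι _ ^ n
    rw [← hb', ← mul_assoc]
    change ι a * b * ι _ ^ n = _
    rw [hb, one_mul])
  refine dvd_derivation_of_mul_eq_prod (d := δ.der U.1) (δ.leibniz U.1)
    (n • Finset.univ.val.map c.eqn) ?_ a b' (by rw [h, Multiset.prod_nsmul]; rfl)
  intro p hp
  obtain ⟨Z, -, rfl⟩ := Multiset.mem_map.mp (Multiset.mem_of_mem_nsmul hp)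
  exact ⟨fun x y ↦ c.dvd_or_dvd Z, c.eqn_mem_nonZeroDivisors Z, c.eqn_dvd_der hδ Z⟩

end LogChart

theorem LogPair.exists_logChart (P : LogPair k) {p : P.X.left} (W : P.X.left.Opens) (hp : p ∈ W) :
    ∃ U : P.X.left.affineOpens, p ∈ U.1 ∧ U.1 ≤ W ∧ Nonempty (LogChart P.X P.D U) :=
  (P.hasLogChart p).exists_logChart_le W hp

/-- Functions are determined by their restrictions to the complement of the divisor. -/
theorem LogPair.res_away_injective (P : LogPair k) (W : P.X.left.Opens) :
    Function.Injective (res (inf_le_left : P.away W ≤ W)) := by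
  intro s t h
  refine eq_of_locally_eq _ _ fun x hx ↦ ?_
  obtain ⟨U, hxU, hU, ⟨c⟩⟩ := P.exists_logChart W hx
  refine ⟨U.1, hU, hxU, c.res_injective ?_⟩
  have := congrArg (res (P.away_le hU)) h
  rw [res_res, res_res] at this
  rw [res_res, res_res, this]

end Charts

end LogJets

/-! ### The affine pieces of the log jet space -/

namespace LogJets

theorem isIso_appLE_top {X Y : Scheme.{u}} (f : X ⟶ Y) [IsOpenImmersion f] {W : Y.Opens}
    (hW : W = f.opensRange) (h : ⊤ ≤ f ⁻¹ᵁ W) : IsIso (f.appLE W ⊤ h) := by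
  obtain rfl : W = f ''ᵁ ⊤ := hW.trans f.image_top_eq_opensRange.symm
  rw [← Scheme.Hom.appIso_hom']
  infer_instance

theorem isAffineOpen_toOpens {X : Scheme.{u}} (U : X.AffineZariskiSite) : IsAffineOpen U.toOpens :=
  U.2

theorem SpecMap_comp_appLE_ΓSpecIso {X : Scheme.{u}} {R S : CommRingCat.{u}} (m : R ⟶ S)
    (g : Spec R ⟶ X) (W : X.Opens) (h : ⊤ ≤ (Spec.map m ≫ g) ⁻¹ᵁ W) (h' : ⊤ ≤ g ⁻¹ᵁ W) :
    (Spec.map m ≫ g).appLE W ⊤ h ≫ (Scheme.ΓSpecIso S).hom =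
      g.appLE W ⊤ h' ≫ (Scheme.ΓSpecIso R).hom ≫ m := by
  rw [← Scheme.ΓSpecIso_naturality, ← Scheme.Hom.appLE_comp_appLE _ _ _ _ _ h' le_top, Category.assoc]
  congr 2

theorem SpecMap_comp_fromSpec_appLE_ΓSpecIso {X : Scheme.{u}} {U : X.Opens} (hU : IsAffineOpen U)
    {S : CommRingCat.{u}} (m : Γ(X, U) ⟶ S) (h : ⊤ ≤ (Spec.map m ≫ hU.fromSpec) ⁻¹ᵁ U) :
    (Spec.map m ≫ hU.fromSpec).appLE U ⊤ h ≫ (Scheme.ΓSpecIso S).hom = m := by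
  rw [SpecMap_comp_appLE_ΓSpecIso m _ _ h (by rw [hU.fromSpec_preimage_self]), Scheme.Hom.appLE,
    hU.fromSpec_app_self, Category.assoc, Category.assoc, ← Functor.map_comp_assoc]
  rw [show (eqToHom hU.fromSpec_preimage_self).op ≫ (homOfLE _).op = 𝟙 _ from rfl]
  simp

namespace LogPair

variable {k : Type u} [Field k] (P : LogPair k)

/-- The preimage of an affine open subset in the log jet space. -/
noncomputable abbrev above (U : P.X.left.AffineZariskiSite) : P.logJet.left.Opens :=
  P.logJetProj.left ⁻¹ᵁ U.toOpens

instance : (P.logJetGluingData.functor ⋙ Scheme.forget).IsLocallyDirected :=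
  Scheme.Cover.RelativeGluingData.instIsLocallyDirectedI₀CompFunctorForgetOfIsThin ..

instance (U : P.X.left.AffineZariskiSite) : IsOpenImmersion (P.logJetChart U) :=
  P.logJetGluingData.cover.map_prop U

theorem above_eq_opensRange (U : P.X.left.AffineZariskiSite) :
    P.above U = (P.logJetChart U).opensRange := by
  have h := P.logJetGluingData.toBase_preimage_eq_opensRange_ι U
  have h2 : ((Scheme.AffineZariskiSite.directedCover P.X.left).f U).opensRange = U.toOpens :=
    Scheme.Opens.opensRange_ι _
  rw [h2] at h
  exact h

theorem isAffineOpen_above (U : P.X.left.AffineZariskiSite) : IsAffineOpen (P.above U) := by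
  rw [above_eq_opensRange]
  exact isAffineOpen_opensRange _

theorem above_mono {U V : P.X.left.AffineZariskiSite} (h : V ≤ U) : P.above V ≤ P.above U :=
  P.logJetProj.left.preimage_mono (Scheme.AffineZariskiSite.toOpens_mono h)

/-- The functions on `U`, as log jets. -/
noncomputable def fnHom (U : P.X.left.AffineZariskiSite) :
    Γ(P.X.left, U.toOpens) →+* P.logJetAlgebra U :=
  (P.fn U.toOpens).codRestrict _ (P.fn_mem U)

/-- The restriction of log jets. -/
noncomputable def resHom {U V : P.X.left.AffineZariskiSite} (h : V ≤ U) :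
    P.logJetAlgebra U →+* P.logJetAlgebra V :=
  (P.resJets (Scheme.AffineZariskiSite.toOpens_mono h)).restrict _ _ fun _ hs ↦ P.resJets_mem _ hs

theorem map_logJetChart {U V : P.X.left.AffineZariskiSite} (h : V ≤ U) :
    Spec.map (CommRingCat.ofHom (P.resHom h)) ≫ P.logJetChart U = P.logJetChart V :=
  Limits.colimit.w P.logJetGluingData.functor (homOfLE h)

theorem logJetChart_proj (U : P.X.left.AffineZariskiSite) :
    P.logJetChart U ≫ P.logJetProj.left =
      Spec.map (CommRingCat.ofHom (P.fnHom U)) ≫ (isAffineOpen_toOpens U).fromSpec :=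
  (P.logJetGluingData.ι_toBase U).trans (Category.assoc _ _ _)

/-- The chart over `U` is an open immersion whose image is the full preimage of `U`. -/
theorem logJetSections_bijective (U : P.X.left.AffineZariskiSite) :
    Function.Bijective (P.logJetSections U) := by
  have := isIso_appLE_top (P.logJetChart U) (P.above_eq_opensRange U)
    (P.top_le_preimage_logJetChart U)
  have h : IsIso ((P.logJetChart U).appLE _ ⊤ (P.top_le_preimage_logJetChart U) ≫
    (Scheme.ΓSpecIso (.of (P.logJetAlgebra U))).hom) := IsIso.comp_isIso
  exact ConcreteCategory.bijective_of_isIso ((P.logJetChart U).appLE _ ⊤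
    (P.top_le_preimage_logJetChart U) ≫ (Scheme.ΓSpecIso (.of (P.logJetAlgebra U))).hom)

theorem logJetSections_res {U V : P.X.left.AffineZariskiSite} (h : V ≤ U)
    (s : Γ(P.logJet.left, P.above U)) :
    P.logJetSections V (res (P.above_mono h) s) = P.resHom h (P.logJetSections U s) := by
  have key : P.logJet.left.presheaf.map (homOfLE (P.above_mono h)).op ≫
      (P.logJetChart V).appLE _ ⊤ (P.top_le_preimage_logJetChart V) ≫
        (Scheme.ΓSpecIso (.of (P.logJetAlgebra V))).hom =
      (P.logJetChart U).appLE _ ⊤ (P.top_le_preimage_logJetChart U) ≫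
        (Scheme.ΓSpecIso (.of (P.logJetAlgebra U))).hom ≫ CommRingCat.ofHom (P.resHom h) := by
    rw [← SpecMap_comp_appLE_ΓSpecIso _ _ _ (by
      rw [P.map_logJetChart h]
      exact (P.top_le_preimage_logJetChart V).trans
        ((P.logJetChart V).preimage_mono (P.above_mono h))), Scheme.Hom.map_appLE_assoc]
    simp only [P.map_logJetChart h]
  exact RingHom.congr_fun (congrArg CommRingCat.Hom.hom key) s

theorem logJetSections_proj (U : P.X.left.AffineZariskiSite) (a : Γ(P.X.left, U.toOpens)) :
    P.logJetSections U ((P.logJetProj.left.app U.toOpens).hom a) = P.fnHom U a := by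
  have key : P.logJetProj.left.app U.toOpens ≫
      (P.logJetChart U).appLE _ ⊤ (P.top_le_preimage_logJetChart U) ≫
        (Scheme.ΓSpecIso (.of (P.logJetAlgebra U))).hom = CommRingCat.ofHom (P.fnHom U) := by
    rw [← Scheme.Hom.appLE_eq_app, Scheme.Hom.appLE_comp_appLE_assoc]
    simp only [P.logJetChart_proj U]
    exact SpecMap_comp_fromSpec_appLE_ΓSpecIso _ _ _
  exact RingHom.congr_fun (congrArg CommRingCat.Hom.hom key) a

end LogPair

end LogJets

/-! ### Gluing vector fields -/

namespace LogJets

/-- The inclusion of one affine open subset in another is étale even if it is not basic, so a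
derivation of the functions on the larger one extends uniquely to the smaller one. -/
theorem etale_res {X : Scheme.{u}} {U V : X.Opens} (hU : IsAffineOpen U) (hV : IsAffineOpen V)
    (h : V ≤ U) : (res h).Etale := by
  have := HasRingHomProperty.appLE (P := @AlgebraicGeometry.Etale) (𝟙 X) inferInstance ⟨U, hU⟩
    ⟨V, hV⟩ h
  have e : (𝟙 X : X ⟶ X).appLE U V h = X.presheaf.map (homOfLE h).op := Category.id_comp _
  rwa [e] at this

variable {k : Type u} [Field k]

namespace VectorField

variable {X Y : Over (Spec (.of k))}

theorem isDerivationAlong (δ : VectorField X) (U : X.left.Opens) :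
    IsDerivationAlong (.id _) (δ.der U) := δ.leibniz U

/-- A vector field is given by compatible derivations of the functions on a basis of opens. -/
theorem exists_of_basis (B : Set X.left.Opens)
    (hB : ∀ (O : X.left.Opens), ∀ x ∈ O, ∃ V ∈ B, x ∈ V ∧ V ≤ O)
    (d : ∀ V ∈ B, Γ(X.left, V) →+ Γ(X.left, V)) (hd : ∀ V hV, IsDerivationAlong (.id _) (d V hV))
    (hc : ∀ V hV c, d V hV (LogJets.consts X V c) = 0)
    (hn : ∀ V hV V' hV' (h : V' ≤ V) a, LogJets.res h (d V hV a) = d V' hV' (LogJets.res h a)) :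
    ∃ δ : VectorField X, ∀ V hV, δ.der V = d V hV := by
  have ext : ∀ (O : X.left.Opens) (s t : Γ(X.left, O)),
      (∀ V ∈ B, ∀ hVO : V ≤ O, LogJets.res hVO s = LogJets.res hVO t) → s = t := fun O s t h ↦ by
    refine LogJets.eq_of_locally_eq s t fun x hx ↦ ?_
    obtain ⟨V, hV, hxV, hVO⟩ := hB O x hx
    exact ⟨V, hVO, hxV, h V hV hVO⟩
  have key : ∀ (O : X.left.Opens) (s : Γ(X.left, O)), ∃ t : Γ(X.left, O),
      ∀ V (hV : V ∈ B) (hVO : V ≤ O), LogJets.res hVO t = d V hV (LogJets.res hVO s) := by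
    intro O s
    obtain ⟨t, ht, -⟩ := X.left.sheaf.existsUnique_gluing'
      (fun V : {V // V ∈ B ∧ V ≤ O} ↦ V.1) O (fun V ↦ homOfLE V.2.2)
      (fun x hx ↦ by
        obtain ⟨V, hV, hxV, hVO⟩ := hB O x hx
        exact Opens.mem_iSup.mpr ⟨⟨V, hV, hVO⟩, hxV⟩)
      (fun V ↦ d V.1 V.2.1 (LogJets.res V.2.2 s))
      -- The intersection of two members of `B` need not belong to `B`, so equality on it is tested
      -- on the members of `B` that it contains.
      (fun V V' ↦ ext _ _ _ fun V'' hV'' h ↦ by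
        change LogJets.res h (LogJets.res inf_le_left _) = LogJets.res h (LogJets.res inf_le_right _)
        rw [res_res, res_res, hn _ _ _ hV'', hn _ _ _ hV'', res_res, res_res])
    exact ⟨t, fun V hV hVO ↦ ht ⟨V, hV, hVO⟩⟩
  choose D hD using key
  have hres : ∀ {U V : X.left.Opens} (h : V ≤ U) a, LogJets.res h (D U a) = D V (LogJets.res h a) :=
    fun {U V} h a ↦ ext _ _ _ fun W hW hWV ↦ by
      rw [hD _ _ _ hW, res_res, res_res, hD _ _ _ hW]
  let δ : VectorField X :=
    { der := fun U ↦
        { toFun := D U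
          map_zero' := ext _ _ _ fun W hW hWV ↦ by
            rw [hD _ _ _ hW, map_zero, map_zero]
          map_add' := fun a b ↦ ext _ _ _ fun W hW hWV ↦ by
            rw [hD _ _ _ hW, map_add, map_add, map_add, hD _ _ _ hW, hD _ _ _ hW] }
      leibniz := fun U a b ↦ ext _ _ _ fun W hW hWV ↦ by
        change LogJets.res hWV (D U (a * b)) = LogJets.res hWV (a * D U b + b * D U a)
        rw [hD _ _ _ hW, map_mul, hd, map_add, map_mul, map_mul, hD _ _ _ hW, hD _ _ _ hW]
        rfl
      consts := fun U c ↦ ext _ _ _ fun W hW hWV ↦ by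
        change LogJets.res hWV (D U _) = _
        rw [hD _ _ _ hW, map_zero, ← RingHom.comp_apply, res_comp_consts, hc]
      res := hres }
  refine ⟨δ, fun V hV ↦ AddMonoidHom.ext fun a ↦ ?_⟩
  have := hD V a V hV le_rfl
  rwa [res_refl, res_refl] at this

/-- A vector field is given by compatible derivations of the functions on the members of an affine
open cover. -/
theorem exists_of_affineCover {ι : Type*} (W : ι → X.left.Opens) (hW : ∀ i, IsAffineOpen (W i))
    (hcov : ∀ x, ∃ i, x ∈ W i)
    (d : ∀ i, Γ(X.left, W i) →+ Γ(X.left, W i)) (hd : ∀ i, IsDerivationAlong (.id _) (d i))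
    (hc : ∀ i c, d i (LogJets.consts X (W i) c) = 0)
    (hn : ∀ i j, ∀ x ∈ W i, x ∈ W j → ∃ (l : ι) (hi : W l ≤ W i) (hj : W l ≤ W j), x ∈ W l ∧
      (∀ a, LogJets.res hi (d i a) = d l (LogJets.res hi a)) ∧
      ∀ a, LogJets.res hj (d j a) = d l (LogJets.res hj a)) :
    ∃ δ : VectorField X, ∀ i, δ.der (W i) = d i := by
  -- Restriction between affine opens is étale, so `d i` extends to every affine open inside `W i`;
  -- by `uniq` the extension is unique and compatible with restriction.
  have ex : ∀ i (V : X.left.Opens) (hV : IsAffineOpen V) (h : V ≤ W i), ∃ d' : Γ(X.left, V) →+ Γ(X.left, V),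
      IsDerivationAlong (.id _) d' ∧ ∀ a, d' (LogJets.res h a) = LogJets.res h (d i a) := by
    intro i V hV h
    refine IsDerivationAlong.exists_extension (d := (LogJets.res h).toAddMonoidHom.comp (d i))
      (formallyEtale_of_etale (etale_res (hW i) hV h)) ?_
    exact (hd i).postcomp (LogJets.res h)
  have uniq : ∀ i (V V' : X.left.Opens) (hV : IsAffineOpen V) (h : V ≤ W i) (h' : V' ≤ V)
      (d₁ : Γ(X.left, V) →+ Γ(X.left, V)) (d₂ : Γ(X.left, V') →+ Γ(X.left, V'))
      (_ : IsDerivationAlong (.id _) d₁) (_ : IsDerivationAlong (.id _) d₂),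
      (∀ a, d₁ (LogJets.res h a) = LogJets.res h (d i a)) →
      (∀ a, d₂ (LogJets.res (h'.trans h) a) = LogJets.res (h'.trans h) (d i a)) →
      ∀ a, LogJets.res h' (d₁ a) = d₂ (LogJets.res h' a) := by
    intro i V V' hV h h' d₁ d₂ hd₁ hd₂ h₁ h₂
    refine DFunLike.congr_fun (IsDerivationAlong.ext_of_formallyUnramified
      (etale_res (hW i) hV h).formallyUnramified (hd₁.postcomp (LogJets.res h'))
      (hd₂.comp (LogJets.res h')) fun a ↦ ?_)
    change LogJets.res h' (d₁ (LogJets.res h a)) = d₂ (LogJets.res h' (LogJets.res h a))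
    rw [h₁, res_res, res_res, h₂]
  -- The extension to `V` does not depend on the member of the cover that contains `V`. This is
  -- local on `V`, and near each point `d i` and `d j` both restrict to some `d l`.
  have indep : ∀ i j (V : X.left.Opens) (hV : IsAffineOpen V) (h : V ≤ W i) (hj : V ≤ W j)
      (d₁ : Γ(X.left, V) →+ Γ(X.left, V)) (_ : IsDerivationAlong (.id _) d₁),
      (∀ a, d₁ (LogJets.res h a) = LogJets.res h (d i a)) →
      ∀ a, d₁ (LogJets.res hj a) = LogJets.res hj (d j a) := by
    intro i j V hV h hj d₁ hd₁ h₁ a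
    refine LogJets.eq_of_locally_eq _ _ fun x hx ↦ ?_
    obtain ⟨l, hli, hlj, hxl, hl₁, hl₂⟩ := hn i j x (h hx) (hj hx)
    obtain ⟨_, ⟨V', hV', rfl⟩, hxV', hV'le⟩ := X.left.isBasis_affineOpens.exists_subset_of_mem_open
      (show x ∈ ((V ⊓ W l : X.left.Opens) : Set X.left) from ⟨hx, hxl⟩) (V ⊓ W l).isOpen
    have hV'V : V' ≤ V := fun y hy ↦ (hV'le hy).1
    have hV'l : V' ≤ W l := fun y hy ↦ (hV'le hy).2
    obtain ⟨d₂, hd₂, h₂⟩ := ex l V' hV' hV'l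
    refine ⟨V', hV'V, hxV', ?_⟩
    rw [uniq i V V' hV h hV'V d₁ d₂ hd₁ hd₂ h₁ (fun b ↦ by
      rw [← res_res hli hV'l, h₂, ← hl₁, res_res]), res_res, res_res, ← res_res hlj hV'l, h₂, ← hl₂,
      res_res]
  let B : Set X.left.Opens := {V | IsAffineOpen V ∧ ∃ i, V ≤ W i}
  choose dB hdB hdB' using fun (V : X.left.Opens) (hV : V ∈ B) ↦ ex hV.2.choose V hV.1 hV.2.choose_spec
  have hdB'' : ∀ V (hV : V ∈ B) j (hj : V ≤ W j) a,
      dB V hV (LogJets.res hj a) = LogJets.res hj (d j a) := fun V hV j hj ↦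
    indep _ j V hV.1 hV.2.choose_spec hj _ (hdB V hV) (hdB' V hV)
  obtain ⟨δ, hδ⟩ := exists_of_basis B (fun O x hx ↦ by
      obtain ⟨i, hi⟩ := hcov x
      obtain ⟨_, ⟨V', hV', rfl⟩, hxV', hV'le⟩ := X.left.isBasis_affineOpens.exists_subset_of_mem_open
        (show x ∈ ((O ⊓ W i : X.left.Opens) : Set X.left) from ⟨hx, hi⟩) (O ⊓ W i).isOpen
      exact ⟨V', ⟨hV', i, fun y hy ↦ (hV'le hy).2⟩, hxV', fun y hy ↦ (hV'le hy).1⟩) dB hdB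
    (fun V hV c ↦ by
      rw [← res_comp_consts X hV.2.choose_spec, RingHom.comp_apply, hdB' V hV, hc, map_zero])
    (fun V hV V' hV' h ↦ uniq hV.2.choose V V' hV.1 hV.2.choose_spec h _ _ (hdB V hV) (hdB V' hV')
      (hdB' V hV) (hdB'' V' hV' _ _))
  refine ⟨δ, fun i ↦ ?_⟩
  rw [hδ (W i) ⟨hW i, i, le_rfl⟩]
  ext a
  have := hdB'' (W i) ⟨hW i, i, le_rfl⟩ i le_rfl a
  rwa [res_refl, res_refl] at this

/-- Compatibility of a morphism with vector fields can be checked on an affine open cover. -/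
theorem map_der_of_affineCover (δ : VectorField X) (δ' : VectorField Y) (f : Y.left ⟶ X.left)
    {ι : Type*} (W : ι → X.left.Opens) (hW : ∀ i, IsAffineOpen (W i)) (hcov : ∀ x, ∃ i, x ∈ W i)
    (h : ∀ i s, (f.app (W i)).hom (δ.der _ s) = δ'.der _ ((f.app (W i)).hom s))
    (U : X.left.Opens) (s : Γ(X.left, U)) :
    (f.app U).hom (δ.der U s) = δ'.der _ ((f.app U).hom s) := by
  refine LogJets.eq_of_locally_eq _ _ fun y hy ↦ ?_
  obtain ⟨i, hi⟩ := hcov (f y)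
  obtain ⟨_, ⟨V, hV, rfl⟩, hxV, hVle⟩ := X.left.isBasis_affineOpens.exists_subset_of_mem_open
    (show f y ∈ ((U ⊓ W i : X.left.Opens) : Set X.left) from ⟨hy, hi⟩) (U ⊓ W i).isOpen
  have hVU : V ≤ U := fun y hy ↦ (hVle hy).1
  have hVi : V ≤ W i := fun y hy ↦ (hVle hy).2
  have nat : ∀ {U V : X.left.Opens} (h : V ≤ U) (a : Γ(X.left, U)),
      LogJets.res (f.preimage_mono h) ((f.app U).hom a) = (f.app V).hom (LogJets.res h a) :=
    fun h a ↦ (RingHom.congr_fun (congrArg CommRingCat.Hom.hom (f.naturality (homOfLE h).op)) a).symm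
  refine ⟨f ⁻¹ᵁ V, f.preimage_mono hVU, hxV, ?_⟩
  rw [δ'.res, nat, nat, δ.res]
  -- Both sides are derivations along the pull-back of functions on `V`, and they agree on
  -- restrictions from `W i`, over which `V` is étale.
  refine DFunLike.congr_fun (IsDerivationAlong.ext_of_formallyUnramified
    (etale_res (hW i) hV hVi).formallyUnramified ((δ.isDerivationAlong V).postcomp (f.app V).hom)
    ((δ'.isDerivationAlong (f ⁻¹ᵁ V)).comp (f.app V).hom) fun a ↦ ?_) (LogJets.res hVU s)
  change (f.app V).hom (δ.der V (LogJets.res hVi a)) = δ'.der _ ((f.app V).hom (LogJets.res hVi a))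
  rw [← δ.res, ← nat, ← nat, h, δ'.res]

end VectorField

end LogJets

namespace LogJets

/-! ### Ideals and components under projections from a product with an affine space -/

section PolynomialExtension

variable {A B σ : Type*} [CommRing A] [CommRing B] {ψ : A →+* B}

/-- The quotient by the extended ideal is a polynomial ring over the reduced ring `A ⧸ I`. -/
theorem map_isRadical_of_polynomial (G : MvPolynomial σ A ≃+* B) (hG : ∀ a, G (.C a) = ψ a)
    {I : Ideal A} (hI : I.IsRadical) : (I.map ψ).IsRadical := by
  have h1 : (I.map (MvPolynomial.C : A →+* MvPolynomial σ A)).IsRadical := by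
    have : IsReduced (A ⧸ I) := (Ideal.isRadical_iff_quotient_reduced I).mp hI
    rw [Ideal.isRadical_iff_quotient_reduced]
    exact isReduced_of_injective _ (MvPolynomial.quotientEquivQuotientMvPolynomial I).symm.injective
  have h2 : ψ = G.toRingHom.comp MvPolynomial.C := RingHom.ext fun a ↦ (hG a).symm
  rw [h2, ← Ideal.map_map]
  change ((I.map MvPolynomial.C).map (G : MvPolynomial σ A →+* B)).IsRadical
  rw [Ideal.map_comap_of_equiv]
  exact h1.comap _

/-- The quotient by the extension of `p` is a polynomial ring over the domain `A ⧸ p`. The extended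
prime is the generic point of the fibre over `p`. -/
theorem map_isPrime_of_polynomial (G : MvPolynomial σ A ≃+* B) (hG : ∀ a, G (.C a) = ψ a)
    (p : Ideal A) [p.IsPrime] : (p.map ψ).IsPrime ∧ (p.map ψ).comap ψ = p := by
  have h1 : (p.map (MvPolynomial.C : A →+* MvPolynomial σ A)).IsPrime := by
    rw [← Ideal.Quotient.isDomain_iff_prime]
    exact (MvPolynomial.quotientEquivQuotientMvPolynomial p).symm.injective.isDomain
      (MvPolynomial.quotientEquivQuotientMvPolynomial p).symm.toRingHom
  have h2 : ψ = G.toRingHom.comp MvPolynomial.C := RingHom.ext fun a ↦ (hG a).symm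
  have h3 : p.map ψ = (p.map MvPolynomial.C).comap (G.symm : B →+* MvPolynomial σ A) := by
    rw [h2, ← Ideal.map_map]
    exact Ideal.map_comap_of_equiv G
  rw [h3]
  refine ⟨Ideal.IsPrime.comap _, ?_⟩
  ext a
  rw [Ideal.mem_comap, Ideal.mem_comap, ← hG]
  change G.symm (G (.C a)) ∈ _ ↔ _
  rw [RingEquiv.symm_apply_apply, MvPolynomial.mem_map_C_iff]
  constructor
  · intro h
    simpa using h 0
  · intro h m
    classical
    rw [MvPolynomial.coeff_C]
    split_ifs
    · exact h
    · exact zero_mem p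

end PolynomialExtension

section AffinePreimage

variable {X Y : Scheme.{u}} (f : Y ⟶ X) {U : X.affineOpens} (hA : IsAffineOpen (f ⁻¹ᵁ U.1))

theorem fromSpec_preimage_preimage (Z : Set X) :
    hA.fromSpec ⁻¹' (f ⁻¹' Z) = PrimeSpectrum.comap (f.app U.1).hom ⁻¹' (U.2.fromSpec ⁻¹' Z) := by
  have h := IsAffineOpen.SpecMap_appLE_fromSpec f U.2 hA le_rfl
  rw [Scheme.Hom.appLE_eq_app] at h
  ext z
  have h2 := congrArg (fun g : Spec Γ(Y, f ⁻¹ᵁ U.1) ⟶ X ↦ g z) h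
  simp only [Scheme.Hom.comp_apply] at h2
  change f (hA.fromSpec z) ∈ Z ↔ U.2.fromSpec (Spec.map (f.app U.1) z) ∈ Z
  rw [h2]

/-- The zero locus of the extended ideal is the preimage of `Z`, so the two ideals agree up to
radical, and both are radical. -/
theorem vanishingIdeal_preimage (Z : Closeds X)
    (h : (((Scheme.IdealSheafData.vanishingIdeal Z).ideal U).map (f.app U.1).hom).IsRadical) :
    (Scheme.IdealSheafData.vanishingIdeal (Z.preimage f.continuous)).ideal ⟨f ⁻¹ᵁ U.1, hA⟩ =
      ((Scheme.IdealSheafData.vanishingIdeal Z).ideal U).map (f.app U.1).hom := by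
  have h1 : (U.2.fromSpec ⁻¹' (Z : Set X)) =
      PrimeSpectrum.zeroLocus ((Scheme.IdealSheafData.vanishingIdeal Z).ideal U) := by
    rw [Scheme.IdealSheafData.vanishingIdeal_ideal,
      PrimeSpectrum.zeroLocus_vanishingIdeal_eq_closure]
    exact (Z.isClosed.preimage U.2.fromSpec.continuous).closure_eq.symm
  have h2 : hA.fromSpec ⁻¹' (f ⁻¹' (Z : Set X)) = PrimeSpectrum.zeroLocus
      (((Scheme.IdealSheafData.vanishingIdeal Z).ideal U).map (f.app U.1).hom) := by
    refine (fromSpec_preimage_preimage f hA Z).trans ((congrArg _ h1).trans ?_)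
    rw [PrimeSpectrum.preimage_comap_zeroLocus, Ideal.map, PrimeSpectrum.zeroLocus_span]
  rw [Scheme.IdealSheafData.vanishingIdeal_ideal]
  refine (congrArg PrimeSpectrum.vanishingIdeal h2).trans ?_
  rw [PrimeSpectrum.vanishingIdeal_zeroLocus_eq_radical, h.radical]

/-- Over an affine open subset over which `f` is the projection from a product with an affine space,
the fibres of `f` have generic points. -/
theorem exists_generic_of_polynomial (hA : IsAffineOpen (f ⁻¹ᵁ U.1)) {σ : Type*}
    (G : MvPolynomial σ Γ(X, U) ≃+* Γ(Y, f ⁻¹ᵁ U.1)) (hG : ∀ a, G (.C a) = (f.app U.1).hom a)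
    {x : X} (hx : x ∈ U.1) : ∃ η, f η = x ∧ ∀ y, f y ∈ U.1 → x ⤳ f y → η ⤳ y := by
  have hU : IsAffineOpen U.1 := U.2
  have h := IsAffineOpen.SpecMap_appLE_fromSpec f hU hA le_rfl
  rw [Scheme.Hom.appLE_eq_app] at h
  have hf : ∀ z, f (hA.fromSpec z) = hU.fromSpec (Spec.map (f.app U.1) z) := fun z ↦ by
    have h2 := congrArg (fun g : Spec Γ(Y, f ⁻¹ᵁ U.1) ⟶ X ↦ g z) h
    simp only [Scheme.Hom.comp_apply] at h2
    exact h2.symm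
  rw [← SetLike.mem_coe, ← hU.range_fromSpec] at hx
  obtain ⟨p, rfl⟩ := hx
  have hp : (p : PrimeSpectrum Γ(X, U)).asIdeal.IsPrime := p.isPrime
  obtain ⟨hq, hqp⟩ := map_isPrime_of_polynomial G hG (PrimeSpectrum.asIdeal p)
  -- The extension of `p` lies in every prime whose contraction contains `p`, so `q` specializes to
  -- every point over a specialization of `p`.
  let q : Spec Γ(Y, f ⁻¹ᵁ U.1) := (⟨_, hq⟩ : PrimeSpectrum Γ(Y, f ⁻¹ᵁ U.1))
  refine ⟨hA.fromSpec q, ?_, fun y hy hxy ↦ ?_⟩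
  · rw [hf]
    exact congrArg hU.fromSpec (PrimeSpectrum.ext hqp : PrimeSpectrum.comap (f.app U.1).hom q = p)
  · have hy' : y ∈ f ⁻¹ᵁ U.1 := hy
    rw [← SetLike.mem_coe, ← hA.range_fromSpec] at hy'
    obtain ⟨z, rfl⟩ := hy'
    refine Specializes.map ?_ hA.fromSpec.continuous
    rw [hf, hU.fromSpec.isOpenEmbedding.isInducing.specializes_iff] at hxy
    have hxy' := (PrimeSpectrum.le_iff_specializes _ _).mpr hxy
    refine (PrimeSpectrum.le_iff_specializes q z).mp ?_
    exact Ideal.map_le_iff_le_comap.mpr hxy'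

end AffinePreimage

section Components

variable {X Y : Type*} [TopologicalSpace X] [TopologicalSpace Y] [QuasiSober X]

/-- If the fibres of `f` have generic points that specialize with the points of the base, then the
components of the preimage of `D` are the preimages of the components of `D`. -/
theorem components_preimage {f : Y → X} (hf : Continuous f)
    (h : ∀ x, ∃ η, f η = x ∧ ∀ y, x ⤳ f y → η ⤳ y) (D : Closeds X) (Z : Closeds Y) :
    Z ∈ components (D.preimage hf) ↔ ∃ Z' ∈ components D, Z = Z'.preimage hf := by
  choose η hη hη' using h
  -- If `x` is the generic point of `Z'`, then the preimage of `Z'` is the closure of `η x`.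
  have irr : ∀ Z' : Closeds X, IsIrreducible (Z' : Set X) →
      IsIrreducible (Z'.preimage hf : Set Y) := by
    intro Z' hZ'
    obtain ⟨x, hx⟩ := QuasiSober.sober hZ' Z'.isClosed
    have : (Z'.preimage hf : Set Y) = closure {η x} := by
      refine Set.Subset.antisymm (fun y hy ↦ ?_) (closure_minimal ?_ (Z'.preimage hf).isClosed)
      · refine (hη' x y ?_).mem_closure
        exact hx.specializes hy
      · rw [Set.singleton_subset_iff]
        change f (η x) ∈ Z'
        rw [hη]
        exact hx.mem
    rw [this]
    exact isIrreducible_singleton.closure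
  have sub : ∀ W : Closeds Y, IsIrreducible (W : Set Y) → W ≤ D.preimage hf →
      ∃ Z' ∈ components D, W ≤ Z'.preimage hf := by
    intro W hW hWD
    -- The closure of the image of `W` has a generic point, and a component of `D` through that
    -- point contains the whole image.
    have hi : IsIrreducible (closure (f '' W)) := (hW.image f hf.continuousOn).closure
    obtain ⟨x, hx⟩ := QuasiSober.sober hi isClosed_closure
    have hxD : x ∈ D := by
      have h1 : f '' (W : Set Y) ⊆ D := Set.image_subset_iff.mpr hWD
      exact closure_minimal h1 D.isClosed hx.mem
    obtain ⟨Z', hZ', hxZ'⟩ := exists_component D hxD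
    refine ⟨Z', hZ', fun y hy ↦ ?_⟩
    have h1 : closure {x} ⊆ (Z' : Set X) :=
      closure_minimal (Set.singleton_subset_iff.mpr hxZ') Z'.isClosed
    rw [hx.def] at h1
    exact h1 (subset_closure ⟨y, hy, rfl⟩)
  constructor
  · intro hZ
    obtain ⟨Z', hZ', hle⟩ := sub Z hZ.1.1 hZ.1.2
    exact ⟨Z', hZ', le_antisymm hle (hZ.2 ⟨irr Z' hZ'.1.1, fun y hy ↦ hZ'.1.2 hy⟩ hle)⟩
  · rintro ⟨Z', hZ', rfl⟩
    refine ⟨⟨irr Z' hZ'.1.1, fun y hy ↦ hZ'.1.2 hy⟩, fun W hW hle ↦ ?_⟩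
    obtain ⟨Z'', hZ'', hle'⟩ := sub W hW.1 hW.2
    have : Z' ≤ Z'' := fun x hx ↦ by
      have : η x ∈ Z''.preimage hf := hle' (hle (show f (η x) ∈ Z' from (hη x).symm ▸ hx))
      change f (η x) ∈ Z'' at this
      rwa [hη] at this
    have h2 := hZ'.2 hZ''.1 this
    exact fun y hy ↦ h2 (hle' hy)

end Components

end LogJets

/-! ### The vector field and the local structure of the log jet space -/

namespace LogJets

variable {k : Type u} [Field k]

theorem app_consts {X Y : Over (Spec (.of k))} (f : Y ⟶ X) (U : X.left.Opens) (c : k) :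
    (f.left.app U).hom (consts X U c) = consts Y (f.left ⁻¹ᵁ U) c := by
  have h1 : X.left.presheaf.map (homOfLE (le_top : U ≤ ⊤)).op ≫ f.left.app U =
      f.left.appTop ≫ Y.left.presheaf.map (homOfLE (le_top : f.left ⁻¹ᵁ U ≤ ⊤)).op :=
    f.left.naturality _
  have h2 : X.hom.appTop ≫ f.left.appTop = Y.hom.appTop := by
    rw [← Scheme.Hom.comp_appTop, Over.w f]
  have h3 : X.hom.appTop ≫ X.left.presheaf.map (homOfLE (le_top : U ≤ ⊤)).op ≫ f.left.app U =
      Y.hom.appTop ≫ Y.left.presheaf.map (homOfLE (le_top : f.left ⁻¹ᵁ U ≤ ⊤)).op := by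
    rw [h1, ← h2, Category.assoc]
  exact RingHom.congr_fun (congrArg CommRingCat.Hom.hom h3) ((Scheme.ΓSpecIso (.of k)).inv.hom c)

namespace LogPair

variable (P : LogPair k)

/-- The derivation of the algebra of log jets. -/
noncomputable def logJetDer (U : P.X.left.AffineZariskiSite) :
    P.logJetAlgebra U →+ P.logJetAlgebra U where
  toFun s := ⟨JetAlgebra.der _ s.1, P.der_mem U s.2⟩
  map_zero' := Subtype.ext (map_zero _)
  map_add' _ _ := Subtype.ext (map_add _ _ _)

theorem logJetDer_leibniz (U : P.X.left.AffineZariskiSite) :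
    IsDerivationAlong (.id _) (P.logJetDer U) := fun _ _ ↦
  Subtype.ext ((JetAlgebra.der _).leibniz _ _)

theorem logJetDer_res {U V : P.X.left.AffineZariskiSite} (h : V ≤ U) (s : P.logJetAlgebra U) :
    P.resHom h (P.logJetDer U s) = P.logJetDer V (P.resHom h s) :=
  Subtype.ext (P.resJets_der (Scheme.AffineZariskiSite.toOpens_mono h) s.1)

theorem logJetDer_fnHom_consts (U : P.X.left.AffineZariskiSite) (c : k) :
    P.logJetDer U (P.fnHom U (consts P.X U.toOpens c)) = 0 := by
  refine Subtype.ext ?_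
  change JetAlgebra.der _ (JetAlgebra.of _ (res inf_le_left (consts P.X U.toOpens c))) = 0
  have h : res inf_le_left (consts P.X U.toOpens c) = consts P.X (P.away U.toOpens) c :=
    RingHom.congr_fun (res_comp_consts P.X inf_le_left) c
  rw [h, ← RingHom.comp_apply, JetAlgebra.of_comp, Derivation.map_algebraMap]

theorem exists_le_inter (U V : P.X.left.AffineZariskiSite) {x : P.X.left} (hU : x ∈ U.toOpens)
    (hV : x ∈ V.toOpens) : ∃ W : P.X.left.AffineZariskiSite, W ≤ U ∧ W ≤ V ∧ x ∈ W.toOpens := by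
  obtain ⟨f, g, h, hx⟩ := exists_basicOpen_le_affine_inter U.2 V.2 x ⟨hU, hV⟩
  exact ⟨U.basicOpen f, U.basicOpen_le f, ⟨g, h.symm⟩, hx⟩

theorem exists_mem_above (x : P.logJet.left) : ∃ U, x ∈ P.above U := by
  obtain ⟨_, ⟨V, hV, rfl⟩, hx, -⟩ := P.X.left.isBasis_affineOpens.exists_subset_of_mem_open
    (Set.mem_univ (P.logJetProj.left x)) isOpen_univ
  exact ⟨⟨V, hV⟩, hx⟩

/-- The vector field on the log jet space. -/
theorem exists_logJetField : ∃ δ : VectorField P.logJet, ∀ (U : P.X.left.AffineZariskiSite) s,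
    P.logJetSections U (δ.der (P.above U) s) = P.logJetDer U (P.logJetSections U s) := by
  let e (U : P.X.left.AffineZariskiSite) : Γ(P.logJet.left, P.above U) ≃+* P.logJetAlgebra U :=
    .ofBijective _ (P.logJetSections_bijective U)
  let d (U : P.X.left.AffineZariskiSite) :
      Γ(P.logJet.left, P.above U) →+ Γ(P.logJet.left, P.above U) :=
    (e U).symm.toAddMonoidHom.comp ((P.logJetDer U).comp (e U).toAddMonoidHom)
  have hd : ∀ U s, P.logJetSections U (d U s) = P.logJetDer U (P.logJetSections U s) :=
    fun U s ↦ (e U).apply_symm_apply _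
  obtain ⟨δ, hδ⟩ := VectorField.exists_of_affineCover (X := P.logJet) P.above P.isAffineOpen_above
    P.exists_mem_above d
    (fun U a b ↦ (P.logJetSections_bijective U).1 (by
      rw [hd, map_mul, P.logJetDer_leibniz U, map_add, RingHom.id_apply, RingHom.id_apply,
        RingHom.id_apply, RingHom.id_apply, map_mul, map_mul, hd, hd]))
    (fun U c ↦ (P.logJetSections_bijective U).1 (by
      rw [hd, map_zero, ← app_consts P.logJetProj, logJetSections_proj, logJetDer_fnHom_consts]))
    (fun U V x hU hV ↦ by
      obtain ⟨W, hWU, hWV, hx⟩ := P.exists_le_inter U V hU hV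
      have key (T : P.X.left.AffineZariskiSite) (hT : W ≤ T) (a) :
          res (P.above_mono hT) (d T a) = d W (res (P.above_mono hT) a) := by
        apply (P.logJetSections_bijective W).1
        rw [P.logJetSections_res hT, hd, hd, P.logJetSections_res hT, logJetDer_res]
      exact ⟨W, P.above_mono hWU, P.above_mono hWV, hx, key U hWU, key V hWV⟩)
  exact ⟨δ, fun U s ↦ by rw [hδ, hd]⟩

/-- The vector field on the log jet space that is the translation of jets. -/
noncomputable def logJetField : VectorField P.logJet := P.exists_logJetField.choose

theorem logJetSections_der (U : P.X.left.AffineZariskiSite) (s) :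
    P.logJetSections U (P.logJetField.der (P.above U) s) =
      P.logJetDer U (P.logJetSections U s) := P.exists_logJetField.choose_spec U s

end LogPair

namespace LogChart

variable {P : LogPair k} {U : P.X.left.affineOpens} (c : LogChart P.X P.D U)

/-- The domain of a chart, in the affine Zariski site. -/
abbrev site (U : P.X.left.affineOpens) : P.X.left.AffineZariskiSite := ⟨U.1, U.2⟩

open Classical in
/-- The equation `x_j` if `x_j` is the equation of a component of the divisor, and `1` otherwise. -/
noncomputable def weight (j : c.J) : Γ(P.X.left, U) :=
  if j ∈ Set.range c.σ then c.φ (.X j) else 1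

theorem weight_σ (Z : meetingComponents P.D U.1) : c.weight (c.σ Z) = c.eqn Z := by
  rw [weight, if_pos (Set.mem_range_self Z)]
  rfl

theorem isUnit_weight (j : c.J) :
    IsUnit (res (inf_le_left : P.away U.1 ≤ U.1) (c.weight j)) := by
  by_cases hj : j ∈ Set.range c.σ
  · obtain ⟨Z, rfl⟩ := hj
    rw [weight_σ]
    exact c.isUnit_res_eqn Z
  · rw [weight, if_neg hj, map_one]
    exact isUnit_one

/-- The logarithmic derivative of an equation `γ` is the generator `y ∂x` with `x = γ` and `y = 1 /
γ`. -/
theorem inv_eqn_mem (Z : meetingComponents P.D U.1) {y : Γ(P.X.left, P.away U.1)}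
    (hy : res (inf_le_left : P.away U.1 ≤ U.1) (c.eqn Z) * y = 1) :
    JetAlgebra.of _ y * JetAlgebra.der _ (P.fn U.1 (c.eqn Z)) ∈ P.logJetAlgebra (site U) := by
  refine P.generators_subset (site U) (.inr ⟨Z, Z.2.1, c.eqn Z,
    (c.mem_ideal_iff Z).mpr dvd_rfl, y, fun t ht ↦ ?_, rfl⟩)
  obtain ⟨a, rfl⟩ := (c.mem_ideal_iff Z).mp ht
  exact ⟨a, by rw [map_mul, ← mul_assoc, mul_comm y, hy, one_mul]⟩

/-- Over a chart, the algebra of log jets is generated under `∂` by the functions and the logarithmic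
derivatives of the equations of the components of the divisor. -/
theorem logJetAlgebra_le {S : Subring (P.awayJets U.1)} (hfn : ∀ a, P.fn U.1 a ∈ S)
    (hder : ∀ s ∈ S, JetAlgebra.der _ s ∈ S)
    (hinv : ∀ (Z : meetingComponents P.D U.1) (y : Γ(P.X.left, P.away U.1)),
      res (inf_le_left : P.away U.1 ≤ U.1) (c.eqn Z) * y = 1 →
        JetAlgebra.of _ y * JetAlgebra.der _ (P.fn U.1 (c.eqn Z)) ∈ S) :
    P.logJetAlgebra (site U) ≤ S := by
  let ι : Γ(P.X.left, U) →+* Γ(P.X.left, P.away U.1) := res inf_le_left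
  let φC : k →+* Γ(P.X.left, P.away U.1) := LogJets.consts P.X (P.away U.1)
  refine P.logJetAlgebra_le ?_ hder
  rintro _ (⟨a, rfl⟩ | ⟨Z, hZ, x, hx, y, hy, rfl⟩)
  · exact hfn a
  · change JetAlgebra.of φC y * JetAlgebra.der φC (JetAlgebra.of φC (ι x)) ∈ S
    by_cases hZU : ((Z : Set P.X.left) ∩ U.1).Nonempty
    · let Z' : meetingComponents P.D U.1 := ⟨Z, hZ, hZU⟩
      obtain ⟨a, rfl⟩ := (c.mem_ideal_iff Z').mp hx
      obtain ⟨b, hb⟩ := hy (c.eqn Z') ((c.mem_ideal_iff Z').mpr dvd_rfl)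
      replace hb : y * ι (c.eqn Z') = ι b := hb
      obtain ⟨v, hv⟩ := (c.isUnit_res_eqn Z').exists_right_inv
      replace hv : ι (c.eqn Z') * v = 1 := hv
      let ζ : JetAlgebra φC := JetAlgebra.of φC v *
        JetAlgebra.der φC (JetAlgebra.of φC (ι (c.eqn Z')))
      have h1 : JetAlgebra.der φC (JetAlgebra.of φC (ι (c.eqn Z'))) =
          JetAlgebra.of φC (ι (c.eqn Z')) * ζ := by
        rw [← mul_assoc, ← map_mul, hv, map_one, one_mul]
      -- With `γ` the equation of `Z`, `x = γ a` and `y = b / γ`, the generator `y ∂x` is `b ∂a + a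
      -- b (∂γ / γ)`.
      have h2 : JetAlgebra.of φC y * JetAlgebra.der φC (JetAlgebra.of φC (ι (c.eqn Z' * a))) =
          JetAlgebra.of φC (ι b) * JetAlgebra.der φC (JetAlgebra.of φC (ι a)) +
            JetAlgebra.of φC (ι a) * JetAlgebra.of φC (ι b) * ζ := by
        rw [map_mul, map_mul, Derivation.leibniz, h1, ← hb, map_mul]
        simp only [smul_eq_mul]
        ring
      rw [h2]
      exact add_mem (mul_mem (hfn b) (hder _ (hfn a)))
        (mul_mem (mul_mem (hfn a) (hfn b)) (hinv Z' v hv))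
    -- If `Z` misses `U`, its ideal contains `1`, so `y` itself extends to a function on `U`.
    · obtain ⟨b, hb⟩ := hy 1 (mem_vanishingIdeal_iff (U := U) |>.mpr fun z hz hz' ↦
        hZU ⟨z, hz, P.X.left.basicOpen_le _ hz'⟩)
      rw [map_one, mul_one] at hb
      rw [hb]
      exact mul_mem (hfn b) (hder _ (hfn x))

/-- Over a chart, the algebra of log jets is a polynomial algebra over the functions. -/
theorem exists_jetCoord [CharZero k] (c : LogChart P.X P.D U) :
    ∃ G : MvPolynomial (c.J × ℕ) Γ(P.X.left, U) ≃+* P.logJetAlgebra (site U),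
      ∀ a, G (.C a) = P.fnHom (site U) a := by
  let ι : Γ(P.X.left, U) →+* Γ(P.X.left, P.away U.1) := res inf_le_left
  let φC : k →+* Γ(P.X.left, P.away U.1) := LogJets.consts P.X (P.away U.1)
  choose v hv using fun j ↦ (c.isUnit_weight j).exists_right_inv
  let ζ (j : c.J) : JetAlgebra φC := JetAlgebra.of φC (v j) *
    JetAlgebra.der φC (JetAlgebra.of φC (ι (c.φ (.X j))))
  have hζ : ∀ j, JetAlgebra.of φC (ι (c.weight j)) * ζ j =
      JetAlgebra.der φC (JetAlgebra.of φC (ι (c.φ (.X j)))) := fun j ↦ by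
    rw [← mul_assoc, ← map_mul, hv, map_one, one_mul]
  have hφC : ι.comp (c.φ.comp MvPolynomial.C) = φC := by
    rw [c.φ_comp]
    exact res_comp_consts _ _
  let Θ := logCoord φC ι ζ
  have hinj : Function.Injective Θ := logCoord_injective c.etale
    (etale_of_isLocalization c.prodEqn c.isLocalization) c.res_injective hφC c.isUnit_weight hζ
  have hder : ∀ s ∈ Θ.range, JetAlgebra.der φC s ∈ Θ.range := by
    obtain ⟨D, hD, hC, hX, hz⟩ := exists_logDerivation c.etale c.weight
    rintro _ ⟨x, rfl⟩
    exact ⟨D x, logCoord_der c.etale hφC hζ hD hC hX hz x⟩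
  have hfn : ∀ a, JetAlgebra.of φC (ι a) ∈ Θ.range := fun a ↦ ⟨.C a, logCoord_C ζ a⟩
  have hζr : ∀ j, ζ j ∈ Θ.range := fun j ↦ ⟨.X (j, 0), logCoord_X ζ j 0⟩
  -- The range of `Θ` contains the generators and is closed under `∂`, so minimality applies. The
  -- inverse of an equation is unique, hence `y` is the chosen `v`.
  have hle : P.logJetAlgebra (site U) ≤ Θ.range := c.logJetAlgebra_le hfn hder fun Z y hy ↦ by
    have h1 : y = v (c.σ Z) := by
      have := hv (c.σ Z)
      rw [weight_σ] at this
      rw [← mul_one y, ← this, ← mul_assoc, mul_comm y, hy, one_mul]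
    rw [h1]
    exact hζr (c.σ Z)
  have hζmem : ∀ j, ζ j ∈ P.logJetAlgebra (site U) := by
    intro j
    by_cases hj : j ∈ Set.range c.σ
    · obtain ⟨Z, rfl⟩ := hj
      have := hv (c.σ Z)
      rw [weight_σ] at this
      exact c.inv_eqn_mem Z this
    -- For a coordinate that defines no component the weight is `1`, so `ζ j` is just `∂x_j`.
    · have h1 := hv j
      rw [weight, if_neg hj, map_one, one_mul] at h1
      change JetAlgebra.of φC (v j) * _ ∈ _
      rw [h1, map_one, one_mul]
      exact P.der_mem (site U) (P.fn_mem (site U) (c.φ (.X j)))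
  have hge : ∀ x, Θ x ∈ P.logJetAlgebra (site U) := by
    intro x
    induction x using MvPolynomial.induction_on with
    | C a =>
      rw [show Θ (.C a) = _ from logCoord_C ζ a]
      exact P.fn_mem (site U) a
    | add p q hp hq => rw [map_add]; exact add_mem hp hq
    | mul_X p i hp =>
      rw [map_mul]
      refine mul_mem hp ?_
      rw [show Θ (.X i) = _ from logCoord_X ζ i.1 i.2]
      generalize i.2 = n
      induction n with
      | zero => exact hζmem i.1
      | succ n ih => rw [Function.iterate_succ_apply']; exact P.der_mem (site U) ih
  refine ⟨.ofBijective (Θ.codRestrict _ hge) ⟨fun x y h ↦ hinj (congrArg Subtype.val h), ?_⟩,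
    fun a ↦ Subtype.ext (logCoord_C ζ a)⟩
  rintro ⟨s, hs⟩
  obtain ⟨x, rfl⟩ := hle hs
  exact ⟨x, rfl⟩

/-- Over a chart, the log jet space is the product with an affine space. -/
theorem exists_jetSections [CharZero k] (c : LogChart P.X P.D U) :
    ∃ G : MvPolynomial (c.J × ℕ) Γ(P.X.left, U) ≃+*
        Γ(P.logJet.left, P.logJetProj.left ⁻¹ᵁ U.1),
      ∀ a, G (.C a) = (P.logJetProj.left.app U.1).hom a := by
  obtain ⟨G, hG⟩ := c.exists_jetCoord
  let e : Γ(P.logJet.left, P.logJetProj.left ⁻¹ᵁ U.1) ≃+* P.logJetAlgebra (site U) :=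
    .ofBijective _ (P.logJetSections_bijective (site U))
  refine ⟨G.trans e.symm, fun a ↦ e.injective ?_⟩
  change e (e.symm (G (.C a))) = _
  rw [e.apply_symm_apply, hG]
  exact (P.logJetSections_proj (site U) a).symm

end LogChart

end LogJets

/-! ### The log jet space is a log pair with a tangent vector field -/

namespace LogJets

variable {k : Type u} [Field k]

theorem isRadical_vanishingIdeal {X : Scheme.{u}} (Z : Closeds X) (U : X.affineOpens) :
    ((Scheme.IdealSheafData.vanishingIdeal Z).ideal U).IsRadical := by
  rw [Scheme.IdealSheafData.vanishingIdeal_ideal]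
  exact PrimeSpectrum.isRadical_vanishingIdeal _

instance (P : LogPair k) : IsAffineHom P.logJetProj.left :=
  ⟨fun U hU ↦ P.isAffineOpen_above ⟨U, hU⟩⟩

namespace LogChart

variable {P : LogPair k} {U : P.X.left.affineOpens}

/-- The preimage of the domain of a chart in the log jet space. -/
noncomputable abbrev jetSite (U : P.X.left.affineOpens) : P.logJet.left.affineOpens :=
  ⟨P.logJetProj.left ⁻¹ᵁ U.1, P.isAffineOpen_above (site U)⟩

/-- Over a chart the functions upstairs form a polynomial algebra, so the extension of the radical
ideal of `Z` is still radical. -/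
theorem vanishingIdeal_jetSite [CharZero k] (c : LogChart P.X P.D U) (Z : Closeds P.X.left) :
    (Scheme.IdealSheafData.vanishingIdeal (Z.preimage P.logJetProj.left.continuous)).ideal
      (jetSite U) =
      ((Scheme.IdealSheafData.vanishingIdeal Z).ideal U).map (P.logJetProj.left.app U.1).hom := by
  obtain ⟨G, hG⟩ := c.exists_jetSections
  exact vanishingIdeal_preimage P.logJetProj.left (P.isAffineOpen_above (site U)) Z
    (map_isRadical_of_polynomial G hG (isRadical_vanishingIdeal Z U))

end LogChart

namespace LogPair

variable (P : LogPair k)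

open LogChart

/-- Over a chart at `x` the fibre has a generic point `η`. If `y` lies over a specialization of `x`
outside that chart, a chart at `π(y)` still contains `x` and yields another generic point `η'` over
`x`; then `η ⤳ η' ⤳ y`. -/
theorem exists_logJet_generic [CharZero k] (x : P.X.left) :
    ∃ η, P.logJetProj.left η = x ∧ ∀ y, x ⤳ P.logJetProj.left y → η ⤳ y := by
  have key (U : P.X.left.affineOpens) (c : LogChart P.X P.D U) (hx : x ∈ U.1) :
      ∃ η, P.logJetProj.left η = x ∧
        ∀ y, P.logJetProj.left y ∈ U.1 → x ⤳ P.logJetProj.left y → η ⤳ y := by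
    obtain ⟨G, hG⟩ := c.exists_jetSections
    exact exists_generic_of_polynomial P.logJetProj.left (P.isAffineOpen_above (site U)) G hG hx
  obtain ⟨U, hxU, -, ⟨c⟩⟩ := P.exists_logChart ⊤ (p := x) trivial
  obtain ⟨η, hη, h⟩ := key U c hxU
  refine ⟨η, hη, fun y hy ↦ ?_⟩
  obtain ⟨U', hyU', -, ⟨c'⟩⟩ := P.exists_logChart ⊤ (p := P.logJetProj.left y) trivial
  obtain ⟨η', hη', h'⟩ := key U' c' (hy.mem_open U'.1.isOpen hyU')
  exact (h η' (hη'.symm ▸ hxU) (by rw [hη'])).trans (h' y hyU' hy)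

theorem mem_components_logJetDivisor [CharZero k] (Z : Closeds P.logJet.left) :
    Z ∈ components P.logJetDivisor ↔
      ∃ Z' ∈ components P.D, Z = Z'.preimage P.logJetProj.left.continuous :=
  components_preimage P.logJetProj.left.continuous P.exists_logJet_generic P.D Z

/-- The chart of the log jet space over a chart. -/
theorem nonempty_logJet_chart [CharZero k] {U : P.X.left.affineOpens} (c : LogChart P.X P.D U) :
    Nonempty (LogChart P.logJet P.logJetDivisor (jetSite U)) := by
  obtain ⟨G, hG⟩ := c.exists_jetSections
  have hZ (Z : meetingComponents P.logJetDivisor (jetSite U).1) :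
      ∃ Z' : meetingComponents P.D U.1, Z.1 = Z'.1.preimage P.logJetProj.left.continuous := by
    obtain ⟨Z', hZ', h⟩ := (P.mem_components_logJetDivisor Z.1).mp Z.2.1
    obtain ⟨x, hx, hxU⟩ := Z.2.2
    rw [h] at hx
    exact ⟨⟨Z', hZ', P.logJetProj.left x, hx, hxU⟩, h⟩
  choose τ hτ using hZ
  have hτi : Function.Injective τ := fun Z₁ Z₂ h ↦ Subtype.ext (by rw [hτ, hτ, h])
  have := c.finite.to_subtype
  -- The coordinates upstairs are the polynomial variables and the old `x_j`. The equation of a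
  -- component is the one of the component `τ Z` downstairs whose preimage it is.
  let φ : MvPolynomial ((c.J × ℕ) ⊕ c.J) k →+* Γ(P.logJet.left, P.logJetProj.left ⁻¹ᵁ U.1) :=
    G.toRingHom.comp (polyChart c.φ (c.J × ℕ))
  refine ⟨⟨(c.J × ℕ) ⊕ c.J, φ, fun Z ↦ .inr (c.σ (τ Z)), ?_, ?_, ?_, ?_, fun Z ↦ ?_⟩⟩
  · ext a
    change G (polyChart c.φ (c.J × ℕ) (.C a)) = consts P.logJet (P.logJetProj.left ⁻¹ᵁ U.1) a
    rw [polyChart_C, hG, ← app_consts P.logJetProj, ← c.φ_comp]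
    rfl
  · exact etale_comp (polyChart_etale c.etale _) (etale_of_bijective G.bijective)
  · exact Set.finite_coe_iff.mp (Finite.of_injective τ hτi)
  · exact fun Z₁ Z₂ h ↦ hτi (c.injective (Sum.inr_injective h))
  · rw [hτ, c.vanishingIdeal_jetSite, c.ideal_eq, Ideal.map_span, Set.image_singleton, ← hG,
      ← polyChart_inr]
    rfl

theorem hasLogChart_logJet [CharZero k] (p : P.logJet.left) :
    HasLogChart P.logJet P.logJetDivisor p := by
  obtain ⟨U, hU, -, ⟨c⟩⟩ := P.exists_logChart ⊤ (p := P.logJetProj.left p) trivial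
  obtain ⟨c'⟩ := P.nonempty_logJet_chart c
  exact c'.hasLogChart hU

/-- Functions pulled back from the ideal of `D` vanish on the preimage of `D`. Conversely, over each
chart the ideal of the preimage is generated by such pull-backs. -/
theorem vanishingIdeal_logJetDivisor [CharZero k] :
    Scheme.IdealSheafData.vanishingIdeal P.logJetDivisor =
      (Scheme.IdealSheafData.vanishingIdeal P.D).comap P.logJetProj.left := by
  refine le_antisymm ?_ ?_
  · refine Scheme.IdealSheafData.le_of_iSup_eq_top
      (fun i : {U : P.X.left.affineOpens // Nonempty (LogChart P.X P.D U)} ↦ jetSite i.1) ?_ ?_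
    · refine top_le_iff.mp fun x _ ↦ ?_
      obtain ⟨U, hU, -, hc⟩ := P.exists_logChart ⊤ (p := P.logJetProj.left x) trivial
      exact Opens.mem_iSup.mpr ⟨⟨U, hc⟩, hU⟩
    · rintro ⟨U, ⟨c⟩⟩
      refine (c.vanishingIdeal_jetSite P.D).trans_le (Ideal.map_le_iff_le_comap.mpr ?_)
      have h := (Scheme.IdealSheafData.le_map_comap (f := P.logJetProj.left)
        (J := Scheme.IdealSheafData.vanishingIdeal P.D)) U
      exact h.trans_eq (Scheme.IdealSheafData.ideal_map _ _ U (P.isAffineOpen_above (site U)))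
  · rw [← Scheme.IdealSheafData.le_support_iff_le_vanishingIdeal,
      Scheme.IdealSheafData.support_comap]
    intro x hx
    change P.logJetProj.left x ∈ (Scheme.IdealSheafData.vanishingIdeal P.D).support
    rw [← SetLike.mem_coe, Scheme.IdealSheafData.coe_support_vanishingIdeal]
    exact hx

/-- The quotient is the log jet `∂γ / γ`, which is a genuine function over the chart. -/
theorem app_eqn_dvd_der {U : P.X.left.affineOpens} (c : LogChart P.X P.D U)
    (Z : meetingComponents P.D U.1) :
    (P.logJetProj.left.app U.1).hom (c.eqn Z) ∣
      P.logJetField.der _ ((P.logJetProj.left.app U.1).hom (c.eqn Z)) := by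
  obtain ⟨y, hy⟩ := (c.isUnit_res_eqn Z).exists_right_inv
  obtain ⟨w, hw⟩ := (P.logJetSections_bijective (site U)).2 ⟨_, c.inv_eqn_mem Z hy⟩
  refine ⟨w, (P.logJetSections_bijective (site U)).1 (Subtype.ext ?_)⟩
  have h1 : P.logJetSections (site U) ((P.logJetProj.left.app U.1).hom (c.eqn Z)) =
      P.fnHom (site U) (c.eqn Z) := P.logJetSections_proj (site U) (c.eqn Z)
  have h2 : P.logJetSections (site U) (P.logJetField.der (P.logJetProj.left ⁻¹ᵁ U.1)
      ((P.logJetProj.left.app U.1).hom (c.eqn Z))) =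
      P.logJetDer (site U) (P.fnHom (site U) (c.eqn Z)) := by
    rw [← h1]
    exact P.logJetSections_der (site U) _
  refine (congrArg Subtype.val h2).trans ?_
  refine Eq.trans ?_ (congrArg Subtype.val (map_mul (P.logJetSections (site U))
    ((P.logJetProj.left.app U.1).hom (c.eqn Z)) w)).symm
  rw [h1, hw]
  change JetAlgebra.der _ (P.fn U.1 (c.eqn Z)) = JetAlgebra.of _ _ * (JetAlgebra.of _ y * _)
  rw [← mul_assoc, ← map_mul, hy, map_one, one_mul]

/-- Vanishing of `∂s` is checked at each point `x` of the divisor. Let `t` be the pulled back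
equation of a component of `D` through `π(x)`. Near `x` one has `s = t a`, so `∂s = t ∂a + a ∂t`,
and `t` divides both terms. -/
theorem logJetField_isTangent [CharZero k] : P.logJetField.IsTangent P.logJetDivisor := by
  intro V s hs
  rw [mem_vanishingIdeal_iff]
  intro x hx hxs
  have hxV : x ∈ V.1 := P.logJet.left.basicOpen_le _ hxs
  obtain ⟨U, hU, -, ⟨c⟩⟩ := P.exists_logChart ⊤ (p := P.logJetProj.left x) trivial
  obtain ⟨Z, hxZ⟩ := LogChart.exists_mem_of_mem hU (show P.logJetProj.left x ∈ P.D from hx)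
  obtain ⟨_, ⟨W, hW, rfl⟩, hxW, hWle⟩ := P.logJet.left.isBasis_affineOpens.exists_subset_of_mem_open
    (show x ∈ ((V.1 ⊓ P.logJetProj.left ⁻¹ᵁ U.1 : P.logJet.left.Opens) : Set P.logJet.left) from
      ⟨hxV, hU⟩) (V.1 ⊓ P.logJetProj.left ⁻¹ᵁ U.1).isOpen
  let W' : P.logJet.left.affineOpens := ⟨W, hW⟩
  have hWV : W ≤ V.1 := fun y hy ↦ (hWle hy).1
  have hWU : W ≤ P.logJetProj.left ⁻¹ᵁ U.1 := fun y hy ↦ (hWle hy).2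
  let Z' : Closeds P.logJet.left := Z.1.preimage P.logJetProj.left.continuous
  have hZ' : Z' ≤ P.logJetDivisor := fun y hy ↦ Z.2.1.1.2 hy
  let t := (P.logJetProj.left.app U.1).hom (c.eqn Z)
  have h1 : res hWV s ∈ (Scheme.IdealSheafData.vanishingIdeal Z').ideal W' :=
    Scheme.IdealSheafData.vanishingIdeal_antimono hZ' W'
      (Scheme.IdealSheafData.ideal_le_comap_ideal _ (U := W') (V := V) hWV hs)
  have h2 : (Scheme.IdealSheafData.vanishingIdeal Z').ideal W' = Ideal.span {res hWU t} := by
    rw [← Scheme.IdealSheafData.map_ideal _ (U := W') (V := jetSite U) hWU,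
      c.vanishingIdeal_jetSite, c.ideal_eq, Ideal.map_span, Set.image_singleton, Ideal.map_span,
      Set.image_singleton]
    rfl
  have h3 : res hWV (P.logJetField.der V.1 s) ∈
      (Scheme.IdealSheafData.vanishingIdeal Z').ideal W' := by
    rw [h2, Ideal.mem_span_singleton] at h1 ⊢
    obtain ⟨a, ha⟩ := h1
    rw [P.logJetField.res, ha, P.logJetField.leibniz, ← P.logJetField.res]
    exact dvd_add (dvd_mul_right _ _)
      (dvd_mul_of_dvd_right (map_dvd (res hWU) (P.app_eqn_dvd_der c Z)) _)
  refine mem_vanishingIdeal_iff.mp h3 x hxZ ?_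
  rw [basicOpen_res]
  exact ⟨hxW, hxs⟩

end LogPair

end LogJets

namespace LogJets

/-! ### Gluing morphisms to a scheme affine over the base -/

section Gluing

variable {X Y Z : Scheme.{u}}

theorem hom_ext_of_opens {ι : Type*} (W : ι → Y.Opens) (hW : ∀ y, ∃ i, y ∈ W i) (g g' : Y ⟶ Z)
    (h : ∀ i, (W i).ι ≫ g = (W i).ι ≫ g') : g = g' := by
  have hc : IsOpenCover W := IsOpenCover.mk (top_le_iff.mp fun y _ ↦ Opens.mem_iSup.mpr (hW y))
  exact Scheme.Cover.hom_ext (Y.openCoverOfIsOpenCover W hc) _ _ h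

/-- Gluing of morphisms that agree on sufficiently many smaller opens of a cover. -/
theorem exists_glued_hom {ι : Type u} (W : ι → Y.Opens) (hW : ∀ y, ∃ i, y ∈ W i)
    (g : ∀ i, (W i).toScheme ⟶ Z)
    (h : ∀ i j, ∀ y ∈ W i, y ∈ W j → ∃ (l : ι) (hi : W l ≤ W i) (hj : W l ≤ W j), y ∈ W l ∧
      Y.homOfLE hi ≫ g i = g l ∧ Y.homOfLE hj ≫ g j = g l) :
    ∃ G : Y ⟶ Z, ∀ i, (W i).ι ≫ G = g i := by
  have hc : IsOpenCover W := IsOpenCover.mk (top_le_iff.mp fun y _ ↦ Opens.mem_iSup.mpr (hW y))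
  refine ⟨(Y.openCoverOfIsOpenCover W hc).glueMorphisms g fun i j ↦ ?_,
    fun i ↦ (Y.openCoverOfIsOpenCover W hc).ι_glueMorphisms g _ i⟩
  let p : Limits.pullback (W i).ι (W j).ι ⟶ (W i).toScheme := Limits.pullback.fst _ _
  let q : Limits.pullback (W i).ι (W j).ι ⟶ (W j).toScheme := Limits.pullback.snd _ _
  have hpq : p ≫ (W i).ι = q ≫ (W j).ι := Limits.pullback.condition
  change p ≫ g i = q ≫ g j
  let r := p ≫ (W i).ι
  -- The preimages of the smaller opens `W l` supplied by `h` cover the fibre product, and on each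
  -- of them both composites come from `g l`.
  refine hom_ext_of_opens
    (fun l : {l // ∃ (hi : W l ≤ W i) (hj : W l ≤ W j),
      Y.homOfLE hi ≫ g i = g l ∧ Y.homOfLE hj ≫ g j = g l} ↦ r ⁻¹ᵁ W l.1) (fun x ↦ ?_) _ _ ?_
  · obtain ⟨l, hi, hj, hl, h1, h2⟩ := h i j (r x) (p x).2 (by
      change (p ≫ (W i).ι) x ∈ W j
      rw [hpq]
      exact (q x).2)
    exact ⟨⟨l, hi, hj, h1, h2⟩, hl⟩
  · rintro ⟨l, hi, hj, h1, h2⟩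
    have h3 : (r ⁻¹ᵁ W l).ι ≫ p = (r ∣_ W l) ≫ Y.homOfLE hi := by
      rw [← cancel_mono (W i).ι, Category.assoc, Category.assoc, Scheme.homOfLE_ι,
        morphismRestrict_ι]
    have h4 : (r ⁻¹ᵁ W l).ι ≫ q = (r ∣_ W l) ≫ Y.homOfLE hj := by
      rw [← cancel_mono (W j).ι, Category.assoc, Category.assoc, Scheme.homOfLE_ι,
        morphismRestrict_ι, ← hpq]
    change (r ⁻¹ᵁ W l).ι ≫ p ≫ g i = (r ⁻¹ᵁ W l).ι ≫ q ≫ g j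
    exact ((reassoc_of% h3) (g i)).trans ((congrArg (r ∣_ W l ≫ ·) (h1.trans h2.symm)).trans
      ((reassoc_of% h4) (g j)).symm)

theorem toSpecΓ_SpecMap_appLE_fromSpec (g : Y ⟶ Z) {V : Z.Opens} (hV : IsAffineOpen V)
    {W : Y.Opens} (h : W ≤ g ⁻¹ᵁ V) :
    W.toSpecΓ ≫ Spec.map (g.appLE V W h) ≫ hV.fromSpec = W.ι ≫ g := by
  rw [Scheme.Opens.toSpecΓ_SpecMap_appLE_assoc, hV.toSpecΓ_fromSpec, Scheme.Hom.resLE_comp_ι]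

/-- The map `W.toSpecΓ` is an isomorphism on global functions, so `a` and `b` are recovered by
taking global functions. -/
theorem toSpecΓ_SpecMap_injective {W : Y.Opens} {R : CommRingCat.{u}} {a b : R ⟶ Γ(Y, W)}
    (h : W.toSpecΓ ≫ Spec.map a = W.toSpecΓ ≫ Spec.map b) : a = b := by
  have h2 := congrArg Scheme.Hom.appTop h
  rw [Scheme.Hom.comp_appTop, Scheme.Hom.comp_appTop, Scheme.Opens.toSpecΓ_appTop,
    Scheme.ΓSpecIso_naturality_assoc, Scheme.ΓSpecIso_naturality_assoc] at h2
  rwa [Iso.cancel_iso_hom_left, Iso.cancel_iso_inv_right] at h2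

section Affine

variable (π : Z ⟶ X) [IsAffineHom π] (F : Y ⟶ X)

theorem preimage_le_of_comp_eq {π : Z ⟶ X} {F : Y ⟶ X} {G : Y ⟶ Z} (h : G ≫ π = F) (U : X.Opens) :
    F ⁻¹ᵁ U ≤ G ⁻¹ᵁ π ⁻¹ᵁ U := by
  rw [← h]
  exact le_rfl

/-- Morphisms to a scheme affine over `X` are determined by their effect on functions. -/
theorem hom_ext_of_affine {G G' : Y ⟶ Z} (hG : G ≫ π = F) (hG' : G' ≫ π = F)
    (h : ∀ x, ∃ U : X.affineOpens, x ∈ U.1 ∧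
      G.appLE (π ⁻¹ᵁ U.1) (F ⁻¹ᵁ U.1) (preimage_le_of_comp_eq hG U.1) =
        G'.appLE (π ⁻¹ᵁ U.1) (F ⁻¹ᵁ U.1) (preimage_le_of_comp_eq hG' U.1)) : G = G' := by
  choose U hU h using h
  refine hom_ext_of_opens (fun x : X ↦ F ⁻¹ᵁ (U x).1) (fun y ↦ ⟨F y, hU (F y)⟩) _ _ fun x ↦ ?_
  have hA : IsAffineOpen (π ⁻¹ᵁ (U x).1) := (U x).2.preimage π
  rw [← toSpecΓ_SpecMap_appLE_fromSpec G hA (preimage_le_of_comp_eq hG _),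
    ← toSpecΓ_SpecMap_appLE_fromSpec G' hA (preimage_le_of_comp_eq hG' _), h]

/-- Morphisms to a scheme affine over `X` are given by compatible homomorphisms between the algebras
of functions. -/
theorem exists_hom_of_affine
    (l : ∀ U : X.AffineZariskiSite, Γ(Z, π ⁻¹ᵁ U.toOpens) →+* Γ(Y, F ⁻¹ᵁ U.toOpens))
    (hl : ∀ U a, l U ((π.app U.toOpens).hom a) = (F.app U.toOpens).hom a)
    (hres : ∀ {U V : X.AffineZariskiSite} (h : V ≤ U) s,
      res (F.preimage_mono (Scheme.AffineZariskiSite.toOpens_mono h)) (l U s) =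
        l V (res (π.preimage_mono (Scheme.AffineZariskiSite.toOpens_mono h)) s)) :
    ∃ G : Y ⟶ Z, ∃ h : G ≫ π = F, ∀ U : X.AffineZariskiSite,
      G.appLE (π ⁻¹ᵁ U.toOpens) (F ⁻¹ᵁ U.toOpens) (preimage_le_of_comp_eq h U.toOpens) =
        CommRingCat.ofHom (l U) := by
  have hA (U : X.AffineZariskiSite) : IsAffineOpen (π ⁻¹ᵁ U.toOpens) :=
    (isAffineOpen_toOpens U).preimage π
  let g (U : X.AffineZariskiSite) : (F ⁻¹ᵁ U.toOpens).toScheme ⟶ Z :=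
    (F ⁻¹ᵁ U.toOpens).toSpecΓ ≫ Spec.map (CommRingCat.ofHom (l U)) ≫ (hA U).fromSpec
  have hcov : ∀ y, ∃ U : X.AffineZariskiSite, y ∈ F ⁻¹ᵁ U.toOpens := fun y ↦ by
    obtain ⟨_, ⟨V, hV, rfl⟩, hx, -⟩ := X.isBasis_affineOpens.exists_subset_of_mem_open
      (Set.mem_univ (F y)) isOpen_univ
    exact ⟨⟨V, hV⟩, hx⟩
  have hg {U V : X.AffineZariskiSite} (h : V ≤ U) :
      Y.homOfLE (F.preimage_mono (Scheme.AffineZariskiSite.toOpens_mono h)) ≫ g U = g V := by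
    have h1 : Y.presheaf.map (homOfLE (F.preimage_mono
        (Scheme.AffineZariskiSite.toOpens_mono h))).op = CommRingCat.ofHom
          (res (F.preimage_mono (Scheme.AffineZariskiSite.toOpens_mono h))) := rfl
    have h2 : CommRingCat.ofHom (l U) ≫ Y.presheaf.map (homOfLE (F.preimage_mono
        (Scheme.AffineZariskiSite.toOpens_mono h))).op = Z.presheaf.map (homOfLE (π.preimage_mono
          (Scheme.AffineZariskiSite.toOpens_mono h))).op ≫ CommRingCat.ofHom (l V) :=
      CommRingCat.hom_ext (RingHom.ext fun s ↦ hres h s)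
    simp only [g]
    rw [← Scheme.Opens.toSpecΓ_SpecMap_presheaf_map_assoc, ← Spec.map_comp_assoc, h2,
      Spec.map_comp_assoc, (hA U).map_fromSpec (hA V)]
  obtain ⟨G, hG⟩ := exists_glued_hom (fun U : X.AffineZariskiSite ↦ F ⁻¹ᵁ U.toOpens) hcov g
    fun U V y hU hV ↦ by
      obtain ⟨f, f', h, hx⟩ := exists_basicOpen_le_affine_inter (isAffineOpen_toOpens U)
        (isAffineOpen_toOpens V) (F y) ⟨hU, hV⟩
      have h1 : U.basicOpen f ≤ U := U.basicOpen_le f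
      have h2 : U.basicOpen f ≤ V := ⟨f', h.symm⟩
      exact ⟨U.basicOpen f, F.preimage_mono (Scheme.AffineZariskiSite.toOpens_mono h1),
        F.preimage_mono (Scheme.AffineZariskiSite.toOpens_mono h2), hx, hg h1, hg h2⟩
  have hGF : G ≫ π = F := by
    refine hom_ext_of_opens (fun U : X.AffineZariskiSite ↦ F ⁻¹ᵁ U.toOpens) hcov _ _ fun U ↦ ?_
    have h1 : π.appLE U.toOpens (π ⁻¹ᵁ U.toOpens) le_rfl ≫ CommRingCat.ofHom (l U) =
        F.appLE U.toOpens (F ⁻¹ᵁ U.toOpens) le_rfl := by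
      rw [Scheme.Hom.appLE_eq_app, Scheme.Hom.appLE_eq_app]
      exact CommRingCat.hom_ext (RingHom.ext (hl U))
    rw [← Category.assoc, hG, Category.assoc, Category.assoc,
      ← IsAffineOpen.SpecMap_appLE_fromSpec π (isAffineOpen_toOpens U) (hA U) le_rfl,
      ← Spec.map_comp_assoc, h1]
    exact toSpecΓ_SpecMap_appLE_fromSpec F (isAffineOpen_toOpens U) le_rfl
  refine ⟨G, hGF, fun U ↦ toSpecΓ_SpecMap_injective ?_⟩
  rw [← cancel_mono (hA U).fromSpec, Category.assoc, Category.assoc]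
  exact (toSpecΓ_SpecMap_appLE_fromSpec G (hA U) _).trans (hG U)

end Affine

end Gluing

end LogJets

/-! ### Evaluating log jets along a tangent vector field -/

namespace LogJets

variable {k : Type u} [Field k]

namespace LogPair.Hom

variable {Q P : LogPair k} (f : Hom Q P)

theorem away_le_preimage (U : P.X.left.Opens) :
    Q.away (f.hom.left ⁻¹ᵁ U) ≤ f.hom.left ⁻¹ᵁ P.away U :=
  fun y hy ↦ ⟨hy.1, fun h ↦ hy.2 (f.mem_of_mem y h)⟩

/-- The pull-back of functions defined off the divisors. -/
noncomputable def pullAway (U : P.X.left.Opens) :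
    Γ(P.X.left, P.away U) →+* Γ(Q.X.left, Q.away (f.hom.left ⁻¹ᵁ U)) :=
  (f.hom.left.appLE _ _ (f.away_le_preimage U)).hom

theorem pullAway_res (U : P.X.left.Opens) (a : Γ(P.X.left, U)) :
    f.pullAway U (res inf_le_left a) = res inf_le_left ((f.hom.left.app U).hom a) := by
  have h : P.X.left.presheaf.map (homOfLE (inf_le_left : P.away U ≤ U)).op ≫
      f.hom.left.appLE _ _ (f.away_le_preimage U) = f.hom.left.app U ≫
        Q.X.left.presheaf.map (homOfLE (inf_le_left : Q.away (f.hom.left ⁻¹ᵁ U) ≤ _)).op :=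
    Scheme.Hom.map_appLE ..
  exact RingHom.congr_fun (congrArg CommRingCat.Hom.hom h) a

theorem res_pullAway {U V : P.X.left.Opens} (h : V ≤ U) (a : Γ(P.X.left, P.away U)) :
    res (Q.away_le (f.hom.left.preimage_mono h)) (f.pullAway U a) =
      f.pullAway V (res (P.away_le h) a) := by
  have h : f.hom.left.appLE _ _ (f.away_le_preimage U) ≫
      Q.X.left.presheaf.map (homOfLE (Q.away_le (f.hom.left.preimage_mono h))).op =
      P.X.left.presheaf.map (homOfLE (P.away_le h)).op ≫
      f.hom.left.appLE _ _ (f.away_le_preimage V) := by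
    rw [Scheme.Hom.appLE_map, Scheme.Hom.map_appLE]
  exact RingHom.congr_fun (congrArg CommRingCat.Hom.hom h) a

theorem pullAway_comp_consts (U : P.X.left.Opens) :
    (f.pullAway U).comp (consts P.X (P.away U)) =
      consts Q.X (Q.away (f.hom.left ⁻¹ᵁ U)) := by
  ext c
  have h1 : res inf_le_left (consts P.X U c) = consts P.X (P.away U) c :=
    RingHom.congr_fun (res_comp_consts P.X inf_le_left) c
  have h2 : res inf_le_left (consts Q.X (f.hom.left ⁻¹ᵁ U) c) =
      consts Q.X (Q.away (f.hom.left ⁻¹ᵁ U)) c :=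
    RingHom.congr_fun (res_comp_consts Q.X inf_le_left) c
  rw [RingHom.comp_apply, ← h1, pullAway_res, app_consts, h2]

theorem isUnit_res_app_eqn {U : P.X.left.affineOpens} (c : LogChart P.X P.D U)
    (Z : meetingComponents P.D U.1) :
    IsUnit (res (inf_le_left : Q.away (f.hom.left ⁻¹ᵁ U.1) ≤ _)
      ((f.hom.left.app U.1).hom (c.eqn Z))) := by
  rw [← f.pullAway_res]
  exact (c.isUnit_res_eqn Z).map _

end LogPair.Hom

namespace LCVS

/-- If a function is invertible off the divisor, then its logarithmic derivative has no poles. -/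
theorem exists_res_eq_mul_der {Y : LCVS k} {W : Y.pair.X.left.Opens} (a : Γ(Y.pair.X.left, W))
    (b : Γ(Y.pair.X.left, Y.pair.away W)) (h : res (inf_le_left : Y.pair.away W ≤ W) a * b = 1) :
    ∃ t, res (inf_le_left : Y.pair.away W ≤ W) t =
      b * Y.field.der _ (res (inf_le_left : Y.pair.away W ≤ W) a) := by
  refine mem_range_res_of_locally Y.pair.D.compl Y.pair.res_away_injective _ fun y hy ↦ ?_
  obtain ⟨V, hyV, hV, ⟨c⟩⟩ := Y.pair.exists_logChart W hy
  have h1 : res (inf_le_left : Y.pair.away V.1 ≤ V.1) (res hV a) =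
      res (Y.pair.away_le hV) (res (inf_le_left : Y.pair.away W ≤ W) a) :=
    (res_res ..).trans (res_res ..).symm
  have h2 : res (inf_le_left : Y.pair.away V.1 ≤ V.1) (res hV a) * res (Y.pair.away_le hV) b = 1 := by
    rw [h1, ← map_mul, h, map_one]
  -- Here tangency enters: over a chart, `a` divides its derivative because it is invertible off the
  -- divisor, and the quotient `w` is the required local extension.
  obtain ⟨w, hw⟩ := c.dvd_der_of_isUnit Y.isTangent (a := res hV a) (.of_mul_eq_one _ h2)
  refine ⟨V.1, hV, hyV, w, ?_⟩
  change _ = res (Y.pair.away_le hV) _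
  rw [map_mul, Y.field.res, ← h1, ← Y.field.res, hw, map_mul, ← mul_assoc,
    mul_comm (res (Y.pair.away_le hV) b), h2, one_mul]

variable {Y : LCVS k} {P : LogPair k} (f : LogPair.Hom Y.pair P) [CharZero k]

/-- Evaluation of jets of functions off `D` along the trajectories of the vector field. -/
noncomputable def jetEval (U : P.X.left.Opens) :
    P.awayJets U →+* Γ(Y.pair.X.left, Y.pair.away (f.hom.left ⁻¹ᵁ U)) :=
  taylor (f.pullAway U) (f.pullAway_comp_consts U) (Y.field.leibniz _) (Y.field.consts _)

theorem jetEval_of (U : P.X.left.Opens) (a) :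
    jetEval f U (JetAlgebra.of _ a) = f.pullAway U a := taylor_of ..

theorem jetEval_der (U : P.X.left.Opens) (s) :
    jetEval f U (JetAlgebra.der _ s) = Y.field.der _ (jetEval f U s) := taylor_der ..

theorem jetEval_fn (U : P.X.left.Opens) (a) :
    jetEval f U (P.fn U a) = res inf_le_left ((f.hom.left.app U).hom a) :=
  (jetEval_of f U _).trans (f.pullAway_res U a)

/-- Both composites are compatible with the derivations, so they need only be compared on functions.
-/
theorem res_jetEval {U V : P.X.left.Opens} (h : V ≤ U) (s : P.awayJets U) :
    res (Y.pair.away_le (f.hom.left.preimage_mono h)) (jetEval f U s) =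
      jetEval f V (P.resJets h s) := by
  refine RingHom.congr_fun (f := (res (Y.pair.away_le (f.hom.left.preimage_mono h))).comp
    (jetEval f U)) (g := (jetEval f V).comp (P.resJets h))
    (JetAlgebra.hom_ext_of_der (consts Y.pair.X _) (d := Y.field.der _)
      (fun x ↦ ?_) (fun x ↦ ?_) fun a ↦ ?_) s
  · rw [RingHom.comp_apply, jetEval_der, Y.field.res]
    rfl
  · rw [RingHom.comp_apply, LogPair.resJets_der, jetEval_der]
    rfl
  · rw [RingHom.comp_apply, RingHom.comp_apply, jetEval_of, LogPair.resJets_of, jetEval_of,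
      f.res_pullAway h]

/-- Log jets take values without poles. Over a chart, the jets with this property form a subring
closed under `∂` that contains the functions and, by `exists_res_eq_mul_der`, the logarithmic
derivatives of the equations. The general case follows because extension across the divisor is a
local condition. -/
theorem exists_res_eq_jetEval (U : P.X.left.AffineZariskiSite) {s : P.awayJets U.toOpens}
    (hs : s ∈ P.logJetAlgebra U) : ∃ t, res inf_le_left t = jetEval f U.toOpens s := by
  have chart (U : P.X.left.affineOpens) (c : LogChart P.X P.D U) :
      P.logJetAlgebra (LogChart.site U) ≤ (res (inf_le_left :
        Y.pair.away (f.hom.left ⁻¹ᵁ U.1) ≤ _)).range.comap (jetEval f U.1) := by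
    refine c.logJetAlgebra_le (fun a ↦ ⟨_, (jetEval_fn f U.1 a).symm⟩) ?_ fun Z y hy ↦ ?_
    · rintro s ⟨t, ht⟩
      refine ⟨Y.field.der _ t, ?_⟩
      rw [jetEval_der, ← ht, Y.field.res]
    · obtain ⟨t, ht⟩ := exists_res_eq_mul_der ((f.hom.left.app U.1).hom (c.eqn Z))
        (f.pullAway U.1 y) (by rw [← f.pullAway_res, ← map_mul, hy, map_one])
      refine ⟨t, ht.trans ?_⟩
      rw [map_mul, jetEval_of, jetEval_der, jetEval_fn]
  refine mem_range_res_of_locally Y.pair.D.compl Y.pair.res_away_injective _ fun y hy ↦ ?_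
  obtain ⟨V, hyV, hV, ⟨c⟩⟩ := P.exists_logChart U.toOpens (p := f.hom.left y) hy
  obtain ⟨t, ht⟩ := chart V c (P.resJets_mem (V := LogChart.site V) hV hs)
  exact ⟨_, f.hom.left.preimage_mono hV, hyV, t, ht.trans (res_jetEval f hV s).symm⟩

theorem exists_evalHom (U : P.X.left.AffineZariskiSite) :
    ∃ l : P.logJetAlgebra U →+* Γ(Y.pair.X.left, f.hom.left ⁻¹ᵁ U.toOpens),
      ∀ s, res inf_le_left (l s) = jetEval f U.toOpens s.1 := by
  let ρ : Γ(Y.pair.X.left, f.hom.left ⁻¹ᵁ U.toOpens) →+*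
    Γ(Y.pair.X.left, Y.pair.away (f.hom.left ⁻¹ᵁ U.toOpens)) := res inf_le_left
  -- Restriction off the divisor is injective, so it can be inverted on its range, where the values
  -- of log jets lie.
  let e : Γ(Y.pair.X.left, f.hom.left ⁻¹ᵁ U.toOpens) ≃+* ρ.range :=
    .ofBijective ρ.rangeRestrict ⟨fun a b h ↦ Y.pair.res_away_injective _ (congrArg Subtype.val h),
      ρ.rangeRestrict_surjective⟩
  refine ⟨e.symm.toRingHom.comp (((jetEval f U.toOpens).comp (P.logJetAlgebra U).subtype).codRestrict
    ρ.range fun s ↦ exists_res_eq_jetEval f U s.2), fun s ↦ ?_⟩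
  exact congrArg Subtype.val (e.apply_symm_apply _)

/-- Evaluation of log jets along the trajectories of the vector field. -/
noncomputable def evalHom (U : P.X.left.AffineZariskiSite) :
    P.logJetAlgebra U →+* Γ(Y.pair.X.left, f.hom.left ⁻¹ᵁ U.toOpens) := (exists_evalHom f U).choose

theorem res_evalHom (U : P.X.left.AffineZariskiSite) (s) :
    res inf_le_left (evalHom f U s) = jetEval f U.toOpens s.1 := (exists_evalHom f U).choose_spec s

theorem evalHom_fnHom (U : P.X.left.AffineZariskiSite) (a) :
    evalHom f U (P.fnHom U a) = (f.hom.left.app U.toOpens).hom a :=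
  Y.pair.res_away_injective _ ((res_evalHom ..).trans (jetEval_fn f U.toOpens a))

theorem evalHom_der (U : P.X.left.AffineZariskiSite) (s) :
    evalHom f U (P.logJetDer U s) = Y.field.der _ (evalHom f U s) := by
  refine Y.pair.res_away_injective _ ?_
  rw [res_evalHom, Y.field.res, res_evalHom]
  exact jetEval_der f U.toOpens s.1

theorem evalHom_res {U V : P.X.left.AffineZariskiSite} (h : V ≤ U) (s) :
    res (f.hom.left.preimage_mono (Scheme.AffineZariskiSite.toOpens_mono h)) (evalHom f U s) =
      evalHom f V (P.resHom h s) := by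
  refine Y.pair.res_away_injective _ ?_
  rw [res_evalHom, res_res]
  refine Eq.trans ?_ (res_jetEval f (Scheme.AffineZariskiSite.toOpens_mono h) s.1)
  rw [← res_evalHom, res_res]

end LCVS

/-- Homomorphisms from the algebra of log jets over a chart are determined by their values on
functions if they are compatible with the derivations. -/
theorem LogChart.hom_ext {P : LogPair k} {U : P.X.left.affineOpens} (c : LogChart P.X P.D U)
    {R : Type*} [CommRing R] {d : R → R} {e e' : P.logJetAlgebra (site U) →+* R}
    (he : ∀ s, e (P.logJetDer (site U) s) = d (e s))
    (he' : ∀ s, e' (P.logJetDer (site U) s) = d (e' s))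
    (h : ∀ a, e (P.fnHom (site U) a) = e' (P.fnHom (site U) a))
    (hc : ∀ Z a b, e (P.fnHom (site U) (c.eqn Z)) * a = e (P.fnHom (site U) (c.eqn Z)) * b → a = b) :
    e = e' := by
  have key : P.logJetAlgebra (site U) ≤ (e.eqLocus e').map (P.logJetAlgebra (site U)).subtype := by
    refine c.logJetAlgebra_le (fun a ↦ ⟨P.fnHom (site U) a, h a, rfl⟩) ?_ fun Z y hy ↦ ?_
    · rintro _ ⟨s, hs, rfl⟩
      refine ⟨P.logJetDer (site U) s, ?_, rfl⟩
      change e _ = e' _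
      rw [he, he', show e s = e' s from hs]
    -- Both homomorphisms agree on `∂γ = γ · (∂γ / γ)` and on `γ`, and the image of `γ` can be
    -- cancelled; so they agree on `∂γ / γ`.
    · refine ⟨⟨_, c.inv_eqn_mem Z hy⟩, hc Z _ _ ?_, rfl⟩
      have h1 : P.fnHom (site U) (c.eqn Z) * ⟨_, c.inv_eqn_mem Z hy⟩ =
          P.logJetDer (site U) (P.fnHom (site U) (c.eqn Z)) := by
        refine Subtype.ext ?_
        change JetAlgebra.of _ _ * (JetAlgebra.of _ y * JetAlgebra.der _ _) = _
        rw [← mul_assoc, ← map_mul, hy, map_one, one_mul]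
        rfl
      rw [← map_mul, h, ← map_mul, h1, he, he', h]
  ext s
  obtain ⟨t, ht, hts⟩ := key s.2
  obtain rfl : t = s := Subtype.ext hts
  exact ht

end LogJets

/-! ### The universal property and the adjunction -/

namespace LogJets

variable {k : Type u} [Field k]

/-- Morphisms to the log jet space compatible with the vector fields are determined by their
compositions with the projection. -/
theorem LCVS.eq_of_comp_logJetProj {Y : LCVS k} {P : LogPair k} (f : LogPair.Hom Y.pair P) {G G' : Y.pair.X.left ⟶ P.logJet.left}
    (hG : G ≫ P.logJetProj.left = f.hom.left) (hG' : G' ≫ P.logJetProj.left = f.hom.left)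
    (h : ∀ U s, (G.app U).hom (P.logJetField.der U s) = Y.field.der _ ((G.app U).hom s))
    (h' : ∀ U s, (G'.app U).hom (P.logJetField.der U s) = Y.field.der _ ((G'.app U).hom s)) :
    G = G' := by
  refine hom_ext_of_affine P.logJetProj.left f.hom.left hG hG' fun x ↦ ?_
  obtain ⟨U, hU, -, ⟨c⟩⟩ := P.exists_logChart ⊤ (p := x) trivial
  refine ⟨U, hU, ?_⟩
  let V : P.logJet.left.Opens := P.logJetProj.left ⁻¹ᵁ U.1
  let e : Γ(P.logJet.left, V) ≃+* P.logJetAlgebra (LogChart.site U) :=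
    .ofBijective _ (P.logJetSections_bijective (LogChart.site U))
  let E (g : Y.pair.X.left ⟶ P.logJet.left) (hg : g ≫ P.logJetProj.left = f.hom.left) :
      P.logJetAlgebra (LogChart.site U) →+* Γ(Y.pair.X.left, f.hom.left ⁻¹ᵁ U.1) :=
    (g.appLE V (f.hom.left ⁻¹ᵁ U.1) (preimage_le_of_comp_eq hg U.1)).hom.comp e.symm.toRingHom
  have hE (g) (hg) (t) : E g hg (e t) =
      (g.appLE V (f.hom.left ⁻¹ᵁ U.1) (preimage_le_of_comp_eq hg U.1)).hom t :=
    congrArg (g.appLE V (f.hom.left ⁻¹ᵁ U.1) (preimage_le_of_comp_eq hg U.1)).hom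
      (e.symm_apply_apply t)
  have hder (g) (hg) (h : ∀ U s, (g.app U).hom (P.logJetField.der U s) =
      Y.field.der _ ((g.app U).hom s)) (s) :
      E g hg (P.logJetDer (LogChart.site U) s) = Y.field.der _ (E g hg s) := by
    obtain ⟨s, rfl⟩ := e.surjective s
    have h1 : P.logJetDer (LogChart.site U) (e s) = e (P.logJetField.der _ s) :=
      (P.logJetSections_der (LogChart.site U) s).symm
    rw [h1, hE g hg, hE g hg]
    exact (congrArg (res (preimage_le_of_comp_eq hg U.1)) (h V s)).trans (Y.field.res _ _)
  have hfn (g) (hg) (a) : E g hg (P.fnHom (LogChart.site U) a) = (f.hom.left.app U.1).hom a := by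
    have h1 : P.fnHom (LogChart.site U) a = e ((P.logJetProj.left.app U.1).hom a) :=
      (P.logJetSections_proj (LogChart.site U) a).symm
    have h2 : P.logJetProj.left.app U.1 ≫
        g.appLE V (f.hom.left ⁻¹ᵁ U.1) (preimage_le_of_comp_eq hg U.1) = f.hom.left.app U.1 := by
      rw [← Scheme.Hom.appLE_eq_app, ← Scheme.Hom.appLE_eq_app, Scheme.Hom.appLE_comp_appLE]
      simp only [hg]
    rw [h1, hE g hg]
    exact RingHom.congr_fun (congrArg CommRingCat.Hom.hom h2) a
  have key : E G hG = E G' hG' := by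
    refine c.hom_ext (d := Y.field.der _) (hder G hG h) (hder G' hG' h')
      (fun a ↦ (hfn G hG a).trans (hfn G' hG' a).symm) fun Z a b hab ↦ ?_
    rw [hfn G hG] at hab
    -- The pull-back of an equation of a component of `D` is invertible off the divisor of `Y`, and
    -- functions are determined there, so it can be cancelled.
    refine Y.pair.res_away_injective _ ((f.isUnit_res_app_eqn c Z).mul_left_cancel ?_)
    have := congrArg (res (inf_le_left : Y.pair.away (f.hom.left ⁻¹ᵁ U.1) ≤ _)) hab
    rwa [map_mul, map_mul] at this
  refine CommRingCat.hom_ext (RingHom.ext fun s ↦ ?_)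
  exact ((hE G hG s).symm.trans (RingHom.congr_fun key (e s))).trans (hE G' hG' s)

variable [CharZero k]

namespace LogPair

/-- The log jet space, with its vector field. -/
noncomputable def logJetLCVS (P : LogPair k) : LCVS k :=
  ⟨⟨P.logJet, P.logJetDivisor, P.hasLogChart_logJet⟩, P.logJetField, P.logJetField_isTangent⟩

/-- The projection from the log jet space, as a morphism of log pairs. -/
noncomputable def logJetProjHom (P : LogPair k) : P.logJetLCVS.pair ⟶ P :=
  LogPair.Hom.mk P.logJetProj fun _ h ↦ h

end LogPair

namespace LCVS

variable {Y : LCVS k} {P : LogPair k}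

/-- The evaluation homomorphisms are compatible with restriction and glue to a morphism over `X`.
The condition on divisors is inherited from `f`, because the divisor upstairs is the preimage of
`D`; compatibility with the vector fields is checked over the affine open subsets of `X`. -/
theorem exists_lift (f : Y.pair ⟶ P) :
    ∃ g : Y ⟶ P.logJetLCVS, (forget k).map g ≫ P.logJetProjHom = f := by
  let F : Y.pair.X.left ⟶ P.X.left := f.hom.left
  obtain ⟨G, hG, happ⟩ := exists_hom_of_affine P.logJetProj.left F
    (fun U ↦ (evalHom f U).comp (P.logJetSections U))
    (fun U a ↦ by
      rw [RingHom.comp_apply, P.logJetSections_proj]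
      exact evalHom_fnHom f U a)
    (fun {U V} h s ↦ by
      rw [RingHom.comp_apply, RingHom.comp_apply]
      exact (evalHom_res f h _).trans (congrArg (evalHom f V) (P.logJetSections_res h s).symm))
  have happ (U : P.X.left.AffineZariskiSite) (s : Γ(P.logJet.left, P.above U)) :
      (G.appLE (P.above U) (F ⁻¹ᵁ U.toOpens) (preimage_le_of_comp_eq hG U.toOpens)).hom s =
        evalHom f U (P.logJetSections U s) := by
    rw [happ]
    rfl
  have hw : G ≫ P.logJet.hom = Y.pair.X.hom := by
    rw [← Over.w P.logJetProj, ← Category.assoc, hG]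
    exact Over.w f.hom
  refine ⟨LCVS.Hom.mk (LogPair.Hom.mk (Over.homMk G hw) fun y hy ↦ f.mem_of_mem y ?_)
    (VectorField.map_der_of_affineCover P.logJetField Y.field G P.above P.isAffineOpen_above
      P.exists_mem_above fun U s ↦ ?_), LogPair.Hom.ext (Over.OverMorphism.ext hG)⟩
  · change F y ∈ P.D
    rw [← hG]
    exact hy
  · have hle : G ⁻¹ᵁ P.above U ≤ F ⁻¹ᵁ U.toOpens := by rw [← hG]; exact le_rfl
    have key (t : Γ(P.logJet.left, P.above U)) :
        (G.app (P.above U)).hom t = res hle (evalHom f U (P.logJetSections U t)) := by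
      rw [← happ]
      have h : G.appLE (P.above U) (F ⁻¹ᵁ U.toOpens) (preimage_le_of_comp_eq hG U.toOpens) ≫
          Y.pair.X.left.presheaf.map (homOfLE hle).op = G.app (P.above U) := by
        rw [Scheme.Hom.appLE_map, Scheme.Hom.appLE_eq_app]
      exact (RingHom.congr_fun (congrArg CommRingCat.Hom.hom h) t).symm
    rw [key, key, P.logJetSections_der, evalHom_der, Y.field.res]

theorem hom_ext_of_proj {g g' : Y ⟶ P.logJetLCVS}
    (h : (forget k).map g ≫ P.logJetProjHom = (forget k).map g' ≫ P.logJetProjHom) : g = g' :=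
  LCVS.Hom.ext (LogPair.Hom.ext (Over.OverMorphism.ext (eq_of_comp_logJetProj
    ((forget k).map g ≫ P.logJetProjHom) rfl
    (congrArg (fun f : LogPair.Hom Y.pair P ↦ f.hom.left) h.symm) g.map_der g'.map_der)))

/-- Morphisms to the log jet space. -/
noncomputable def homEquiv (Y : LCVS k) (P : LogPair k) :
    ((forget k).obj Y ⟶ P) ≃ (Y ⟶ P.logJetLCVS) :=
  (Equiv.ofBijective (fun g : Y ⟶ P.logJetLCVS ↦ (forget k).map g ≫ P.logJetProjHom)
    ⟨fun _ _ h ↦ hom_ext_of_proj h, fun f ↦ exists_lift f⟩).symm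

/-- The inverse of `homEquiv` is composition with the projection, which is visibly natural in `Y`.
-/
theorem homEquiv_naturality (Y' Y : LCVS k) (P : LogPair k) (g : Y' ⟶ Y)
    (f : (forget k).obj Y ⟶ P) :
    homEquiv Y' P ((forget k).map g ≫ f) = g ≫ homEquiv Y P f := by
  obtain ⟨f, rfl⟩ := (homEquiv Y P).symm.surjective f
  rw [Equiv.apply_symm_apply]
  exact (homEquiv Y' P).symm.injective (Equiv.symm_apply_apply ..)

/-- Log jets are right adjoint to the forgetful functor. -/
noncomputable def logJetAdjunction :
    forget k ⊣ Adjunction.rightAdjointOfEquiv homEquiv (homEquiv_naturality (k := k)) :=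
  Adjunction.adjunctionOfEquivRight homEquiv homEquiv_naturality

theorem logJetAdjunction_counit_app (P : LogPair k) :
    logJetAdjunction.counit.app P = P.logJetProjHom :=
  (Adjunction.adjunctionOfEquivRight_counit_app ..).trans (Category.id_comp P.logJetProjHom)

end LCVS

end LogJets

theorem mainTheorem5 (k : Type u) [Field k] [CharZero k] :
    ∃ (hJ : ∀ (P : LogPair k) (p : P.logJet.left), HasLogChart P.logJet P.logJetDivisor p)
      (δ : ∀ P : LogPair k, VectorField P.logJet)
      (hδ : ∀ P : LogPair k, (δ P).IsTangent P.logJetDivisor),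
      -- the reduced divisor is the scheme-theoretic pull-back of `D`
      (∀ P : LogPair k, Scheme.IdealSheafData.vanishingIdeal P.logJetDivisor =
        (Scheme.IdealSheafData.vanishingIdeal P.D).comap P.logJetProj.left) ∧
      -- the vector field is the translation of jets
      (∀ (P : LogPair k) (U : P.X.left.AffineZariskiSite)
        (s : Γ(P.logJet.left, P.logJetProj.left ⁻¹ᵁ U.toOpens)),
        (P.logJetSections U ((δ P).der _ s)).1 =
          JetAlgebra.der (consts P.X (P.away U.toOpens)) (P.logJetSections U s).1) ∧
      -- log jets are right adjoint to the forgetful functor, with the projections as counit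
      ∃ (R : LogPair k ⥤ LCVS k) (adj : LCVS.forget k ⊣ R),
        ∀ P : LogPair k,
          ∃ h : R.obj P = ⟨⟨P.logJet, P.logJetDivisor, hJ P⟩, δ P, hδ P⟩,
            (LCVS.forget k).map (eqToHom h.symm) ≫ adj.counit.app P =
              LogPair.Hom.mk P.logJetProj (fun _ hx ↦ hx) := by
  refine ⟨fun P ↦ P.hasLogChart_logJet, fun P ↦ P.logJetField, fun P ↦ P.logJetField_isTangent,
    fun P ↦ P.vanishingIdeal_logJetDivisor,
    fun P U s ↦ congrArg Subtype.val (P.logJetSections_der U s), _,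
    LCVS.logJetAdjunction,
    -- The right adjoint is constructed with the log jet spaces as its values, so the comparison
    -- morphism is an identity.
    fun P ↦ ⟨rfl, ?_⟩⟩
  exact (Category.id_comp _).trans (LCVS.logJetAdjunction_counit_app P)
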